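/- Let $d\ge 1$, let $\Omega\subset\mathbb{R}^d$ be a polyhedral open bounded connected set, let $0<\underline\lambda\le\overline\lambda$, and let $\Lambda$ be a measurable map from $\Omega$ to the $d\times d$ real matrices such that, for a.e. $x\in\Omega$, $\Lambda(x)$ is symmetric with all its eigenvalues in $[\underline\lambda,\overline\lambda]$. **Discretisations.** A discretisation $\mathcal D=(\mathcal M,\mathcal E,\mathcal P)$ of $\Omega$ consists of the following. (1) A finite family $\mathcal M$ of nonempty connected open pairwise disjoint sets $K\subset\Omega$ with $\overline\Omega=\bigcup_{K\in\mathcal M}\overline K$; $|K|$ is the volume and $h_K$ the diameter of $K$, and $\partial K=\overline K\setminus K$. (2) A finite family $\mathcal E$ of pairwise disjoint sets $\sigma\subset\overline\Omega$, each a nonempty open subset of a hyperplane, with $(d-1)$-dimensional measure $|\sigma|>0$ and relative boundary $\overline\sigma\setminus\sigma$ of zero $(d-1)$-dimensional measure, together with subsets $\mathcal E_K\subset\mathcal E$ such that $\partial K=\bigcup_{\sigma\in\mathcal E_K}\overline\sigma$ for all $K\in\mathcal M$. With $\mathcal M_\sigma=\{K:\sigma\in\mathcal E_K\}$, each $\sigma$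 satisfies either $\#\mathcal M_\sigma=1$ and $\sigma\subset\partial\Omega=\overline\Omega\setminus\Omega$ ($\sigma\in\mathcal E_{\rm ext}$), or $\#\mathcal M_\sigma=2$ ($\sigma\in\mathcal E_{\rm int}$). Let $x_\sigma$ be the barycentre of $\sigma$ and, for $\sigma\in\mathcal E_K$, let $n_{K,\sigma}$ be the unit normal to $\sigma$ outward to $K$. (3) Points $x_K\in K$ such that $K$ is star-shaped with respect to $x_K$ and, for each $\sigma\in\mathcal E_K$, the distance $d_{K,\sigma}$ from $x_K$ to the hyperplane containing $\sigma$ is positive. Let $D_{K,\sigma}$ be the cone with vertex $x_K$ and basis $\sigma$. Set $h_{\mathcal D}=\max_K h_K$ and $\theta_{\mathcal D}=\max\Big(\max_{\sigma\in\mathcal E_{\rm int},\,K,L\in\mathcal M_\sigma}\frac{d_{K,\sigma}}{d_{L,\sigma}},\ \max_{K\in\mathcal M,\,\sigma\in\mathcal E_K}\frac{h_K}{d_{K,\sigma}}\Big)$. Let $X_{\mathcal D}$ be the space of real families $v=((v_K)_{K\in\mathcal M},(v_\sigma)_{\sigma\in\mathcal E})$, let $X_{\mathcal D,0}=\{v\in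 X_{\mathcal D}:v_\sigma=0\ \forall\sigma\in\mathcal E_{\rm ext}\}$, and let $|v|_X^2=\sum_{K}\sum_{\sigma\in\mathcal E_K}\frac{|\sigma|}{d_{K,\sigma}}(v_\sigma-v_K)^2$. Write $\Pi_{\mathcal M}v$ for the function equal to $v_K$ on each $K$, and $P_{\mathcal D}\varphi=((\varphi(x_K))_K,(\varphi(x_\sigma))_\sigma)$, where $\varphi\in C_c^\infty(\Omega)$ is extended by zero to $\mathbb R^d$. **Discrete gradient.** For $u\in X_{\mathcal D}$, let $\nabla_{\mathcal D}u$ be equal on $D_{K,\sigma}$ to $$\nabla_{K,\sigma}u=\nabla_Ku+R_{K,\sigma}u\;n_{K,\sigma},\qquad \nabla_Ku=\frac1{|K|}\sum_{\sigma\in\mathcal E_K}|\sigma|(u_\sigma-u_K)n_{K,\sigma},\qquad R_{K,\sigma}u=\frac{\sqrt d}{d_{K,\sigma}}\big(u_\sigma-u_K-\nabla_Ku\cdot(x_\sigma-x_K)\big).$$ **SUSHI fluxes.** For $\sigma,\sigma'\in\mathcal E_K$ let $$y^{\sigma\sigma'}=\frac{|\sigma'|}{|K|}n_{K,\sigma'}+\frac{\sqrt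 d}{d_{K,\sigma}}\Big(\delta_{\sigma\sigma'}-\frac{|\sigma'|}{|K|}n_{K,\sigma'}\cdot(x_\sigma-x_K)\Big)n_{K,\sigma},$$ where $\delta_{\sigma\sigma'}=1$ if $\sigma=\sigma'$ and $0$ otherwise, and let $$A_K^{\sigma\sigma'}=\sum_{\sigma''\in\mathcal E_K}y^{\sigma''\sigma}\cdot\Big(\int_{D_{K,\sigma''}}\Lambda\,dx\Big)y^{\sigma''\sigma'},\qquad F^{\mathcal D}_{K,\sigma}(u)=\sum_{\sigma'\in\mathcal E_K}A_K^{\sigma\sigma'}(u_K-u_{\sigma'}).$$ Put $\langle u,v\rangle_F=\sum_K\sum_{\sigma\in\mathcal E_K}F^{\mathcal D}_{K,\sigma}(u)(v_K-v_\sigma)$. **Statement.** Let $\mathcal F$ be a family of discretisations of $\Omega$ for which there is $\theta>0$ with $\theta_{\mathcal D}\le\theta$ for all $\mathcal D\in\mathcal F$. Then $\langle u,v\rangle_F=\int_\Omega\nabla_{\mathcal D}u\cdot\Lambda\nabla_{\mathcal D}v\,dx$ for all $\mathcal D\in\mathcal F$ and $u,v\in X_{\mathcal D}$, and the family of fluxes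 $((F^{\mathcal D}_{K,\sigma})_{K,\sigma})_{\mathcal D\in\mathcal F}$ is - continuous: there is $M>0$ with $\langle u,v\rangle_F\le M|u|_X|v|_X$ for all $\mathcal D\in\mathcal F$ and $u,v\in X_{\mathcal D}$; - coercive: there is $\alpha>0$ with $\alpha|u|_X^2\le\langle u,u\rangle_F$ for all $\mathcal D\in\mathcal F$ and $u\in X_{\mathcal D}$; - consistent: suppose that $\mathcal F$ contains discretisations of arbitrarily small size. If $u_{\mathcal D}\in X_{\mathcal D,0}$ for all $\mathcal D\in\mathcal F$, if $|u_{\mathcal D}|_X\le C$ for some $C>0$ and all $\mathcal D\in\mathcal F$, and if $u\in L^2(\Omega)$ satisfies $\lim_{h_{\mathcal D}\to0}\|\Pi_{\mathcal M}u_{\mathcal D}-u\|_{L^2(\Omega)}=0$, then $u$ has zero boundary values in the sense that its extension by zero belongs to $H^1(\mathbb R^d)$, and $$\lim_{h_{\mathcal D}\to0}\langle u_{\mathcal D},P_{\mathcal D}\varphi\rangle_F=\int_\Omega\Lambda\nabla\varphi\cdot\nabla u\,dx\qquad\forall\varphi\in C_c^\infty(\Omega);$$ - symmetric: $\langle u,v\rangle_F=\langle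 v,u\rangle_F$ for all $\mathcal D\in\mathcal F$ and $u,v\in X_{\mathcal D}$. -/

import Mathlib

open MeasureTheory Filter Topology
open scoped ContDiff

noncomputable section

namespace Sushi

/-- Euclidean space `ℝ^d`. -/
abbrev Pt (d : ℕ) := EuclideanSpace ℝ (Fin d)

/-- A discretisation `(M, E, P)` of `Ω ⊆ ℝ^d`: control volumes `cell K`, edges `edge σ` lying in
the hyperplanes `plane σ`, the sets `edgesOf K` of edges of a control volume, and the points
`center K`. Both families are finite and are indexed by `Fin numCells` and `Fin numEdges`. The
`(d-1)`-dimensional measure is the Hausdorff measure normalised so as to agree with Lebesgue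
measure on hyperplanes. -/
structure Discretisation (d : ℕ) (Ω : Set (Pt d)) where
  numCells : ℕ
  numEdges : ℕ
  cell : Fin numCells → Set (Pt d)
  edge : Fin numEdges → Set (Pt d)
  plane : Fin numEdges → AffineSubspace ℝ (Pt d)
  edgesOf : Fin numCells → Finset (Fin numEdges)
  center : Fin numCells → Pt d
  -- control volumes
  cell_isOpen : ∀ K, IsOpen (cell K)
  cell_isConnected : ∀ K, IsConnected (cell K)
  cell_subset : ∀ K, cell K ⊆ Ω
  cell_disjoint : Pairwise fun K L => Disjoint (cell K) (cell L)
  closure_eq : closure Ω = ⋃ K, closure (cell K)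
  -- edges
  edge_subset : ∀ σ, edge σ ⊆ closure Ω
  edge_disjoint : Pairwise fun σ τ => Disjoint (edge σ) (edge τ)
  edge_nonempty : ∀ σ, (edge σ).Nonempty
  plane_finrank : ∀ σ, Module.finrank ℝ (plane σ).direction + 1 = d
  edge_open : ∀ σ, ∃ U : Set (Pt d), IsOpen U ∧ edge σ = U ∩ (plane σ : Set (Pt d))
  edge_measure_pos : ∀ σ, 0 < μHE[d - 1] (edge σ)
  /-- The edges are polyhedral; all that is required is that their relative boundary has zero
  `(d-1)`-dimensional measure, which rules out, e.g., complements of fat Cantor sets. -/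
  edge_boundary_null : ∀ σ, μHE[d - 1] (closure (edge σ) \ edge σ) = 0
  boundary_eq : ∀ K, closure (cell K) \ cell K = ⋃ σ ∈ edgesOf K, closure (edge σ)
  /-- Each edge either belongs to exactly one control volume, and then lies on `∂Ω`, or belongs to
  exactly two. -/
  edge_cells : ∀ σ,
    ((Finset.univ.filter fun K => σ ∈ edgesOf K).card = 1 ∧ edge σ ⊆ closure Ω \ Ω) ∨
      (Finset.univ.filter fun K => σ ∈ edgesOf K).card = 2
  -- points
  center_mem : ∀ K, center K ∈ cell K
  starShaped : ∀ K, StarConvex ℝ (center K) (cell K)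
  dist_plane_pos : ∀ K, ∀ σ ∈ edgesOf K,
    0 < Metric.infDist (center K) (plane σ : Set (Pt d))

namespace Discretisation

variable {d : ℕ} {Ω : Set (Pt d)} (D : Discretisation d Ω)

/-- Index set of the control volumes. -/
abbrev Cell := Fin D.numCells

/-- Index set of the edges. -/
abbrev Edge := Fin D.numEdges

/-- `M_σ`: the control volumes having `σ` as an edge. -/
def cellsOf (σ : D.Edge) : Finset D.Cell := Finset.univ.filter fun K => σ ∈ D.edgesOf K

/-- `σ` is a boundary interface. -/
def IsExt (σ : D.Edge) : Prop := (D.cellsOf σ).card = 1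

/-- `σ` is an interior interface. -/
def IsInt (σ : D.Edge) : Prop := (D.cellsOf σ).card = 2

/-- `|K|`. -/
def cellVol (K : D.Cell) : ℝ := volume.real (D.cell K)

/-- `|σ|`. -/
def edgeVol (σ : D.Edge) : ℝ := (μHE[d - 1] : Measure (Pt d)).real (D.edge σ)

/-- The diameter `h_K`. -/
def cellDiam (K : D.Cell) : ℝ := Metric.diam (D.cell K)

/-- `x_σ`, the barycentre of `σ`. -/
def bary (σ : D.Edge) : Pt d := ⨍ y in D.edge σ, y ∂(μHE[d - 1])

/-- `d_{K,σ}`, the distance from `x_K` to the hyperplane that contains `σ`. -/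
def dist (K : D.Cell) (σ : D.Edge) : ℝ :=
  Metric.infDist (D.center K) (D.plane σ : Set (Pt d))

/-- `n` is a unit vector normal to `σ` and outward to `K`. -/
def IsOutwardUnitNormal (K : D.Cell) (σ : D.Edge) (n : Pt d) : Prop :=
  ‖n‖ = 1 ∧ (∀ w ∈ (D.plane σ).direction, inner ℝ n w = 0) ∧
    ∀ y ∈ D.edge σ, ∀ᶠ t : ℝ in 𝓝[>] 0, y - t • n ∈ D.cell K ∧ y + t • n ∉ D.cell K

/-- `n_{K,σ}`, the unit vector normal to `σ` outward to `K` (used for `σ ∈ E_K` only). -/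
def normal (K : D.Cell) (σ : D.Edge) : Pt d := Classical.epsilon (D.IsOutwardUnitNormal K σ)

/-- `D_{K,σ}`, the (open) cone with vertex `x_K` and basis `σ`. -/
def cone (K : D.Cell) (σ : D.Edge) : Set (Pt d) :=
  {x | ∃ y ∈ D.edge σ, ∃ t ∈ Set.Ioo (0 : ℝ) 1, x = D.center K + t • (y - D.center K)}

/-- The mesh size `h_D`. -/
def size : ℝ := ⨆ K, D.cellDiam K

/-- The mesh regularity `θ_D`, the largest of the ratios `d_{K,σ} / d_{L,σ}` (`σ` interior,
`K, L ∈ M_σ`) and `h_K / d_{K,σ}` (`σ ∈ E_K`). -/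
def theta : ℝ :=
  sSup ({r | ∃ σ, D.IsInt σ ∧ ∃ K ∈ D.cellsOf σ, ∃ L ∈ D.cellsOf σ, r = D.dist K σ / D.dist L σ} ∪
    {r | ∃ K, ∃ σ ∈ D.edgesOf K, r = D.cellDiam K / D.dist K σ})

/-- The space `X_D` of discrete unknowns `((v_K)_K, (v_σ)_σ)`. -/
abbrev X := (D.Cell → ℝ) × (D.Edge → ℝ)

/-- Membership in `X_{D,0}`: the unknowns vanish on the boundary interfaces. -/
def MemX0 (v : D.X) : Prop := ∀ σ, D.IsExt σ → v.2 σ = 0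

/-- The seminorm `|v|_X`. -/
def seminormX (v : D.X) : ℝ :=
  √(∑ K, ∑ σ ∈ D.edgesOf K, D.edgeVol σ / D.dist K σ * (v.2 σ - v.1 K) ^ 2)

/-- `Π_M v`: the function equal to `v_K` on each control volume `K`. -/
def proj (v : D.X) (x : Pt d) : ℝ := ∑ K, (D.cell K).indicator (fun _ => v.1 K) x

/-- `P_D φ`: the values of `φ` at the points `x_K` and `x_σ`. -/
def interp (φ : Pt d → ℝ) : D.X := (fun K => φ (D.center K), fun σ => φ (D.bary σ))

/-- `∇_K u`. -/
def gradCell (u : D.X) (K : D.Cell) : Pt d :=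
  (D.cellVol K)⁻¹ • ∑ σ ∈ D.edgesOf K, (D.edgeVol σ * (u.2 σ - u.1 K)) • D.normal K σ

/-- The stabilisation term `R_{K,σ} u`. -/
def stab (u : D.X) (K : D.Cell) (σ : D.Edge) : ℝ :=
  √(d : ℝ) / D.dist K σ *
    (u.2 σ - u.1 K - inner ℝ (D.gradCell u K) (D.bary σ - D.center K))

/-- The stabilised gradient `∇_{K,σ} u`. -/
def gradCone (u : D.X) (K : D.Cell) (σ : D.Edge) : Pt d :=
  D.gradCell u K + D.stab u K σ • D.normal K σ

/-- The discrete gradient `∇_D u`, equal to `∇_{K,σ} u` on each cone `D_{K,σ}`. -/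
def grad (u : D.X) (x : Pt d) : Pt d :=
  ∑ K, ∑ σ ∈ D.edgesOf K, (D.cone K σ).indicator (fun _ => D.gradCone u K σ) x

/-- The vectors `y^{σσ'}` of the control volume `K`. -/
def yVec (K : D.Cell) (σ σ' : D.Edge) : Pt d :=
  if σ = σ' then
    (D.edgeVol σ / D.cellVol K) • D.normal K σ +
      (√(d : ℝ) / D.dist K σ * (1 - D.edgeVol σ / D.cellVol K *
        inner ℝ (D.normal K σ) (D.bary σ - D.center K))) • D.normal K σ
  else
    (D.edgeVol σ' / D.cellVol K) • D.normal K σ' -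
      (√(d : ℝ) / (D.dist K σ * D.cellVol K) * D.edgeVol σ' *
        inner ℝ (D.normal K σ') (D.bary σ - D.center K)) • D.normal K σ

/-- `Λ_{K,σ} = ∫_{D_{K,σ}} Λ(x) dx`. -/
def coneIntegral (Λ : Pt d → Matrix (Fin d) (Fin d) ℝ) (K : D.Cell) (σ : D.Edge) :
    Matrix (Fin d) (Fin d) ℝ :=
  Matrix.of fun i j => ∫ x in D.cone K σ, Λ x i j

/-- The local matrix `A_K^{σσ'}`. -/
def localMatrix (Λ : Pt d → Matrix (Fin d) (Fin d) ℝ) (K : D.Cell) (σ σ' : D.Edge) : ℝ :=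
  ∑ τ ∈ D.edgesOf K,
    inner ℝ (D.yVec K τ σ) (Matrix.toEuclideanLin (D.coneIntegral Λ K τ) (D.yVec K τ σ'))

/-- The linear form `u ↦ u_K - u_σ` on `X_D`. -/
def diffForm (K : D.Cell) (σ : D.Edge) : D.X →ₗ[ℝ] ℝ :=
  LinearMap.proj K ∘ₗ LinearMap.fst ℝ (D.Cell → ℝ) (D.Edge → ℝ) -
    LinearMap.proj σ ∘ₗ LinearMap.snd ℝ (D.Cell → ℝ) (D.Edge → ℝ)

/-- A collection of numerical fluxes `(F_{K,σ})` on `D`: linear forms on `X_D`. -/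
abbrev Fluxes := D.Cell → D.Edge → (D.X →ₗ[ℝ] ℝ)

/-- The SUSHI fluxes `F_{K,σ}(u) = ∑_{σ'} A_K^{σσ'} (u_K - u_{σ'})`. -/
def sushiFlux (Λ : Pt d → Matrix (Fin d) (Fin d) ℝ) : D.Fluxes := fun K σ =>
  ∑ σ' ∈ D.edgesOf K, D.localMatrix Λ K σ σ' • D.diffForm K σ'

/-- The bilinear form `⟨u, v⟩_F`. -/
def form (F : D.Fluxes) (u v : D.X) : ℝ :=
  ∑ K, ∑ σ ∈ D.edgesOf K, F K σ u * (v.1 K - v.2 σ)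

end Discretisation

/-- `φ ∈ C_c^∞(U)`. -/
def IsTest {d : ℕ} (U : Set (Pt d)) (φ : Pt d → ℝ) : Prop :=
  ContDiff ℝ ∞ φ ∧ HasCompactSupport φ ∧ tsupport φ ⊆ U

/-- `u ∈ L²(U)` has the weak gradient `G ∈ L²(U)^d` on the open set `U`. -/
def HasWeakGradient {d : ℕ} (U : Set (Pt d)) (u : Pt d → ℝ) (G : Pt d → Pt d) : Prop :=
  MemLp u 2 (volume.restrict U) ∧ MemLp G 2 (volume.restrict U) ∧
    ∀ φ, IsTest U φ → ∫ x in U, u x • gradient φ x = -∫ x in U, φ x • G x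

/-- The extension of `u` by zero outside `Ω` belongs to `H^1(ℝ^d)`, the form in which membership
of `u` in `H^1_0(Ω)` is expressed. -/
def ZeroExtensionMemH1 {d : ℕ} (Ω : Set (Pt d)) (u : Pt d → ℝ) : Prop :=
  ∃ G, HasWeakGradient Set.univ (Ω.indicator u) G

/-- The diffusion field: `Λ` is measurable on `Ω` and, for a.e. `x ∈ Ω`, symmetric with all its
eigenvalues in `[lo, hi]`. -/
def IsDiffusionField {d : ℕ} (Ω : Set (Pt d)) (lo hi : ℝ)
    (Λ : Pt d → Matrix (Fin d) (Fin d) ℝ) : Prop :=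
  (∀ i j, Measurable fun x : Ω => Λ x i j) ∧
    ∀ᵐ x ∂(volume.restrict Ω), (Λ x).IsSymm ∧ spectrum ℝ (Λ x) ⊆ Set.Icc lo hi

section Families

variable {d : ℕ} {Ω : Set (Pt d)} {ι : Type*} (D : ι → Discretisation d Ω)

/-- The filter `h_D → 0` on a family of discretisations. -/
def sizeToZero : Filter ι := comap (fun i => (D i).size) (𝓝 0)

/-- Continuous family of fluxes. -/
def IsContinuousFamily (Φ : ∀ i, (D i).Fluxes) : Prop :=
  ∃ M > 0, ∀ i, ∀ u v : (D i).X,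
    (D i).form (Φ i) u v ≤ M * (D i).seminormX u * (D i).seminormX v

/-- Coercive family of fluxes. -/
def IsCoerciveFamily (Φ : ∀ i, (D i).Fluxes) : Prop :=
  ∃ α > 0, ∀ i, ∀ u : (D i).X, α * (D i).seminormX u ^ 2 ≤ (D i).form (Φ i) u u

/-- Consistent family of fluxes. A limit as `h_D → 0` presupposes that the family contains
discretisations of arbitrarily small size, hence the requirement `NeBot`. -/
def IsConsistentFamily (Λ : Pt d → Matrix (Fin d) (Fin d) ℝ) (Φ : ∀ i, (D i).Fluxes) : Prop :=
  (sizeToZero D).NeBot →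
    ∀ (w : ∀ i, (D i).X) (u : Pt d → ℝ),
      (∀ i, (D i).MemX0 (w i)) →
      (∃ C > 0, ∀ i, (D i).seminormX (w i) ≤ C) →
      MemLp u 2 (volume.restrict Ω) →
      Tendsto (fun i => eLpNorm (fun x => (D i).proj (w i) x - u x) 2 (volume.restrict Ω))
        (sizeToZero D) (𝓝 0) →
      ZeroExtensionMemH1 Ω u ∧
        ∀ G, HasWeakGradient Ω u G → ∀ φ, IsTest Ω φ →
          Tendsto (fun i => (D i).form (Φ i) (w i) ((D i).interp φ)) (sizeToZero D)
            (𝓝 (∫ x in Ω, inner ℝ (Matrix.toEuclideanLin (Λ x) (gradient φ x)) (G x)))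

/-- Symmetric family of fluxes. -/
def IsSymmetricFamily (Φ : ∀ i, (D i).Fluxes) : Prop :=
  ∀ i, ∀ u v : (D i).X, (D i).form (Φ i) u v = (D i).form (Φ i) v u

end Families

end Sushi

end

/-
Every cell is a star domain whose gauge with respect to `x_K` is affine on each cone `D_{K,σ}`.
Testing the divergence theorem with the resulting hat function of the cell gives
`∑ |σ| n_{K,σ} = 0` and `∑ |σ| (a · (x_σ - x_K)) n_{K,σ} = |K| a`. The second identity makes
`∇_K` exact on affine functions and the stabilisation `R_{K,σ} n_{K,σ}` orthogonal to constants on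
each cell, so that the `L²` norm of `∇_D u` is equivalent to `|u|_X`, with constants depending only
on `d` and `θ`. Since `⟨u, v⟩_F` is the integral of `∇_D u · Λ ∇_D v`, continuity and coercivity
follow from the bounds on the spectrum of `Λ`.

For consistency, the discrete gradients of `u_D` are bounded in `L²`, and by discrete integration by
parts each of their weak limits is a weak gradient of the zero extension of `u`. As weak gradients
are unique, the discrete gradients converge weakly along the whole family, and `∇_D (P_D φ)`
converges to `∇ φ` uniformly, so the form passes to the limit.
-/

noncomputable section

namespace Sushi

section Cones

variable {E : Type*} [NormedAddCommGroup E] [InnerProductSpace ℝ E] {c m : E} {B : Set E}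

/-- The open cone with vertex `c` and basis `B`. -/
def coneOver (c : E) (B : Set E) : Set E :=
  {x | ∃ y ∈ B, ∃ t ∈ Set.Ioo (0 : ℝ) 1, x = c + t • (y - c)}

/-- The affine function with gradient `m` that vanishes at `c`. A hyperplane at positive distance
`δ` from `c`, with unit normal `n` pointing away from `c`, is its level set `1` for `m = δ⁻¹ • n`,
so that a single vector `m` encodes both `δ = ‖m‖⁻¹` and `n`. -/
def level (c m x : E) : ℝ := inner ℝ m (x - c)

/-- The central projection, with centre `c`, of `x` onto the hyperplane `level c m = 1`. -/
def foot (c m x : E) : E := c + (level c m x)⁻¹ • (x - c)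

lemma continuous_level : Continuous (level c m) := by
  unfold level; fun_prop

lemma lipschitzWith_level : LipschitzWith ‖m‖₊ (level c m) :=
  LipschitzWith.of_dist_le_mul fun x y => by
    rw [Real.dist_eq, level, level, ← inner_sub_right, sub_sub_sub_cancel_right, dist_eq_norm]
    exact abs_real_inner_le_norm _ _

lemma level_self : level c m c = 0 := by simp [level]

lemma level_homothety (t : ℝ) (y : E) : level c m (c + t • (y - c)) = t * level c m y := by
  simp [level, inner_smul_right]

lemma level_add_smul (x v : E) (t : ℝ) :
    level c m (x + t • v) = level c m x + t * inner ℝ m v := by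
  simp only [level, add_sub_right_comm x, inner_add_right, inner_smul_right]

lemma foot_homothety {y : E} (hy : level c m y = 1) {t : ℝ} (ht : t ≠ 0) :
    foot c m (c + t • (y - c)) = y := by
  simp [foot, level_homothety, hy, smul_smul, ht]

lemma add_level_smul_foot {x : E} (hx : level c m x ≠ 0) :
    c + level c m x • (foot c m x - c) = x := by
  simp [foot, smul_smul, hx]

lemma mem_coneOver_iff (hB : ∀ y ∈ B, level c m y = 1) {x : E} :
    x ∈ coneOver c B ↔ level c m x ∈ Set.Ioo 0 1 ∧ foot c m x ∈ B := by
  constructor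
  · rintro ⟨y, hy, t, ht, rfl⟩
    rw [level_homothety, hB y hy, mul_one, foot_homothety (hB y hy) ht.1.ne']
    exact ⟨ht, hy⟩
  · rintro ⟨ht, hy⟩
    exact ⟨_, hy, _, ht, (add_level_smul_foot ht.1.ne').symm⟩

lemma coneOver_inter_level (hB : ∀ y ∈ B, level c m y = 1) {t : ℝ} (ht : t ∈ Set.Ioo (0 : ℝ) 1) :
    coneOver c B ∩ {x | level c m x = t} = AffineMap.homothety c t '' B := by
  ext x
  simp only [Set.mem_inter_iff, Set.mem_ofPred_eq, Set.mem_image, AffineMap.homothety_apply,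
    vsub_eq_sub, vadd_eq_add, add_comm _ c]
  constructor
  · rintro ⟨hx, rfl⟩
    exact ⟨_, ((mem_coneOver_iff hB).1 hx).2, add_level_smul_foot ht.1.ne'⟩
  · rintro ⟨y, hy, rfl⟩
    exact ⟨⟨y, hy, t, ht, rfl⟩, by rw [level_homothety, hB y hy, mul_one]⟩

lemma setIntegral_Ioo_pow (k : ℕ) : ∫ t in Set.Ioo (0 : ℝ) 1, t ^ k = 1 / (k + 1) := by
  rw [← integral_Ioc_eq_integral_Ioo, ← intervalIntegral.integral_of_le zero_le_one, integral_pow]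
  simp

lemma lintegral_Ioo_pow (k : ℕ) :
    ∫⁻ t in Set.Ioo (0 : ℝ) 1, ENNReal.ofReal (t ^ k) = ENNReal.ofReal (1 / (k + 1)) := by
  have hint : IntegrableOn (fun t : ℝ => t ^ k) (Set.Ioo 0 1) :=
    (continuous_pow k).integrableOn_Icc.mono_set Set.Ioo_subset_Icc_self
  rw [← setIntegral_Ioo_pow, ofReal_integral_eq_lintegral_ofReal hint]
  filter_upwards [ae_restrict_mem measurableSet_Ioo] with t ht using pow_nonneg ht.1.le _

lemma finrank_pos_of_ne_zero [FiniteDimensional ℝ E] (hm : m ≠ 0) : 0 < Module.finrank ℝ E :=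
  Module.finrank_pos_iff_exists_ne_zero.2 ⟨m, hm⟩

/-- The distribution of the level on a cone whose basis has unit measure. -/
def coneLevelMeasure (m : E) : Measure ℝ :=
  (volume.restrict (Set.Ioo 0 1)).withDensity
    fun t => ENNReal.ofReal (‖m‖⁻¹ * t ^ (Module.finrank ℝ E - 1))

lemma coneLevelMeasure_apply {A : Set ℝ} (hA : MeasurableSet A) :
    coneLevelMeasure m A = ENNReal.ofReal ‖m‖⁻¹ *
      ∫⁻ t in A ∩ Set.Ioo 0 1, ENNReal.ofReal (t ^ (Module.finrank ℝ E - 1)) := by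
  rw [coneLevelMeasure, withDensity_apply _ hA, Measure.restrict_restrict hA]
  simp_rw [ENNReal.ofReal_mul (inv_nonneg.2 (norm_nonneg m))]
  exact lintegral_const_mul _ (by fun_prop)

instance : IsFiniteMeasure (coneLevelMeasure m) where
  measure_univ_lt_top := by
    rw [coneLevelMeasure_apply MeasurableSet.univ, Set.univ_inter, lintegral_Ioo_pow]
    exact ENNReal.mul_lt_top ENNReal.ofReal_lt_top ENNReal.ofReal_lt_top

lemma integral_id_coneLevelMeasure [FiniteDimensional ℝ E] (hm : m ≠ 0) :
    ∫ t, t ∂coneLevelMeasure m = ‖m‖⁻¹ / (Module.finrank ℝ E + 1) := by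
  have hdens : ∀ t ∈ Set.Ioo (0 : ℝ) 1,
      (ENNReal.ofReal (‖m‖⁻¹ * t ^ (Module.finrank ℝ E - 1))).toReal • t =
        ‖m‖⁻¹ * t ^ Module.finrank ℝ E := by
    intro t ht
    have h0 := ht.1.le
    rw [ENNReal.toReal_ofReal (by positivity), smul_eq_mul, mul_assoc, ← pow_succ,
      Nat.sub_add_cancel (finrank_pos_of_ne_zero hm)]
  rw [coneLevelMeasure, integral_withDensity_eq_integral_toReal_smul (by fun_prop)
      (ae_of_all _ fun _ => ENNReal.ofReal_lt_top),
    setIntegral_congr_fun measurableSet_Ioo hdens, integral_const_mul, setIntegral_Ioo_pow,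
    mul_one_div]

variable [MeasurableSpace E] [BorelSpace E]

lemma measurable_level : Measurable (level c m) := continuous_level.measurable

variable [FiniteDimensional ℝ E]

lemma measurable_foot : Measurable (foot c m) := by
  have := measurable_level (c := c) (m := m)
  unfold foot; fun_prop

lemma measurableSet_coneOver (hB : ∀ y ∈ B, level c m y = 1) (hBm : MeasurableSet B) :
    MeasurableSet (coneOver c B) := by
  have hcone : coneOver c B = level c m ⁻¹' Set.Ioo 0 1 ∩ foot c m ⁻¹' B :=
    Set.ext fun _ => mem_coneOver_iff hB
  rw [hcone]
  exact (measurable_level measurableSet_Ioo).inter (measurable_foot hBm)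

lemma volume_eq_lintegral_level (hm : m ≠ 0) {s : Set E} (hs : MeasurableSet s) :
    volume s = ENNReal.ofReal ‖m‖⁻¹ *
      ∫⁻ t : ℝ, μHE[Module.finrank ℝ E - 1] (s ∩ {x | level c m x = t}) := by
  have hm0 : ‖m‖ ≠ 0 := norm_ne_zero_iff.2 hm
  have hv : (‖m‖ ^ 2)⁻¹ • m ≠ 0 := smul_ne_zero (by positivity) hm
  have hplane (t : ℝ) : (AffineSubspace.mk' (t • (‖m‖ ^ 2)⁻¹ • m +ᵥ c)
      (Submodule.span ℝ {(‖m‖ ^ 2)⁻¹ • m})ᗮ : Set E) = {x | level c m x = t} := by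
    ext x
    rw [SetLike.mem_coe, AffineSubspace.mem_mk', Submodule.mem_orthogonal_singleton_iff_inner_right,
      vsub_eq_sub, vadd_eq_add, sub_add_eq_sub_sub_swap, inner_sub_right, inner_smul_left,
      inner_smul_left, inner_smul_right, inner_smul_right, real_inner_self_eq_norm_sq]
    simp only [conj_trivial, ← mul_sub, mul_eq_zero, inv_eq_zero, pow_eq_zero_iff two_ne_zero, hm0,
      false_or, inv_mul_cancel₀ (pow_ne_zero 2 hm0), mul_one, sub_eq_zero, Set.mem_ofPred_eq, level]
  rw [← InnerProductSpace.euclideanHausdorffMeasure_eq_volume,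
    EuclideanGeometry.euclideanHausdorffMeasure_eq_lintegral c hv hs]
  simp only [hplane]
  congr 1
  rw [← ofReal_norm, norm_smul, norm_inv, norm_pow, norm_norm, pow_two, mul_inv, mul_assoc,
    inv_mul_cancel₀ hm0, mul_one]

lemma volume_coneOver_inter_level (hm : m ≠ 0) (hB : ∀ y ∈ B, level c m y = 1)
    (hBm : MeasurableSet B) {A : Set ℝ} (hA : MeasurableSet A) :
    volume (coneOver c B ∩ level c m ⁻¹' A) =
      ENNReal.ofReal ‖m‖⁻¹ * (∫⁻ t in A ∩ Set.Ioo 0 1,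
        ENNReal.ofReal (t ^ (Module.finrank ℝ E - 1))) * μHE[Module.finrank ℝ E - 1] B := by
  have hslice (t : ℝ) : μHE[Module.finrank ℝ E - 1]
      (coneOver c B ∩ level c m ⁻¹' A ∩ {x | level c m x = t}) = (A ∩ Set.Ioo 0 1).indicator
        (fun t => ENNReal.ofReal (t ^ (Module.finrank ℝ E - 1)) *
          μHE[Module.finrank ℝ E - 1] B) t := by
    by_cases ht : t ∈ A ∩ Set.Ioo 0 1
    · have hset : coneOver c B ∩ level c m ⁻¹' A ∩ {x | level c m x = t} =
          AffineMap.homothety c t '' B := by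
        rw [← coneOver_inter_level hB ht.2]
        ext x
        simp only [Set.mem_inter_iff, Set.mem_preimage, Set.mem_ofPred_eq]
        exact ⟨fun h => ⟨h.1.1, h.2⟩, fun h => ⟨⟨h.1, h.2 ▸ ht.1⟩, h.2⟩⟩
      rw [hset, euclideanHausdorffMeasure_homothety_image _ _ ht.2.1.ne', Set.indicator_of_mem ht,
        ENNReal.smul_def, smul_eq_mul, ENNReal.ofReal_pow ht.2.1.le, ENNReal.coe_pow,
        ← enorm_eq_nnnorm, Real.enorm_of_nonneg ht.2.1.le]
    · have hset : coneOver c B ∩ level c m ⁻¹' A ∩ {x | level c m x = t} = ∅ := by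
        refine Set.eq_empty_of_forall_notMem ?_
        rintro x ⟨⟨hx, hA⟩, rfl⟩
        exact ht ⟨hA, ((mem_coneOver_iff hB).1 hx).1⟩
      rw [hset, measure_empty, Set.indicator_of_notMem ht]
  rw [volume_eq_lintegral_level (c := c) hm
    ((measurableSet_coneOver hB hBm).inter (measurable_level hA)), mul_assoc]
  simp_rw [hslice]
  rw [lintegral_indicator (hA.inter measurableSet_Ioo), lintegral_mul_const _ (by fun_prop)]

lemma volume_coneOver (hm : m ≠ 0) (hB : ∀ y ∈ B, level c m y = 1) (hBm : MeasurableSet B) :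
    volume (coneOver c B) =
      ENNReal.ofReal (‖m‖⁻¹ / Module.finrank ℝ E) * μHE[Module.finrank ℝ E - 1] B := by
  have h := volume_coneOver_inter_level hm hB hBm MeasurableSet.univ
  rw [Set.preimage_univ, Set.inter_univ, Set.univ_inter, lintegral_Ioo_pow,
    ← ENNReal.ofReal_mul (by positivity), ← Nat.cast_add_one,
    Nat.sub_add_cancel (finrank_pos_of_ne_zero hm), mul_one_div] at h
  exact h

lemma map_level_foot_volume_coneOver (hm : m ≠ 0) (hB : ∀ y ∈ B, level c m y = 1)
    (hBm : MeasurableSet B) (hBf : μHE[Module.finrank ℝ E - 1] B ≠ ⊤) :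
    (volume.restrict (coneOver c B)).map (fun x => (level c m x, foot c m x)) =
      (coneLevelMeasure m).prod ((μHE[Module.finrank ℝ E - 1]).restrict B) := by
  have hfin : IsFiniteMeasure ((μHE[Module.finrank ℝ E - 1] : Measure E).restrict B) :=
    isFiniteMeasure_restrict.2 hBf
  have hmeas : Measurable fun x => (level c m x, foot c m x) :=
    measurable_level.prodMk measurable_foot
  refine (Measure.prod_eq fun A C hA hC => ?_).symm
  have hset : (fun x => (level c m x, foot c m x)) ⁻¹' A ×ˢ C ∩ coneOver c B =
      coneOver c (C ∩ B) ∩ level c m ⁻¹' A := by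
    ext x
    simp only [Set.mem_inter_iff, Set.mem_preimage, Set.mem_prod, mem_coneOver_iff hB,
      mem_coneOver_iff fun y (hy : y ∈ C ∩ B) => hB y hy.2]
    tauto
  rw [Measure.map_apply hmeas (hA.prod hC), Measure.restrict_apply (hmeas (hA.prod hC)), hset,
    volume_coneOver_inter_level hm (fun y hy => hB y hy.2) (hC.inter hBm) hA,
    coneLevelMeasure_apply hA, Measure.restrict_apply hC]

lemma setIntegral_coneOver_sub (hm : m ≠ 0) (hB : ∀ y ∈ B, level c m y = 1)
    (hBm : MeasurableSet B) (hBf : μHE[Module.finrank ℝ E - 1] B ≠ ⊤) :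
    ∫ x in coneOver c B, (x - c) = (‖m‖⁻¹ / (Module.finrank ℝ E + 1)) •
      ∫ y in B, (y - c) ∂(μHE[Module.finrank ℝ E - 1]) := by
  have hfin : IsFiniteMeasure ((μHE[Module.finrank ℝ E - 1] : Measure E).restrict B) :=
    isFiniteMeasure_restrict.2 hBf
  calc ∫ x in coneOver c B, (x - c)
      = ∫ x in coneOver c B, level c m x • (foot c m x - c) :=
        setIntegral_congr_fun (measurableSet_coneOver hB hBm) fun x hx =>
          (eq_sub_of_add_eq' (add_level_smul_foot ((mem_coneOver_iff hB).1 hx).1.1.ne')).symm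
    _ = ∫ z, z.1 • (z.2 - c) ∂(volume.restrict (coneOver c B)).map
          (fun x => (level c m x, foot c m x)) :=
        by
        refine (integral_map (measurable_level.prodMk measurable_foot).aemeasurable
          (f := fun z : ℝ × E => z.1 • (z.2 - c)) ?_).symm
        fun_prop
    _ = _ := by
        rw [map_level_foot_volume_coneOver hm hB hBm hBf,
          integral_prod_smul (fun t : ℝ => t) fun y : E => y - c, integral_id_coneLevelMeasure hm]

end Cones

section StarDomains

variable {E : Type*} [NormedAddCommGroup E] [NormedSpace ℝ E] {c y : E} {S : Set E} {s t : ℝ}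

/-- An open set containing, with each point `y` of its closure, the half-open segment from `c` to
`y`: a set that is star-shaped with respect to `c` and whose frontier meets each ray issued from
`c` at most once. -/
structure IsStarDomain (c : E) (S : Set E) : Prop where
  isOpen : IsOpen S
  center_mem : c ∈ S
  segment_mem : ∀ ⦃y⦄, y ∈ closure S → ∀ ⦃t : ℝ⦄, 0 ≤ t → t < 1 → c + t • (y - c) ∈ S

lemma homothety_mem_frontier (hS : StarConvex ℝ c S) (hSo : IsOpen S) (hy : y ∈ closure S)
    (ht : 0 ≤ t) (hts : t ≤ s) (hs : s ≤ 1) (hyt : c + t • (y - c) ∉ S) :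
    c + s • (y - c) ∈ frontier S := by
  rw [hSo.frontier_eq]
  refine ⟨map_mem_closure (f := fun z => c + s • (z - c)) (by fun_prop) hy
    fun z hz => hS.add_smul_sub_mem hz (ht.trans hts) hs, fun hmem => hyt ?_⟩
  rcases (ht.trans hts).eq_or_lt with rfl | hs0
  · rwa [hts.antisymm ht]
  · have := hS.add_smul_sub_mem hmem (t := t / s) (by positivity) ((div_le_one hs0).2 hts)
    rwa [add_sub_cancel_left, smul_smul, div_mul_cancel₀ _ hs0.ne'] at this

/-- The gauge of `S` with respect to the centre `c`. -/
def starGauge (c : E) (S : Set E) (x : E) : ℝ := gauge ((c + ·) ⁻¹' S) (x - c)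

lemma starGauge_nonneg (x : E) : 0 ≤ starGauge c S x := gauge_nonneg _

lemma starGauge_center : starGauge c S c = 0 := by simp [starGauge]

lemma starGauge_homothety (ht : 0 ≤ t) (x : E) :
    starGauge c S (c + t • (x - c)) = t * starGauge c S x := by
  simp only [starGauge, add_sub_cancel_left, gauge_smul_of_nonneg ht, smul_eq_mul]

namespace IsStarDomain

variable (hS : IsStarDomain c S)
include hS

lemma homothety_mem {x : E} (hx : x ∈ S) (ht : 0 ≤ t) (ht' : t ≤ 1) : c + t • (x - c) ∈ S := by
  rcases ht'.lt_or_eq with h | rfl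
  · exact hS.segment_mem (subset_closure hx) ht h
  · simpa using hx

lemma homothety_notMem (hy : y ∉ S) (ht : 1 ≤ t) : c + t • (y - c) ∉ S := fun h => hy <| by
  have := hS.homothety_mem h (t := t⁻¹) (by positivity) (inv_le_one_of_one_le₀ ht)
  rwa [add_sub_cancel_left, smul_smul, inv_mul_cancel₀ (by positivity), one_smul,
    add_sub_cancel] at this

lemma preimage_mem_nhds_zero : (c + ·) ⁻¹' S ∈ 𝓝 (0 : E) :=
  (hS.isOpen.preimage (by fun_prop)).mem_nhds (by simpa using hS.center_mem)

lemma starGauge_lt_one_iff {x : E} : starGauge c S x < 1 ↔ x ∈ S := by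
  refine ⟨fun h => ?_, fun h =>
    gauge_lt_one_of_mem_of_isOpen (hS.isOpen.preimage (by fun_prop)) (by simpa using h)⟩
  obtain ⟨r, hr0, hr1, z, hz, hzx : r • z = x - c⟩ :=
    exists_lt_of_gauge_lt (absorbent_nhds_zero hS.preimage_mem_nhds_zero) h
  have := hS.homothety_mem hz hr0.le hr1.le
  rwa [add_sub_cancel_left, hzx, add_sub_cancel] at this

lemma starGauge_le_one_iff {x : E} : starGauge c S x ≤ 1 ↔ x ∈ closure S := by
  constructor
  · intro h
    have htendsto : Tendsto (fun t : ℝ => c + t • (x - c)) (𝓝[<] 1) (𝓝 x) :=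
      tendsto_nhdsWithin_of_tendsto_nhds (Continuous.tendsto' (by fun_prop) _ _ (by simp))
    refine mem_closure_of_tendsto htendsto ?_
    filter_upwards [Ioo_mem_nhdsLT (zero_lt_one (α := ℝ))] with t ht
    rw [← hS.starGauge_lt_one_iff, starGauge_homothety ht.1.le]
    nlinarith [ht.1, ht.2]
  · intro h
    by_contra! hlt
    have hpos := one_pos.trans hlt
    have := hS.segment_mem h (inv_nonneg.2 hpos.le) (inv_lt_one_of_one_lt₀ hlt)
    rw [← hS.starGauge_lt_one_iff, starGauge_homothety (inv_nonneg.2 hpos.le),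
      inv_mul_cancel₀ hpos.ne'] at this
    exact this.false

lemma starGauge_eq_one_iff : starGauge c S y = 1 ↔ y ∈ frontier S := by
  rw [hS.isOpen.frontier_eq, Set.mem_sdiff, ← hS.starGauge_le_one_iff, ← hS.starGauge_lt_one_iff,
    not_lt, le_antisymm_iff]

lemma eq_one_of_homothety_mem_frontier (hy : y ∈ frontier S) (ht : 0 ≤ t)
    (hty : c + t • (y - c) ∈ frontier S) : t = 1 := by
  rw [← hS.starGauge_eq_one_iff] at hy hty
  rwa [starGauge_homothety ht, hy, mul_one] at hty

lemma starGauge_lt_iff {x : E} {a : ℝ} (ha : 0 < a) :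
    starGauge c S x < a ↔ c + a⁻¹ • (x - c) ∈ S := by
  rw [← hS.starGauge_lt_one_iff, starGauge_homothety (by positivity), ← div_eq_inv_mul,
    div_lt_one ha]

lemma starGauge_le_iff {x : E} {a : ℝ} (ha : 0 < a) :
    starGauge c S x ≤ a ↔ c + a⁻¹ • (x - c) ∈ closure S := by
  rw [← hS.starGauge_le_one_iff, starGauge_homothety (by positivity), ← div_eq_inv_mul,
    div_le_one ha]

lemma continuous_starGauge : Continuous (starGauge c S) := by
  refine continuous_iff_lower_upperSemicontinuous.2 ⟨fun x a ha => ?_, fun x a ha => ?_⟩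
  · rcases lt_or_ge a 0 with h0 | h0
    · exact .of_forall fun z => h0.trans_le (starGauge_nonneg z)
    · obtain ⟨b, hab, hb⟩ := exists_between ha
      have hopen : IsOpen {z | b < starGauge c S z} := by
        simp only [← not_le, hS.starGauge_le_iff (h0.trans_lt hab)]
        exact (isClosed_closure.preimage (by fun_prop)).isOpen_compl
      filter_upwards [hopen.mem_nhds hb] with z hz using hab.trans hz
  · have ha' := (starGauge_nonneg x).trans_lt ha
    have hopen : IsOpen {z | starGauge c S z < a} := by
      simp only [hS.starGauge_lt_iff ha']
      exact hS.isOpen.preimage (by fun_prop)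
    exact hopen.mem_nhds ha

lemma starGauge_pos (hSb : Bornology.IsBounded S) {x : E} (hx : x ≠ c) : 0 < starGauge c S x := by
  have hb : Bornology.IsBounded ((c + ·) ⁻¹' S) :=
    (isometry_add_left c).antilipschitz.isBounded_preimage hSb
  exact (gauge_pos (absorbent_nhds_zero hS.preimage_mem_nhds_zero)
    (NormedSpace.isVonNBounded_iff ℝ |>.2 hb)).2 (sub_ne_zero.2 hx)

lemma inv_starGauge_homothety_mem_frontier (hSb : Bornology.IsBounded S) {x : E} (hx : x ≠ c) :
    c + (starGauge c S x)⁻¹ • (x - c) ∈ frontier S := by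
  rw [← hS.starGauge_eq_one_iff, starGauge_homothety (inv_nonneg.2 (starGauge_nonneg x)),
    inv_mul_cancel₀ (hS.starGauge_pos hSb hx).ne']

end IsStarDomain

end StarDomains

section LipschitzSelections

variable {ι : Type*} {s : Finset ι} {L : NNReal}

lemma le_add_mul_of_continuous_selection {f : ℝ → ℝ} (hf : Continuous f) {g : ι → ℝ → ℝ}
    (hg : ∀ i ∈ s, LipschitzWith L (g i)) (h : ∀ t, ∃ i ∈ s, f t = g i t) {a b : ℝ}
    (hab : a ≤ b) : f b ≤ f a + L * (b - a) := by
  refine image_le_of_liminf_slope_right_le_deriv_boundary (f := f)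
    (B := fun t => f a + L * (t - a)) (B' := fun _ => L) hf.continuousOn (by simp) (by fun_prop)
    (fun t _ => by
      simpa using ((((hasDerivAt_id t).sub_const a).const_mul (L : ℝ)).const_add
        (f a)).hasDerivWithinAt)
    (fun t _ r hr => ?_) (Set.right_mem_Icc.2 hab)
  -- Some `g i` agrees with `f` arbitrarily close to the right of `t`, hence also at `t`.
  obtain ⟨i, hi, hfr⟩ : ∃ i ∈ s, ∃ᶠ z in 𝓝[>] t, f z = g i z :=
    (frequently_exists_finset s).1 (Frequently.of_forall h)
  have ht : f t = g i t := (isClosed_eq hf (hg i hi).continuous).mem_of_frequently_of_tendsto hfr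
    (tendsto_id.mono_left nhdsWithin_le_nhds)
  refine (hfr.and_eventually self_mem_nhdsWithin).mono fun z ⟨hz, hzt⟩ => ?_
  have hzt : 0 < z - t := sub_pos.2 hzt
  refine lt_of_le_of_lt ?_ hr
  rw [slope_def_field, div_le_iff₀ hzt, hz, ht]
  calc g i z - g i t ≤ |g i z - g i t| := le_abs_self _
    _ ≤ L * |z - t| := (hg i hi).dist_le_mul z t
    _ = L * (z - t) := by rw [abs_of_pos hzt]

lemma lipschitzWith_of_continuous_selection {E : Type*} [NormedAddCommGroup E]
    [NormedSpace ℝ E] {f : E → ℝ} (hf : Continuous f) {g : ι → E → ℝ}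
    (hg : ∀ i ∈ s, LipschitzWith L (g i)) (h : ∀ x, ∃ i ∈ s, f x = g i x) :
    LipschitzWith L f := by
  refine LipschitzWith.of_le_add_mul _ fun y x => ?_
  have := le_add_mul_of_continuous_selection (f := f ∘ AffineMap.lineMap x y)
    (g := fun i => g i ∘ AffineMap.lineMap x y) (hf.comp AffineMap.lineMap_continuous)
    (fun i hi => (hg i hi).comp (lipschitzWith_lineMap x y)) (fun t => h _) zero_le_one
  simpa [nndist_comm, dist_comm] using this

end LipschitzSelections

section Hyperplanes

variable {E : Type*} [NormedAddCommGroup E] [InnerProductSpace ℝ E] {c m : E}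

lemma eq_or_eq_neg_of_mem_orthogonal [FiniteDimensional ℝ E] {V : Submodule ℝ E}
    (hV : Module.finrank ℝ V + 1 = Module.finrank ℝ E) {n n' : E} (hn : n ∈ Vᗮ) (hn' : n' ∈ Vᗮ)
    (hnorm : ‖n‖ = 1) (hnorm' : ‖n'‖ = 1) : n' = n ∨ n' = -n := by
  have hfin : Module.finrank ℝ Vᗮ = 1 := by
    have := V.finrank_add_finrank_orthogonal
    lia
  have hn0 : (⟨n, hn⟩ : Vᗮ) ≠ 0 := by
    rw [← norm_ne_zero_iff, Submodule.coe_norm, hnorm]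
    exact one_ne_zero
  obtain ⟨a, ha⟩ := (finrank_eq_one_iff_of_nonzero' _ hn0).1 hfin ⟨n', hn'⟩
  obtain rfl : a • n = n' := congr_arg Subtype.val ha
  rw [norm_smul, hnorm, mul_one, Real.norm_eq_abs, abs_eq zero_le_one] at hnorm'
  rcases hnorm' with rfl | rfl <;> simp

lemma inner_eq_zero_of_mem_direction {P : AffineSubspace ℝ E} (hP : (P : Set E).Nonempty)
    (hm : ∀ y, y ∈ P ↔ level c m y = 1) {w : E} (hw : w ∈ P.direction) : inner ℝ m w = 0 := by
  obtain ⟨p, hp⟩ := hP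
  have h := (hm _).1 (AffineSubspace.vadd_mem_of_mem_direction hw hp)
  rw [vadd_eq_add, add_comm, ← one_smul ℝ w, level_add_smul, (hm p).1 hp] at h
  simpa using h

lemma exists_level_eq_one [FiniteDimensional ℝ E] {P : AffineSubspace ℝ E}
    (hP : (P : Set E).Nonempty) (hfin : Module.finrank ℝ P.direction + 1 = Module.finrank ℝ E)
    (hc : 0 < Metric.infDist c (P : Set E)) :
    ∃ m : E, ‖m‖ = (Metric.infDist c (P : Set E))⁻¹ ∧ ∀ y, y ∈ P ↔ level c m y = 1 := by
  have : Nonempty P := hP.to_subtype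
  obtain ⟨q, hq⟩ : ∃ q : E, q = (EuclideanGeometry.orthogonalProjection P c : P) := ⟨_, rfl⟩
  have hqP : q ∈ P := hq ▸ EuclideanGeometry.orthogonalProjection_mem c
  have hdist : ‖q - c‖ = Metric.infDist c (P : Set E) := by
    rw [← EuclideanGeometry.dist_orthogonalProjection_eq_infDist P c, dist_comm, dist_eq_norm, hq]
  have hqc : q - c ≠ 0 := norm_pos_iff.1 (hdist ▸ hc)
  have hdir : P.direction = (ℝ ∙ (q - c))ᗮ := by
    refine Submodule.eq_of_le_of_finrank_eq (fun w hw => ?_) ?_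
    · have := EuclideanGeometry.orthogonalProjection_vsub_mem_direction_orthogonal P c
      rw [← hq] at this
      rw [Submodule.mem_orthogonal_singleton_iff_inner_left]
      exact (Submodule.mem_orthogonal _ _).1 this w hw
    · have := (ℝ ∙ (q - c)).finrank_add_finrank_orthogonal
      rw [finrank_span_singleton hqc] at this
      lia
  refine ⟨(‖q - c‖ ^ 2)⁻¹ • (q - c), ?_, fun y => ?_⟩
  · rw [norm_smul, norm_inv, norm_pow, norm_norm, hdist]
    field_simp
  · rw [← AffineSubspace.vsub_right_mem_direction_iff_mem hqP y, hdir, vsub_eq_sub,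
      Submodule.mem_orthogonal_singleton_iff_inner_right, ← sub_sub_sub_cancel_right y q c,
      inner_sub_right, real_inner_self_eq_norm_sq, sub_eq_zero, level, real_inner_smul_left,
      inv_mul_eq_one₀ (by positivity), eq_comm]

lemma level_foot {x : E} (hx : level c m x ≠ 0) : level c m (foot c m x) = 1 := by
  rw [foot, level_homothety, inv_mul_cancel₀ hx]

variable {B : Set E}

lemma eventually_foot_mem (hB : ∃ U, IsOpen U ∧ B = U ∩ {x | level c m x = 1}) {x : E}
    (hx : level c m x ≠ 0) (hfx : foot c m x ∈ B) : ∀ᶠ z in 𝓝 x, foot c m z ∈ B := by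
  obtain ⟨U, hU, rfl⟩ := hB
  have hlevel : ContinuousAt (level c m) x := continuous_level.continuousAt
  have hfoot : ContinuousAt (foot c m) x :=
    continuousAt_const.add ((hlevel.inv₀ hx).smul (by fun_prop))
  filter_upwards [hfoot.eventually (hU.mem_nhds hfx.1), hlevel.eventually_ne hx] with z hz hz0
  exact ⟨hz, level_foot hz0⟩

lemma isOpen_coneOver (hB : ∃ U, IsOpen U ∧ B = U ∩ {x | level c m x = 1}) :
    IsOpen (coneOver c B) := by
  have hBm : ∀ y ∈ B, level c m y = 1 := by
    obtain ⟨U, -, rfl⟩ := hB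
    exact fun y hy => hy.2
  refine isOpen_iff_mem_nhds.2 fun x hx => ?_
  rw [mem_coneOver_iff hBm] at hx
  filter_upwards [eventually_foot_mem hB hx.1.1.ne' hx.2,
    continuous_level.continuousAt.eventually (isOpen_Ioo.mem_nhds hx.1)] with z hz hz'
  exact (mem_coneOver_iff hBm).2 ⟨hz', hz⟩

lemma IsStarDomain.eventually_mem_iff_level_lt_one {S : Set E} (hS : IsStarDomain c S)
    (hB : ∃ U, IsOpen U ∧ B = U ∩ {x | level c m x = 1}) (hBS : B ⊆ frontier S) {y : E}
    (hy : y ∈ B) : ∀ᶠ z in 𝓝 y, z ∈ S ↔ level c m z < 1 := by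
  have hy1 : level c m y = 1 := by
    obtain ⟨U, -, rfl⟩ := hB
    exact hy.2
  have hfy : foot c m y ∈ B := by simpa [foot, hy1] using hy
  have hpos : ∀ᶠ z in 𝓝 y, 0 < level c m z :=
    continuous_level.continuousAt.eventually (lt_mem_nhds (by rw [hy1]; exact one_pos))
  filter_upwards [eventually_foot_mem hB (hy1 ▸ one_ne_zero) hfy, hpos] with z hz hz0
  have hfoot := hBS hz
  rw [hS.isOpen.frontier_eq] at hfoot
  rw [← add_level_smul_foot hz0.ne', level_homothety, level_foot hz0.ne', mul_one]
  refine ⟨fun hzS => ?_, fun hlt => hS.segment_mem hfoot.1 hz0.le hlt⟩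
  by_contra! hle
  exact hS.homothety_notMem hfoot.2 hle hzS

lemma eventually_sub_mem_and_add_notMem {S : Set E} {y v : E}
    (hS : ∀ᶠ z in 𝓝 y, z ∈ S ↔ level c m z < 1) (hy : level c m y = 1) (hv : 0 < inner ℝ m v) :
    ∀ᶠ t : ℝ in 𝓝[>] 0, y - t • v ∈ S ∧ y + t • v ∉ S := by
  have hsub : Tendsto (fun t : ℝ => y - t • v) (𝓝[>] 0) (𝓝 y) :=
    tendsto_nhdsWithin_of_tendsto_nhds (Continuous.tendsto' (by fun_prop) _ _ (by simp))
  have hadd : Tendsto (fun t : ℝ => y + t • v) (𝓝[>] 0) (𝓝 y) :=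
    tendsto_nhdsWithin_of_tendsto_nhds (Continuous.tendsto' (by fun_prop) _ _ (by simp))
  filter_upwards [hsub.eventually hS, hadd.eventually hS, self_mem_nhdsWithin] with t h1 h2 ht
  rw [h1, h2, sub_eq_add_neg, ← neg_smul, level_add_smul, level_add_smul, hy]
  have := mul_pos ht hv
  constructor <;> linarith

end Hyperplanes

namespace Discretisation

variable {d : ℕ} {Ω : Set (Pt d)} (D : Discretisation d Ω) {K L : D.Cell} {σ τ : D.Edge}

section Normals

lemma edge_subset_plane (σ : D.Edge) : D.edge σ ⊆ D.plane σ := by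
  obtain ⟨U, -, h⟩ := D.edge_open σ
  exact h ▸ Set.inter_subset_right

lemma closure_edge_subset_plane (σ : D.Edge) : closure (D.edge σ) ⊆ D.plane σ :=
  closure_minimal (D.edge_subset_plane σ) (AffineSubspace.closed_of_finiteDimensional _)

lemma plane_nonempty (σ : D.Edge) : (D.plane σ : Set (Pt d)).Nonempty :=
  (D.edge_nonempty σ).mono (D.edge_subset_plane σ)

lemma measurableSet_edge (σ : D.Edge) : MeasurableSet (D.edge σ) := by
  obtain ⟨U, hU, h⟩ := D.edge_open σ
  rw [h]
  exact hU.measurableSet.inter (AffineSubspace.closed_of_finiteDimensional _).measurableSet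

lemma dist_pos (hσ : σ ∈ D.edgesOf K) : 0 < D.dist K σ := D.dist_plane_pos K σ hσ

lemma frontier_cell (K : D.Cell) :
    frontier (D.cell K) = ⋃ σ ∈ D.edgesOf K, closure (D.edge σ) := by
  rw [(D.cell_isOpen K).frontier_eq, D.boundary_eq K]

lemma edge_subset_frontier (hσ : σ ∈ D.edgesOf K) : D.edge σ ⊆ frontier (D.cell K) := by
  rw [D.frontier_cell]
  exact subset_closure.trans (Set.subset_biUnion_of_mem (u := fun σ => closure (D.edge σ)) hσ)

lemma exists_edge_of_mem_frontier {y : Pt d} (hy : y ∈ frontier (D.cell K)) :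
    ∃ σ ∈ D.edgesOf K, y ∈ closure (D.edge σ) := by
  simpa [D.frontier_cell] using hy

lemma exists_mem_plane_iff_level (hσ : σ ∈ D.edgesOf K) :
    ∃ m, ‖m‖ = (D.dist K σ)⁻¹ ∧ ∀ y, y ∈ D.plane σ ↔ level (D.center K) m y = 1 :=
  exists_level_eq_one (D.plane_nonempty σ) (by simpa using D.plane_finrank σ) (D.dist_pos hσ)

/-- If the half-open segment from the centre of a cell to a point of its closure left the cell, it
would end with a whole segment of the frontier; but this segment meets each of the finitely many
hyperplanes of the edges at most once. -/
lemma isStarDomain_cell (K : D.Cell) : IsStarDomain (D.center K) (D.cell K) where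
  isOpen := D.cell_isOpen K
  center_mem := D.center_mem K
  segment_mem y hy t ht0 ht1 := by
    by_contra hnot
    have hcover : Set.Ico t 1 ⊆ ⋃ σ ∈ D.edgesOf K,
        {s | D.center K + s • (y - D.center K) ∈ D.plane σ} := fun s hs => by
      obtain ⟨σ, hσ, h⟩ := D.exists_edge_of_mem_frontier <|
        homothety_mem_frontier (D.starShaped K) (D.cell_isOpen K) hy ht0 hs.1 hs.2.le hnot
      exact Set.mem_biUnion hσ (D.closure_edge_subset_plane σ h)
    refine (Set.Ico_infinite ht1) <| .subset
      (Set.Finite.biUnion (Finset.finite_toSet _) fun σ hσ => Set.Subsingleton.finite ?_) hcover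
    obtain ⟨m, -, hm⟩ := D.exists_mem_plane_iff_level hσ
    intro s hs s' hs'
    simp only [Set.mem_ofPred_eq, hm, level_homothety] at hs hs'
    exact mul_right_cancel₀ (right_ne_zero_of_mul_eq_one hs) (hs.trans hs'.symm)

lemma edge_eq_inter_level {m : Pt d}
    (hm : ∀ y, y ∈ D.plane σ ↔ level (D.center K) m y = 1) :
    ∃ U, IsOpen U ∧ D.edge σ = U ∩ {x | level (D.center K) m x = 1} := by
  obtain ⟨U, hU, h⟩ := D.edge_open σ
  exact ⟨U, hU, h.trans (congr_arg _ (Set.ext hm))⟩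

lemma isOutwardUnitNormal_of_level (hσ : σ ∈ D.edgesOf K) {m : Pt d}
    (hnorm : ‖m‖ = (D.dist K σ)⁻¹)
    (hm : ∀ y, y ∈ D.plane σ ↔ level (D.center K) m y = 1) :
    D.IsOutwardUnitNormal K σ (D.dist K σ • m) := by
  have hδ := D.dist_pos hσ
  refine ⟨?_, fun w hw => ?_, fun y hy => eventually_sub_mem_and_add_notMem
    ((D.isStarDomain_cell K).eventually_mem_iff_level_lt_one (D.edge_eq_inter_level hm)
      (D.edge_subset_frontier hσ) hy) ((hm y).1 (D.edge_subset_plane σ hy)) ?_⟩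
  · rw [norm_smul, hnorm, Real.norm_of_nonneg hδ.le, mul_inv_cancel₀ hδ.ne']
  · rw [real_inner_smul_left, inner_eq_zero_of_mem_direction (D.plane_nonempty σ) hm hw, mul_zero]
  · rw [real_inner_smul_right, real_inner_self_eq_norm_sq, hnorm]
    positivity

variable {D} in
lemma IsOutwardUnitNormal.eq_or_eq_neg {n n' : Pt d} (hn : D.IsOutwardUnitNormal K σ n)
    (hn' : D.IsOutwardUnitNormal L σ n') : n' = n ∨ n' = -n :=
  eq_or_eq_neg_of_mem_orthogonal (V := (D.plane σ).direction) (by simpa using D.plane_finrank σ)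
    ((Submodule.mem_orthogonal' _ _).2 hn.2.1) ((Submodule.mem_orthogonal' _ _).2 hn'.2.1)
    hn.1 hn'.1

variable {D} in
lemma IsOutwardUnitNormal.unique {n n' : Pt d} (hn : D.IsOutwardUnitNormal K σ n)
    (hn' : D.IsOutwardUnitNormal K σ n') : n' = n := by
  refine (hn.eq_or_eq_neg hn').resolve_right fun h => ?_
  obtain ⟨y, hy⟩ := D.edge_nonempty σ
  obtain ⟨t, ht, ht'⟩ := ((hn.2.2 y hy).and (hn'.2.2 y hy)).exists
  rw [h, smul_neg, ← sub_eq_add_neg] at ht'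
  exact ht'.2 ht.1

variable {D} in
lemma IsOutwardUnitNormal.eq_neg {n n' : Pt d} (hKL : K ≠ L) (hn : D.IsOutwardUnitNormal K σ n)
    (hn' : D.IsOutwardUnitNormal L σ n') : n' = -n := by
  refine (hn.eq_or_eq_neg hn').resolve_left fun h => ?_
  obtain ⟨y, hy⟩ := D.edge_nonempty σ
  obtain ⟨t, ht, ht'⟩ := ((hn.2.2 y hy).and (hn'.2.2 y hy)).exists
  rw [h] at ht'
  exact Set.disjoint_left.1 (D.cell_disjoint hKL) ht.1 ht'.1

lemma isOutwardUnitNormal_normal (hσ : σ ∈ D.edgesOf K) :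
    D.IsOutwardUnitNormal K σ (D.normal K σ) := by
  obtain ⟨m, hnorm, hm⟩ := D.exists_mem_plane_iff_level hσ
  exact Classical.epsilon_spec ⟨_, D.isOutwardUnitNormal_of_level hσ hnorm hm⟩

lemma norm_normal (hσ : σ ∈ D.edgesOf K) : ‖D.normal K σ‖ = 1 :=
  (D.isOutwardUnitNormal_normal hσ).1

lemma normal_eq_neg (hKL : K ≠ L) (hK : σ ∈ D.edgesOf K) (hL : σ ∈ D.edgesOf L) :
    D.normal L σ = -D.normal K σ :=
  (D.isOutwardUnitNormal_normal hK).eq_neg hKL (D.isOutwardUnitNormal_normal hL)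

/-- `n_{K,σ} / d_{K,σ}`, the vector `m` for which `level x_K m = 1` is the hyperplane of `σ`. -/
def levelVec (K : D.Cell) (σ : D.Edge) : Pt d := (D.dist K σ)⁻¹ • D.normal K σ

lemma inner_levelVec (e : Pt d) :
    inner ℝ (D.levelVec K σ) e = inner ℝ (D.normal K σ) e / D.dist K σ := by
  rw [levelVec, real_inner_smul_left, inv_mul_eq_div]

lemma norm_levelVec (hσ : σ ∈ D.edgesOf K) : ‖D.levelVec K σ‖ = (D.dist K σ)⁻¹ := by
  rw [levelVec, norm_smul, D.norm_normal hσ, mul_one,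
    Real.norm_of_nonneg (inv_nonneg.2 (D.dist_pos hσ).le)]

lemma levelVec_ne_zero (hσ : σ ∈ D.edgesOf K) : D.levelVec K σ ≠ 0 := by
  rw [← norm_pos_iff, D.norm_levelVec hσ]
  exact inv_pos.2 (D.dist_pos hσ)

lemma mem_plane_iff (hσ : σ ∈ D.edgesOf K) {y : Pt d} :
    y ∈ D.plane σ ↔ level (D.center K) (D.levelVec K σ) y = 1 := by
  obtain ⟨m, hnorm, hm⟩ := D.exists_mem_plane_iff_level hσ
  rw [levelVec, (D.isOutwardUnitNormal_of_level hσ hnorm hm).unique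
    (D.isOutwardUnitNormal_normal hσ), inv_smul_smul₀ (D.dist_pos hσ).ne', hm]

lemma level_of_mem_edge (hσ : σ ∈ D.edgesOf K) {y : Pt d} (hy : y ∈ D.edge σ) :
    level (D.center K) (D.levelVec K σ) y = 1 :=
  (D.mem_plane_iff hσ).1 (D.edge_subset_plane σ hy)

end Normals

section Cones

lemma cone_eq_coneOver (K : D.Cell) (σ : D.Edge) :
    D.cone K σ = coneOver (D.center K) (D.edge σ) := rfl

lemma measurableSet_cone (hσ : σ ∈ D.edgesOf K) : MeasurableSet (D.cone K σ) :=
  measurableSet_coneOver (fun _ hy => D.level_of_mem_edge hσ hy) (D.measurableSet_edge σ)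

lemma isOpen_cone (hσ : σ ∈ D.edgesOf K) : IsOpen (D.cone K σ) :=
  isOpen_coneOver (D.edge_eq_inter_level fun _ => D.mem_plane_iff hσ)

lemma cone_subset_cell (hσ : σ ∈ D.edgesOf K) : D.cone K σ ⊆ D.cell K := by
  rintro x ⟨y, hy, t, ht, rfl⟩
  exact (D.isStarDomain_cell K).segment_mem
    (frontier_subset_closure (D.edge_subset_frontier hσ hy)) ht.1.le ht.2

lemma disjoint_cone (hσ : σ ∈ D.edgesOf K) (hτ : τ ∈ D.edgesOf K) (h : σ ≠ τ) :
    Disjoint (D.cone K σ) (D.cone K τ) := by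
  rw [Set.disjoint_left]
  rintro x ⟨y, hy, t, ht, rfl⟩ ⟨z, hz, s, hs, hzs⟩
  have hzy : z = D.center K + (t / s) • (y - D.center K) := by
    rw [div_eq_inv_mul, mul_smul, add_left_cancel hzs, inv_smul_smul₀ hs.1.ne', add_sub_cancel]
  have hts : t / s = 1 := (D.isStarDomain_cell K).eq_one_of_homothety_mem_frontier
    (D.edge_subset_frontier hσ hy) (div_pos ht.1 hs.1).le (hzy ▸ D.edge_subset_frontier hτ hz)
  rw [hts, one_smul, add_sub_cancel] at hzy
  exact Set.disjoint_left.1 (D.edge_disjoint h) hy (hzy ▸ hz)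

end Cones

section Gauge

lemma isBounded_cell (hΩb : Bornology.IsBounded Ω) (K : D.Cell) :
    Bornology.IsBounded (D.cell K) := hΩb.subset (D.cell_subset K)

/-- The gauge of the cell `K` with respect to its centre. -/
def cellGauge (K : D.Cell) : Pt d → ℝ := starGauge (D.center K) (D.cell K)

lemma cellGauge_of_mem_cone (hσ : σ ∈ D.edgesOf K) {x : Pt d} (hx : x ∈ D.cone K σ) :
    D.cellGauge K x = level (D.center K) (D.levelVec K σ) x := by
  obtain ⟨y, hy, t, ht, rfl⟩ := hx
  rw [level_homothety, D.level_of_mem_edge hσ hy, cellGauge, starGauge_homothety ht.1.le,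
    (D.isStarDomain_cell K).starGauge_eq_one_iff.2 (D.edge_subset_frontier hσ hy)]

lemma exists_cellGauge_eq_level (hd : 0 < d) (hΩb : Bornology.IsBounded Ω) (K : D.Cell)
    (x : Pt d) :
    ∃ σ ∈ D.edgesOf K, D.cellGauge K x = level (D.center K) (D.levelVec K σ) x := by
  have hK := D.isStarDomain_cell K
  have hKb := D.isBounded_cell hΩb K
  have hne : ∀ x ≠ D.center K,
      ∃ σ ∈ D.edgesOf K, D.cellGauge K x = level (D.center K) (D.levelVec K σ) x := by
    intro x hx
    obtain ⟨σ, hσ, hy⟩ :=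
      D.exists_edge_of_mem_frontier (hK.inv_starGauge_homothety_mem_frontier hKb hx)
    have := (D.mem_plane_iff hσ).1 (D.closure_edge_subset_plane σ hy)
    rw [level_homothety, inv_mul_eq_one₀ (hK.starGauge_pos hKb hx).ne'] at this
    exact ⟨σ, hσ, this⟩
  by_cases hx : x = D.center K
  · have : Nonempty (Fin d) := ⟨⟨0, hd⟩⟩
    obtain ⟨z, hz⟩ := exists_ne (D.center K)
    obtain ⟨σ, hσ, -⟩ := hne z hz
    exact ⟨σ, hσ, by rw [hx, level_self, cellGauge, starGauge_center]⟩
  · exact hne x hx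

lemma exists_lipschitzWith_cellGauge (hd : 0 < d) (hΩb : Bornology.IsBounded Ω) (K : D.Cell) :
    ∃ C, LipschitzWith C (D.cellGauge K) := by
  refine ⟨∑ σ ∈ D.edgesOf K, ‖D.levelVec K σ‖₊, lipschitzWith_of_continuous_selection
    (D.isStarDomain_cell K).continuous_starGauge (fun σ hσ => ?_)
    (D.exists_cellGauge_eq_level hd hΩb K)⟩
  exact lipschitzWith_level.weaken
    (Finset.single_le_sum (f := fun σ => ‖D.levelVec K σ‖₊) (fun _ _ => zero_le) hσ)

end Gauge

end Discretisation

lemma hasLineDerivAt_level {E : Type*} [NormedAddCommGroup E] [InnerProductSpace ℝ E]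
    (c m x v : E) : HasLineDerivAt ℝ (level c m) (inner ℝ m v) x v := by
  unfold HasLineDerivAt
  simp_rw [level_add_smul]
  simpa using ((hasDerivAt_id (0 : ℝ)).mul_const (inner ℝ m v)).const_add (level c m x)

lemma lineDeriv_fun_const {E : Type*} [AddCommGroup E] [Module ℝ E] (a : ℝ) (x v : E) :
    lineDeriv ℝ (fun _ : E => a) x v = 0 := by
  simp [lineDeriv]

namespace Discretisation

variable {d : ℕ} {Ω : Set (Pt d)} (D : Discretisation d Ω) {K : D.Cell} {σ : D.Edge}

section Measures

lemma dim_pos (σ : D.Edge) : 0 < d := by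
  have := D.plane_finrank σ
  omega

lemma volume_cell_lt_top (hΩb : Bornology.IsBounded Ω) (K : D.Cell) :
    volume (D.cell K) < ⊤ := (D.isBounded_cell hΩb K).measure_lt_top

lemma cellVol_pos (hΩb : Bornology.IsBounded Ω) (K : D.Cell) : 0 < D.cellVol K :=
  ENNReal.toReal_pos ((D.cell_isOpen K).measure_pos volume ⟨_, D.center_mem K⟩).ne'
    (D.volume_cell_lt_top hΩb K).ne

lemma volume_cone_lt_top (hΩb : Bornology.IsBounded Ω) (hσ : σ ∈ D.edgesOf K) :
    volume (D.cone K σ) < ⊤ :=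
  (measure_mono (D.cone_subset_cell hσ)).trans_lt (D.volume_cell_lt_top hΩb K)

lemma volume_cone (hσ : σ ∈ D.edgesOf K) :
    volume (D.cone K σ) = ENNReal.ofReal (D.dist K σ / d) * μHE[d - 1] (D.edge σ) := by
  have h := volume_coneOver (D.levelVec_ne_zero hσ) (fun _ hy => D.level_of_mem_edge hσ hy)
    (D.measurableSet_edge σ)
  rwa [finrank_euclideanSpace_fin, D.norm_levelVec hσ, inv_inv] at h

lemma dist_div_dim_pos (hσ : σ ∈ D.edgesOf K) : 0 < D.dist K σ / d :=
  div_pos (D.dist_pos hσ) (by exact_mod_cast D.dim_pos σ)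

lemma edge_measure_ne_top (hΩb : Bornology.IsBounded Ω) (hσ : σ ∈ D.edgesOf K) :
    μHE[d - 1] (D.edge σ) ≠ ⊤ := by
  intro htop
  have hlt := D.volume_cone_lt_top hΩb hσ
  rw [D.volume_cone hσ, htop, ENNReal.mul_top (by simpa using D.dist_div_dim_pos hσ)] at hlt
  exact hlt.false

lemma edgeVol_pos (hΩb : Bornology.IsBounded Ω) (hσ : σ ∈ D.edgesOf K) : 0 < D.edgeVol σ :=
  ENNReal.toReal_pos (D.edge_measure_pos σ).ne' (D.edge_measure_ne_top hΩb hσ)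

lemma volume_real_cone (hσ : σ ∈ D.edgesOf K) :
    volume.real (D.cone K σ) = D.edgeVol σ * D.dist K σ / d := by
  rw [measureReal_def, D.volume_cone hσ, ENNReal.toReal_mul,
    ENNReal.toReal_ofReal (D.dist_div_dim_pos hσ).le, ← measureReal_def, ← edgeVol]
  ring

end Measures

section Barycentres

lemma norm_sub_center_le (hΩb : Bornology.IsBounded Ω) {x : Pt d}
    (hx : x ∈ closure (D.cell K)) : ‖x - D.center K‖ ≤ D.cellDiam K := by
  rw [← dist_eq_norm, cellDiam, ← Metric.diam_closure]
  exact Metric.dist_le_diam_of_mem (D.isBounded_cell hΩb K).closure hx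
    (subset_closure (D.center_mem K))

lemma edge_subset_closedBall (hΩb : Bornology.IsBounded Ω) (hσ : σ ∈ D.edgesOf K) :
    D.edge σ ⊆ Metric.closedBall (D.center K) (D.cellDiam K) := fun _ hy => by
  rw [mem_closedBall_iff_norm]
  exact D.norm_sub_center_le hΩb (frontier_subset_closure (D.edge_subset_frontier hσ hy))

lemma integrableOn_edge_id (hΩb : Bornology.IsBounded Ω) (hσ : σ ∈ D.edgesOf K) :
    IntegrableOn (fun y : Pt d => y) (D.edge σ) μHE[d - 1] := by
  obtain ⟨C, hC⟩ := (Metric.isBounded_closedBall.subset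
    (D.edge_subset_closedBall hΩb hσ)).exists_norm_le
  exact Measure.integrableOn_of_bounded (D.edge_measure_ne_top hΩb hσ) (by fun_prop)
    ((ae_restrict_mem (D.measurableSet_edge σ)).mono hC)

lemma bary_mem (hΩb : Bornology.IsBounded Ω) (hσ : σ ∈ D.edgesOf K) {S : Set (Pt d)}
    (hS : Convex ℝ S) (hSc : IsClosed S) (hsub : D.edge σ ⊆ S) : D.bary σ ∈ S :=
  hS.set_average_mem hSc (D.edge_measure_pos σ).ne' (D.edge_measure_ne_top hΩb hσ)
    ((ae_restrict_mem (D.measurableSet_edge σ)).mono hsub) (D.integrableOn_edge_id hΩb hσ)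

lemma norm_bary_sub_center_le (hΩb : Bornology.IsBounded Ω) (hσ : σ ∈ D.edgesOf K) :
    ‖D.bary σ - D.center K‖ ≤ D.cellDiam K :=
  mem_closedBall_iff_norm.1 (D.bary_mem hΩb hσ (convex_closedBall _ _) Metric.isClosed_closedBall
    (D.edge_subset_closedBall hΩb hσ))

lemma level_bary (hΩb : Bornology.IsBounded Ω) (hσ : σ ∈ D.edgesOf K) :
    level (D.center K) (D.levelVec K σ) (D.bary σ) = 1 :=
  (D.mem_plane_iff hσ).1 (D.bary_mem hΩb hσ (D.plane σ).convex
    (AffineSubspace.closed_of_finiteDimensional _) (D.edge_subset_plane σ))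

lemma setIntegral_edge_sub (hΩb : Bornology.IsBounded Ω) (hσ : σ ∈ D.edgesOf K) (c : Pt d) :
    ∫ y in D.edge σ, (y - c) ∂(μHE[d - 1]) = D.edgeVol σ • (D.bary σ - c) := by
  have hfin := D.edge_measure_ne_top hΩb hσ
  rw [integral_sub (D.integrableOn_edge_id hΩb hσ) (integrableOn_const hfin), setIntegral_const,
    bary, smul_sub, edgeVol, measure_smul_setAverage _ hfin]

lemma setIntegral_cone_level (hΩb : Bornology.IsBounded Ω) (hσ : σ ∈ D.edgesOf K) (a : Pt d) :
    ∫ x in D.cone K σ, level (D.center K) a x =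
      D.edgeVol σ * D.dist K σ / (d + 1) * level (D.center K) a (D.bary σ) := by
  have h := setIntegral_coneOver_sub (D.levelVec_ne_zero hσ)
    (fun _ hy => D.level_of_mem_edge hσ hy) (D.measurableSet_edge σ)
    (by simpa using D.edge_measure_ne_top hΩb hσ)
  rw [finrank_euclideanSpace_fin, D.norm_levelVec hσ, inv_inv, D.setIntegral_edge_sub hΩb hσ,
    smul_smul, ← cone_eq_coneOver] at h
  have hint : IntegrableOn (fun x => x - D.center K) (D.cone K σ) :=
    ((by fun_prop : Continuous fun x => x - D.center K).continuousOn.integrableOn_compact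
      (D.isBounded_cell hΩb K).isCompact_closure).mono_set
        ((D.cone_subset_cell hσ).trans subset_closure)
  simp only [level]
  rw [integral_inner hint, h, inner_smul_right]
  ring

end Barycentres

section Decomposition

lemma volume_plane (σ : D.Edge) : volume (D.plane σ : Set (Pt d)) = 0 := by
  refine Measure.addHaar_affineSubspace _ _ fun h => ?_
  have hfin := D.plane_finrank σ
  rw [h, AffineSubspace.direction_top, finrank_top, finrank_euclideanSpace_fin] at hfin
  omega

lemma volume_frontier_cell (K : D.Cell) : volume (frontier (D.cell K)) = 0 := by
  rw [D.frontier_cell]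
  exact (measure_biUnion_null_iff (Finset.countable_toSet _)).2 fun σ _ =>
    measure_mono_null (D.closure_edge_subset_plane σ) (D.volume_plane σ)

lemma volume_coneOver_edge_boundary (hσ : σ ∈ D.edgesOf K) :
    volume (coneOver (D.center K) (closure (D.edge σ) \ D.edge σ)) = 0 := by
  rw [volume_coneOver (D.levelVec_ne_zero hσ)
    (fun _ hy => (D.mem_plane_iff hσ).1 (D.closure_edge_subset_plane σ hy.1))
    (isClosed_closure.measurableSet.diff (D.measurableSet_edge σ)), finrank_euclideanSpace_fin,
    D.edge_boundary_null, mul_zero]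

lemma cell_subset_union_coneOver (hΩb : Bornology.IsBounded Ω) (K : D.Cell) :
    D.cell K ⊆ {D.center K} ∪ ⋃ σ ∈ D.edgesOf K, coneOver (D.center K) (closure (D.edge σ)) := by
  intro x hxK
  refine or_iff_not_imp_left.2 fun hxc => ?_
  have hK := D.isStarDomain_cell K
  have hKb := D.isBounded_cell hΩb K
  have hpos := hK.starGauge_pos hKb hxc
  obtain ⟨σ, hσ, hy⟩ :=
    D.exists_edge_of_mem_frontier (hK.inv_starGauge_homothety_mem_frontier hKb hxc)
  refine Set.mem_biUnion hσ ⟨_, hy, _, ⟨hpos, hK.starGauge_lt_one_iff.2 hxK⟩, ?_⟩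
  rw [add_sub_cancel_left, smul_inv_smul₀ hpos.ne', add_sub_cancel]

lemma volume_cell_diff_cones (hd : 0 < d) (hΩb : Bornology.IsBounded Ω) (K : D.Cell) :
    volume (D.cell K \ ⋃ σ ∈ D.edgesOf K, D.cone K σ) = 0 := by
  have : Nonempty (Fin d) := ⟨⟨0, hd⟩⟩
  have hsub : D.cell K \ ⋃ σ ∈ D.edgesOf K, D.cone K σ ⊆ {D.center K} ∪
      ⋃ σ ∈ D.edgesOf K, coneOver (D.center K) (closure (D.edge σ) \ D.edge σ) := by
    rintro x ⟨hxK, hx⟩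
    refine (D.cell_subset_union_coneOver hΩb K hxK).imp_right fun h => ?_
    obtain ⟨σ, hσ, y, hy, ht⟩ := Set.mem_iUnion₂.1 h
    exact Set.mem_biUnion hσ ⟨y, ⟨hy, fun hy' => hx (Set.mem_biUnion hσ ⟨y, hy', ht⟩)⟩, ht⟩
  refine measure_mono_null hsub (measure_union_null (measure_singleton _) ?_)
  exact (measure_biUnion_null_iff (Finset.countable_toSet _)).2 fun σ hσ =>
    D.volume_coneOver_edge_boundary hσ

lemma cell_ae_eq_cones (hd : 0 < d) (hΩb : Bornology.IsBounded Ω) (K : D.Cell) :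
    (⋃ σ ∈ D.edgesOf K, D.cone K σ : Set (Pt d)) =ᵐ[volume] D.cell K :=
  EventuallyLE.antisymm
    (LE.le.eventuallyLE (Set.iUnion₂_subset fun _ hσ => D.cone_subset_cell hσ))
    (ae_le_set.2 (D.volume_cell_diff_cones hd hΩb K))

lemma setIntegral_cell_eq_sum {E : Type*} [NormedAddCommGroup E] [NormedSpace ℝ E]
    (hd : 0 < d) (hΩb : Bornology.IsBounded Ω) (K : D.Cell) {f : Pt d → E}
    (hf : ∀ σ ∈ D.edgesOf K, IntegrableOn f (D.cone K σ)) :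
    ∫ x in D.cell K, f x = ∑ σ ∈ D.edgesOf K, ∫ x in D.cone K σ, f x := by
  rw [← setIntegral_congr_set (D.cell_ae_eq_cones hd hΩb K),
    integral_biUnion_finset _ (fun σ hσ => D.measurableSet_cone hσ)
      (fun σ hσ τ hτ h => D.disjoint_cone hσ hτ h) hf]

lemma iUnion_cell_ae_eq : (⋃ K, D.cell K : Set (Pt d)) =ᵐ[volume] Ω := by
  refine (Set.iUnion_subset fun K => D.cell_subset K).eventuallyLE.antisymm
    (ae_le_set.2 (measure_mono_null (t := ⋃ K, frontier (D.cell K)) ?_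
      (measure_iUnion_null fun K => D.volume_frontier_cell K)))
  rintro x ⟨hx, hxK⟩
  obtain ⟨K, hK⟩ := Set.mem_iUnion.1 (D.closure_eq ▸ subset_closure hx)
  rw [Set.mem_iUnion, not_exists] at hxK
  exact Set.mem_iUnion_of_mem K ((D.cell_isOpen K).frontier_eq ▸ ⟨hK, hxK K⟩)

lemma cellVol_eq_sum (hd : 0 < d) (hΩb : Bornology.IsBounded Ω) (K : D.Cell) :
    D.cellVol K = ∑ σ ∈ D.edgesOf K, D.edgeVol σ * D.dist K σ / d := by
  have h := D.setIntegral_cell_eq_sum hd hΩb K (f := fun _ => (1 : ℝ))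
    (fun σ hσ => integrableOn_const (D.volume_cone_lt_top hΩb hσ).ne)
  simp only [setIntegral_const, smul_eq_mul, mul_one] at h
  rw [cellVol, h]
  exact Finset.sum_congr rfl fun σ hσ => D.volume_real_cone hσ

lemma sum_edgeVol_mul_dist (hd : 0 < d) (hΩb : Bornology.IsBounded Ω) (K : D.Cell) :
    ∑ σ ∈ D.edgesOf K, D.edgeVol σ * D.dist K σ = d * D.cellVol K := by
  have : (d : ℝ) ≠ 0 := by exact_mod_cast hd.ne'
  rw [D.cellVol_eq_sum hd hΩb, ← Finset.sum_div, mul_div_cancel₀ _ this]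

lemma integrableOn_cone_of_continuous {E : Type*} [NormedAddCommGroup E]
    (hΩb : Bornology.IsBounded Ω) (hσ : σ ∈ D.edgesOf K) {f : Pt d → E} (hf : Continuous f) :
    IntegrableOn f (D.cone K σ) :=
  (hf.continuousOn.integrableOn_compact (D.isBounded_cell hΩb K).isCompact_closure).mono_set
    ((D.cone_subset_cell hσ).trans subset_closure)

end Decomposition

section Hat

/-- The hat function of a cell: affine on each cone, `1` at the centre of the cell and `0` outside
the cell. It serves as the weight with which the divergence theorem on the cell is obtained from
integration by parts on the whole space. -/
def hat (K : D.Cell) (x : Pt d) : ℝ := max (1 - D.cellGauge K x) 0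

lemma hat_eq_zero {x : Pt d} (hx : x ∉ D.cell K) : D.hat K x = 0 := by
  rw [← (D.isStarDomain_cell K).starGauge_lt_one_iff, not_lt] at hx
  exact max_eq_right (sub_nonpos.2 hx)

lemma exists_lipschitzWith_hat (hd : 0 < d) (hΩb : Bornology.IsBounded Ω) (K : D.Cell) :
    ∃ C, LipschitzWith C (D.hat K) :=
  let ⟨_, hC⟩ := D.exists_lipschitzWith_cellGauge hd hΩb K
  ⟨_, ((LipschitzWith.const (1 : ℝ)).sub hC).max_const 0⟩

lemma hasCompactSupport_hat (hΩb : Bornology.IsBounded Ω) (K : D.Cell) :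
    HasCompactSupport (D.hat K) :=
  HasCompactSupport.intro (D.isBounded_cell hΩb K).isCompact_closure
    fun _ hx => D.hat_eq_zero fun h => hx (subset_closure h)

lemma hat_of_mem_cone (hσ : σ ∈ D.edgesOf K) {x : Pt d} (hx : x ∈ D.cone K σ) :
    D.hat K x = 1 - level (D.center K) (D.levelVec K σ) x := by
  have hlt : D.cellGauge K x < 1 :=
    (D.isStarDomain_cell K).starGauge_lt_one_iff.2 (D.cone_subset_cell hσ hx)
  rw [hat, max_eq_left (sub_nonneg.2 hlt.le), D.cellGauge_of_mem_cone hσ hx]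

lemma lineDeriv_hat_of_mem_cone (hσ : σ ∈ D.edgesOf K) {x : Pt d} (hx : x ∈ D.cone K σ)
    (e : Pt d) : lineDeriv ℝ (D.hat K) x (-e) = inner ℝ (D.levelVec K σ) e := by
  have hev : D.hat K =ᶠ[𝓝 x] fun x => 1 - level (D.center K) (D.levelVec K σ) x := by
    filter_upwards [(D.isOpen_cone hσ).mem_nhds hx] with z hz using D.hat_of_mem_cone hσ hz
  have hder : HasLineDerivAt ℝ (fun x => 1 - level (D.center K) (D.levelVec K σ) x)
      (-inner ℝ (D.levelVec K σ) (-e)) x (-e) :=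
    (hasLineDerivAt_level _ _ x (-e)).const_sub 1
  rw [hev.lineDeriv_eq, hder.lineDeriv, inner_neg_right, neg_neg]

lemma lineDeriv_hat_of_notMem_closure {x : Pt d} (hx : x ∉ closure (D.cell K)) (v : Pt d) :
    lineDeriv ℝ (D.hat K) x v = 0 := by
  have hev : D.hat K =ᶠ[𝓝 x] fun _ => 0 := by
    filter_upwards [isClosed_closure.isOpen_compl.mem_nhds hx] with z hz
    exact D.hat_eq_zero fun h => hz (subset_closure h)
  rw [hev.lineDeriv_eq, lineDeriv_fun_const]

lemma integral_lineDeriv_mul_hat (hd : 0 < d) (hΩb : Bornology.IsBounded Ω) (K : D.Cell)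
    {f : Pt d → ℝ} {C : NNReal} (hf : LipschitzWith C f) (e : Pt d) :
    ∫ x, lineDeriv ℝ f x e * D.hat K x =
      ∑ σ ∈ D.edgesOf K, inner ℝ (D.levelVec K σ) e * ∫ x in D.cone K σ, f x := by
  obtain ⟨L, hL⟩ := D.exists_lipschitzWith_hat hd hΩb K
  have hcone : ∀ σ ∈ D.edgesOf K, ∀ x ∈ D.cone K σ,
      lineDeriv ℝ (D.hat K) x (-e) * f x = inner ℝ (D.levelVec K σ) e * f x :=
    fun σ hσ x hx => by rw [D.lineDeriv_hat_of_mem_cone hσ hx]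
  have hvanish : ∀ᵐ x, x ∉ D.cell K → lineDeriv ℝ (D.hat K) x (-e) * f x = 0 := by
    filter_upwards [measure_eq_zero_iff_ae_notMem.1 (D.volume_frontier_cell K)] with x hx hxK
    rw [D.lineDeriv_hat_of_notMem_closure fun h => hx ((D.cell_isOpen K).frontier_eq ▸ ⟨h, hxK⟩),
      zero_mul]
  calc ∫ x, lineDeriv ℝ f x e * D.hat K x
      = ∫ x, lineDeriv ℝ (D.hat K) x (-e) * f x :=
        hf.integral_lineDeriv_mul_eq hL (D.hasCompactSupport_hat hΩb K) e
    _ = ∫ x in D.cell K, lineDeriv ℝ (D.hat K) x (-e) * f x :=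
        (setIntegral_eq_integral_of_ae_compl_eq_zero hvanish).symm
    _ = ∑ σ ∈ D.edgesOf K, ∫ x in D.cone K σ, lineDeriv ℝ (D.hat K) x (-e) * f x :=
        D.setIntegral_cell_eq_sum hd hΩb K fun σ hσ =>
          IntegrableOn.congr_fun
            ((D.integrableOn_cone_of_continuous hΩb hσ hf.continuous).const_mul _)
            (fun x hx => (hcone σ hσ x hx).symm) (D.measurableSet_cone hσ)
    _ = _ := Finset.sum_congr rfl fun σ hσ => by
        rw [setIntegral_congr_fun (D.measurableSet_cone hσ) (hcone σ hσ), integral_const_mul]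

lemma sum_edgeVol_smul_normal (hd : 0 < d) (hΩb : Bornology.IsBounded Ω) (K : D.Cell) :
    ∑ σ ∈ D.edgesOf K, D.edgeVol σ • D.normal K σ = 0 := by
  have hd' : (d : ℝ) ≠ 0 := by exact_mod_cast hd.ne'
  refine ext_inner_right ℝ fun e => ?_
  have h := D.integral_lineDeriv_mul_hat hd hΩb K (LipschitzWith.const (1 : ℝ)) e
  simp only [lineDeriv_fun_const, zero_mul, integral_zero, setIntegral_const, smul_eq_mul,
    mul_one] at h
  rw [inner_zero_left, sum_inner, ← mul_zero (d : ℝ), h, Finset.mul_sum]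
  refine Finset.sum_congr rfl fun σ hσ => ?_
  have := (D.dist_pos hσ).ne'
  rw [D.volume_real_cone hσ, D.inner_levelVec, real_inner_smul_left]
  field_simp

lemma setIntegral_cone_hat (hΩb : Bornology.IsBounded Ω) (hσ : σ ∈ D.edgesOf K) :
    ∫ x in D.cone K σ, D.hat K x = D.edgeVol σ * D.dist K σ / d / (d + 1) := by
  have hd : (d : ℝ) ≠ 0 := by exact_mod_cast (D.dim_pos σ).ne'
  have hone : IntegrableOn (fun _ : Pt d => (1 : ℝ)) (D.cone K σ) :=
    integrableOn_const (D.volume_cone_lt_top hΩb hσ).ne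
  rw [setIntegral_congr_fun (D.measurableSet_cone hσ) fun x hx => D.hat_of_mem_cone hσ hx,
    integral_sub hone (D.integrableOn_cone_of_continuous hΩb hσ continuous_level),
    D.setIntegral_cone_level hΩb hσ, D.level_bary hΩb hσ, setIntegral_const,
    D.volume_real_cone hσ, smul_eq_mul]
  field_simp
  ring

lemma integral_hat (hd : 0 < d) (hΩb : Bornology.IsBounded Ω) (K : D.Cell) :
    ∫ x, D.hat K x = D.cellVol K / (d + 1) := by
  obtain ⟨L, hL⟩ := D.exists_lipschitzWith_hat hd hΩb K
  rw [← setIntegral_eq_integral_of_forall_compl_eq_zero fun x hx => D.hat_eq_zero hx,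
    D.setIntegral_cell_eq_sum hd hΩb K
      fun σ hσ => D.integrableOn_cone_of_continuous hΩb hσ hL.continuous,
    D.cellVol_eq_sum hd hΩb, Finset.sum_div]
  exact Finset.sum_congr rfl fun σ hσ => D.setIntegral_cone_hat hΩb hσ

lemma sum_inner_bary_smul_normal (hd : 0 < d) (hΩb : Bornology.IsBounded Ω) (K : D.Cell)
    (a : Pt d) :
    ∑ σ ∈ D.edgesOf K, (D.edgeVol σ * inner ℝ a (D.bary σ - D.center K)) • D.normal K σ =
      D.cellVol K • a := by
  have hd1 : (d : ℝ) + 1 ≠ 0 := by positivity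
  refine ext_inner_right ℝ fun e => ?_
  have h := D.integral_lineDeriv_mul_hat hd hΩb K (lipschitzWith_level (c := D.center K) (m := a)) e
  simp only [(hasLineDerivAt_level (D.center K) a _ e).lineDeriv] at h
  rw [integral_const_mul, D.integral_hat hd hΩb] at h
  rw [sum_inner, real_inner_smul_left, ← mul_div_cancel₀ (D.cellVol K) hd1, mul_assoc,
    mul_comm _ (inner ℝ a e), h, Finset.mul_sum]
  refine Finset.sum_congr rfl fun σ hσ => ?_
  have := (D.dist_pos hσ).ne'
  rw [D.setIntegral_cone_level hΩb hσ, D.inner_levelVec, real_inner_smul_left, level]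
  field_simp

end Hat

end Discretisation

section HermitianMatrix

variable {n : Type*} [Fintype n] [DecidableEq n] {M : Matrix n n ℝ}

lemma inner_eigenvectorBasis_toEuclideanLin (hM : M.IsHermitian) (j : n)
    (v : EuclideanSpace ℝ n) :
    inner ℝ (hM.eigenvectorBasis j) (Matrix.toEuclideanLin M v) =
      hM.eigenvalues j * inner ℝ (hM.eigenvectorBasis j) v := by
  have heig : Matrix.toEuclideanLin M (hM.eigenvectorBasis j) =
      hM.eigenvalues j • hM.eigenvectorBasis j := by
    rw [Matrix.toLpLin_apply, hM.mulVec_eigenvectorBasis]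
    rfl
  rw [← Matrix.isSymmetric_toEuclideanLin_iff.2 hM, heig, inner_smul_left]
  rfl

lemma norm_toEuclideanLin_le (hM : M.IsHermitian) {r : ℝ} (hr : 0 ≤ r)
    (hs : ∀ l ∈ spectrum ℝ M, |l| ≤ r) (v : EuclideanSpace ℝ n) :
    ‖Matrix.toEuclideanLin M v‖ ≤ r * ‖v‖ := by
  refine le_of_sq_le_sq ?_ (by positivity)
  rw [mul_pow, ← hM.eigenvectorBasis.sum_sq_norm_inner_right,
    ← hM.eigenvectorBasis.sum_sq_norm_inner_right v, Finset.mul_sum]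
  refine Finset.sum_le_sum fun j _ => ?_
  rw [inner_eigenvectorBasis_toEuclideanLin, norm_mul, mul_pow]
  gcongr
  exact hs _ (hM.eigenvalues_mem_spectrum_real j)

lemma mul_norm_sq_le_inner_toEuclideanLin (hM : M.IsHermitian) {r : ℝ}
    (hs : ∀ l ∈ spectrum ℝ M, r ≤ l) (v : EuclideanSpace ℝ n) :
    r * ‖v‖ ^ 2 ≤ inner ℝ v (Matrix.toEuclideanLin M v) := by
  rw [← hM.eigenvectorBasis.sum_sq_norm_inner_right v,
    ← hM.eigenvectorBasis.sum_inner_mul_inner, Finset.mul_sum]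
  refine Finset.sum_le_sum fun j _ => ?_
  rw [inner_eigenvectorBasis_toEuclideanLin, real_inner_comm, Real.norm_eq_abs, sq_abs,
    mul_left_comm, ← sq]
  gcongr
  exact hs _ (hM.eigenvalues_mem_spectrum_real j)

end HermitianMatrix

lemma inner_toEuclideanLin_eq_sum {n : Type*} [Fintype n] [DecidableEq n] (M : Matrix n n ℝ)
    (a b : EuclideanSpace ℝ n) :
    inner ℝ a (Matrix.toEuclideanLin M b) = ∑ i, ∑ j, a i * (M i j * b j) := by
  rw [PiLp.inner_apply]
  refine Finset.sum_congr rfl fun i _ => ?_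
  rw [Matrix.toLpLin_apply]
  simp only [Matrix.mulVec, dotProduct, RCLike.inner_apply, conj_trivial]
  rw [mul_comm, Finset.mul_sum]

namespace IsDiffusionField

variable {d : ℕ} {Ω : Set (Pt d)} {lo hi : ℝ} {Λ : Pt d → Matrix (Fin d) (Fin d) ℝ}

lemma ae_symm (hΛ : IsDiffusionField Ω lo hi Λ) :
    ∀ᵐ x ∂(volume.restrict Ω), (Matrix.toEuclideanLin (Λ x)).IsSymmetric := by
  filter_upwards [hΛ.2] with x hx
  exact Matrix.isSymmetric_toEuclideanLin_iff.2 (Matrix.isHermitian_iff_isSymm.2 hx.1)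

lemma ae_norm_le (hΛ : IsDiffusionField Ω lo hi Λ) :
    ∀ᵐ x ∂(volume.restrict Ω), ∀ a : Pt d,
      ‖Matrix.toEuclideanLin (Λ x) a‖ ≤ max |lo| |hi| * ‖a‖ := by
  filter_upwards [hΛ.2] with x hx
  exact norm_toEuclideanLin_le (Matrix.isHermitian_iff_isSymm.2 hx.1) (by positivity)
    fun l hl => abs_le_max_abs_abs (hx.2 hl).1 (hx.2 hl).2

lemma ae_coercive (hΛ : IsDiffusionField Ω lo hi Λ) :
    ∀ᵐ x ∂(volume.restrict Ω), ∀ a : Pt d,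
      lo * ‖a‖ ^ 2 ≤ inner ℝ a (Matrix.toEuclideanLin (Λ x) a) := by
  filter_upwards [hΛ.2] with x hx
  exact mul_norm_sq_le_inner_toEuclideanLin (Matrix.isHermitian_iff_isSymm.2 hx.1)
    fun l hl => (hx.2 hl).1

lemma aestronglyMeasurable_apply (hΛ : IsDiffusionField Ω lo hi Λ) (hΩ : MeasurableSet Ω)
    {g : Pt d → Pt d} (hg : AEStronglyMeasurable g (volume.restrict Ω)) :
    AEStronglyMeasurable (fun x => Matrix.toEuclideanLin (Λ x) (g x)) (volume.restrict Ω) := by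
  have hΛij : ∀ i j, AEMeasurable (fun x => Λ x i j) (volume.restrict Ω) :=
    fun i j => aemeasurable_restrict_of_measurable_subtype hΩ (hΛ.1 i j)
  have hgj : ∀ j, AEMeasurable (fun x => g x j) (volume.restrict Ω) := fun j =>
    (EuclideanSpace.proj (𝕜 := ℝ) j).continuous.measurable.comp_aemeasurable hg.aemeasurable
  have hmulVec : AEMeasurable (fun x i => ∑ j, Λ x i j * g x j) (volume.restrict Ω) :=
    aemeasurable_pi_lambda _ fun i => Finset.aemeasurable_fun_sum _ fun j _ =>
      (hΛij i j).mul (hgj j)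
  exact ((PiLp.continuous_toLp 2 (fun _ : Fin d => ℝ)).measurable.comp_aemeasurable
    hmulVec).aestronglyMeasurable

lemma integrableOn_entry (hΛ : IsDiffusionField Ω lo hi Λ) (hΩ : MeasurableSet Ω)
    (hΩb : Bornology.IsBounded Ω) (i j : Fin d) : IntegrableOn (fun x => Λ x i j) Ω := by
  have : IsFiniteMeasure (volume.restrict Ω) :=
    isFiniteMeasure_restrict.2 hΩb.measure_lt_top.ne
  refine Integrable.of_bound (C := max |lo| |hi|)
    (aemeasurable_restrict_of_measurable_subtype hΩ (hΛ.1 i j)).aestronglyMeasurable ?_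
  filter_upwards [hΛ.ae_norm_le] with x hx
  have hentry : Λ x i j = Matrix.toEuclideanLin (Λ x) (EuclideanSpace.single j 1) i := by
    rw [Matrix.toLpLin_apply]
    simp
  rw [hentry]
  refine (PiLp.norm_apply_le _ i).trans ((hx (EuclideanSpace.single j 1)).trans ?_)
  simp

end IsDiffusionField

namespace Discretisation

variable {d : ℕ} {Ω : Set (Pt d)} (D : Discretisation d Ω) {K : D.Cell} {σ : D.Edge}

lemma finite_ratios :
    ({r | ∃ σ, D.IsInt σ ∧ ∃ K ∈ D.cellsOf σ, ∃ L ∈ D.cellsOf σ, r = D.dist K σ / D.dist L σ} ∪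
    {r | ∃ K, ∃ σ ∈ D.edgesOf K, r = D.cellDiam K / D.dist K σ}).Finite := by
  refine Set.Finite.union ?_ ?_
  · refine (Set.finite_range fun p : D.Edge × D.Cell × D.Cell =>
      D.dist p.2.1 p.1 / D.dist p.2.2 p.1).subset ?_
    rintro r ⟨σ, -, K, -, L, -, rfl⟩
    exact ⟨(σ, K, L), rfl⟩
  · refine (Set.finite_range fun p : D.Cell × D.Edge => D.cellDiam p.1 / D.dist p.1 p.2).subset ?_
    rintro r ⟨K, σ, -, rfl⟩
    exact ⟨(K, σ), rfl⟩

lemma cellDiam_le_mul_dist {θ : ℝ} (hθ : D.theta ≤ θ) (hσ : σ ∈ D.edgesOf K) :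
    D.cellDiam K ≤ θ * D.dist K σ := by
  rw [← div_le_iff₀ (D.dist_pos hσ)]
  exact (le_csSup D.finite_ratios.bddAbove (Or.inr ⟨K, σ, hσ, rfl⟩)).trans hθ

lemma cellDiam_nonneg (K : D.Cell) : 0 ≤ D.cellDiam K := Metric.diam_nonneg

lemma cellDiam_le_size (K : D.Cell) : D.cellDiam K ≤ D.size :=
  le_ciSup (Set.finite_range _).bddAbove K

lemma size_nonneg : 0 ≤ D.size := Real.iSup_nonneg fun K => D.cellDiam_nonneg K

section Energy

/-- The contribution of the cell `K` to `|u|_X ^ 2`. -/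
def cellEnergy (u : D.X) (K : D.Cell) : ℝ :=
  ∑ σ ∈ D.edgesOf K, D.edgeVol σ / D.dist K σ * (u.2 σ - u.1 K) ^ 2

/-- The contribution of the cell `K` to the square of the `L²` norm of `∇_D u`. -/
def gradEnergy (u : D.X) (K : D.Cell) : ℝ :=
  ∑ σ ∈ D.edgesOf K, volume.real (D.cone K σ) * ‖D.gradCone u K σ‖ ^ 2

lemma edgeVol_div_dist_nonneg (K : D.Cell) (σ : D.Edge) : 0 ≤ D.edgeVol σ / D.dist K σ :=
  div_nonneg measureReal_nonneg Metric.infDist_nonneg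

lemma cellEnergy_nonneg (u : D.X) (K : D.Cell) : 0 ≤ D.cellEnergy u K :=
  Finset.sum_nonneg fun σ _ => mul_nonneg (D.edgeVol_div_dist_nonneg K σ) (sq_nonneg _)

lemma seminormX_nonneg (u : D.X) : 0 ≤ D.seminormX u := Real.sqrt_nonneg _

lemma seminormX_sq (u : D.X) : D.seminormX u ^ 2 = ∑ K, D.cellEnergy u K :=
  Real.sq_sqrt (Finset.sum_nonneg fun K _ => D.cellEnergy_nonneg u K)

lemma cellVol_smul_gradCell (hΩb : Bornology.IsBounded Ω) (u : D.X) (K : D.Cell) :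
    D.cellVol K • D.gradCell u K =
      ∑ σ ∈ D.edgesOf K, (D.edgeVol σ * (u.2 σ - u.1 K)) • D.normal K σ :=
  smul_inv_smul₀ (D.cellVol_pos hΩb K).ne' _

lemma sum_volume_real_cone (hd : 0 < d) (hΩb : Bornology.IsBounded Ω) (K : D.Cell) :
    ∑ σ ∈ D.edgesOf K, volume.real (D.cone K σ) = D.cellVol K := by
  rw [D.cellVol_eq_sum hd hΩb]
  exact Finset.sum_congr rfl fun σ hσ => D.volume_real_cone hσ

lemma sum_stab_smul_normal (hd : 0 < d) (hΩb : Bornology.IsBounded Ω) (u : D.X) (K : D.Cell) :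
    ∑ σ ∈ D.edgesOf K, (volume.real (D.cone K σ) * D.stab u K σ) • D.normal K σ = 0 := by
  have hterm : ∀ σ ∈ D.edgesOf K, (volume.real (D.cone K σ) * D.stab u K σ) • D.normal K σ =
      (√(d : ℝ) / d) • ((D.edgeVol σ * (u.2 σ - u.1 K)) • D.normal K σ -
        (D.edgeVol σ * inner ℝ (D.gradCell u K) (D.bary σ - D.center K)) • D.normal K σ) := by
    intro σ hσ
    rw [← sub_smul, smul_smul, D.volume_real_cone hσ, stab]
    congr 1
    have := (D.dist_pos hσ).ne'
    field_simp
  rw [Finset.sum_congr rfl hterm, ← Finset.smul_sum, Finset.sum_sub_distrib,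
    D.sum_inner_bary_smul_normal hd hΩb, D.cellVol_smul_gradCell hΩb, sub_self, smul_zero]

lemma sum_volume_smul_gradCone (hd : 0 < d) (hΩb : Bornology.IsBounded Ω) (u : D.X)
    (K : D.Cell) :
    ∑ σ ∈ D.edgesOf K, volume.real (D.cone K σ) • D.gradCone u K σ =
      D.cellVol K • D.gradCell u K := by
  simp only [gradCone, smul_add, smul_smul]
  rw [Finset.sum_add_distrib, D.sum_stab_smul_normal hd hΩb, add_zero, ← Finset.sum_smul,
    D.sum_volume_real_cone hd hΩb]

lemma gradEnergy_eq (hd : 0 < d) (hΩb : Bornology.IsBounded Ω) (u : D.X) (K : D.Cell) :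
    D.gradEnergy u K = D.cellVol K * ‖D.gradCell u K‖ ^ 2 +
      ∑ σ ∈ D.edgesOf K, volume.real (D.cone K σ) * D.stab u K σ ^ 2 := by
  have hcross : ∑ σ ∈ D.edgesOf K, 2 * inner ℝ (D.gradCell u K)
      ((volume.real (D.cone K σ) * D.stab u K σ) • D.normal K σ) = 0 := by
    rw [← Finset.mul_sum, ← inner_sum, D.sum_stab_smul_normal hd hΩb, inner_zero_right, mul_zero]
  rw [← D.sum_volume_real_cone hd hΩb, Finset.sum_mul, ← Finset.sum_add_distrib, gradEnergy,
    ← add_zero (∑ σ ∈ D.edgesOf K, (_ + _)), ← hcross, ← Finset.sum_add_distrib]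
  refine Finset.sum_congr rfl fun σ hσ => ?_
  rw [gradCone, norm_add_sq_real, norm_smul, D.norm_normal hσ, inner_smul_right, inner_smul_right,
    mul_one, Real.norm_eq_abs, sq_abs]
  ring

lemma cellVol_mul_norm_gradCell_le (hΩb : Bornology.IsBounded Ω) (u : D.X) (K : D.Cell) :
    D.cellVol K * ‖D.gradCell u K‖ ≤ ∑ σ ∈ D.edgesOf K, D.edgeVol σ * |u.2 σ - u.1 K| := by
  rw [← Real.norm_of_nonneg (D.cellVol_pos hΩb K).le, ← norm_smul, D.cellVol_smul_gradCell hΩb]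
  refine (norm_sum_le _ _).trans (Finset.sum_le_sum fun σ hσ => ?_)
  rw [norm_smul, D.norm_normal hσ, mul_one, norm_mul, Real.norm_eq_abs, Real.norm_eq_abs,
    abs_of_pos (D.edgeVol_pos hΩb hσ)]

lemma cellVol_mul_norm_gradCell_sq_le (hd : 0 < d) (hΩb : Bornology.IsBounded Ω) (u : D.X)
    (K : D.Cell) : D.cellVol K * ‖D.gradCell u K‖ ^ 2 ≤ d * D.cellEnergy u K := by
  have hV := D.cellVol_pos hΩb K
  have hCS : (∑ σ ∈ D.edgesOf K, D.edgeVol σ * |u.2 σ - u.1 K|) ^ 2 ≤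
      (∑ σ ∈ D.edgesOf K, D.edgeVol σ * D.dist K σ) * D.cellEnergy u K := by
    refine Finset.sum_sq_le_sum_mul_sum_of_sq_le_mul _
      (fun σ hσ => (mul_pos (D.edgeVol_pos hΩb hσ) (D.dist_pos hσ)).le)
      (fun σ _ => mul_nonneg (D.edgeVol_div_dist_nonneg K σ) (sq_nonneg _))
      (fun σ hσ => le_of_eq ?_)
    have := (D.dist_pos hσ).ne'
    rw [mul_pow, sq_abs]
    field_simp
  rw [D.sum_edgeVol_mul_dist hd hΩb] at hCS
  refine le_of_mul_le_mul_left ?_ hV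
  calc D.cellVol K * (D.cellVol K * ‖D.gradCell u K‖ ^ 2)
      = (D.cellVol K * ‖D.gradCell u K‖) ^ 2 := by ring
    _ ≤ (∑ σ ∈ D.edgesOf K, D.edgeVol σ * |u.2 σ - u.1 K|) ^ 2 :=
        pow_le_pow_left₀ (by positivity) (D.cellVol_mul_norm_gradCell_le hΩb u K) 2
    _ ≤ d * D.cellVol K * D.cellEnergy u K := hCS
    _ = D.cellVol K * (d * D.cellEnergy u K) := by ring

lemma sum_inner_bary_sq_le (hd : 0 < d) (hΩb : Bornology.IsBounded Ω) {θ : ℝ}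
    (hθ : D.theta ≤ θ) (g : Pt d) (K : D.Cell) :
    ∑ σ ∈ D.edgesOf K, D.edgeVol σ / D.dist K σ * inner ℝ g (D.bary σ - D.center K) ^ 2 ≤
      d * θ ^ 2 * (D.cellVol K * ‖g‖ ^ 2) := by
  have hsum := D.sum_edgeVol_mul_dist hd hΩb K
  calc _ ≤ ∑ σ ∈ D.edgesOf K, D.edgeVol σ * D.dist K σ * (θ ^ 2 * ‖g‖ ^ 2) := by
        refine Finset.sum_le_sum fun σ hσ => ?_
        have hδ := D.dist_pos hσ
        have hbary : ‖D.bary σ - D.center K‖ ≤ θ * D.dist K σ :=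
          (D.norm_bary_sub_center_le hΩb hσ).trans (D.cellDiam_le_mul_dist hθ hσ)
        calc D.edgeVol σ / D.dist K σ * inner ℝ g (D.bary σ - D.center K) ^ 2
            ≤ D.edgeVol σ / D.dist K σ * (‖g‖ * (θ * D.dist K σ)) ^ 2 := by
              rw [← sq_abs]
              gcongr
              · exact D.edgeVol_div_dist_nonneg K σ
              · exact (abs_real_inner_le_norm _ _).trans (by gcongr)
          _ = _ := by field_simp
    _ = d * θ ^ 2 * (D.cellVol K * ‖g‖ ^ 2) := by rw [← Finset.sum_mul, hsum]; ring

lemma volume_cone_mul_stab_sq (u : D.X) (hσ : σ ∈ D.edgesOf K) :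
    volume.real (D.cone K σ) * D.stab u K σ ^ 2 = D.edgeVol σ / D.dist K σ *
      (u.2 σ - u.1 K - inner ℝ (D.gradCell u K) (D.bary σ - D.center K)) ^ 2 := by
  have hd : (d : ℝ) ≠ 0 := by exact_mod_cast (D.dim_pos σ).ne'
  have := (D.dist_pos hσ).ne'
  rw [D.volume_real_cone hσ, stab, mul_pow, div_pow, Real.sq_sqrt d.cast_nonneg]
  field_simp

lemma sum_stab_sq_le (hd : 0 < d) (hΩb : Bornology.IsBounded Ω) {θ : ℝ} (hθ : D.theta ≤ θ)
    (u : D.X) (K : D.Cell) :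
    ∑ σ ∈ D.edgesOf K, volume.real (D.cone K σ) * D.stab u K σ ^ 2 ≤
      2 * D.cellEnergy u K + 2 * (d * θ ^ 2 * (D.cellVol K * ‖D.gradCell u K‖ ^ 2)) := by
  grw [← D.sum_inner_bary_sq_le hd hΩb hθ (D.gradCell u K) K]
  rw [cellEnergy, Finset.mul_sum, Finset.mul_sum, ← Finset.sum_add_distrib]
  refine Finset.sum_le_sum fun σ hσ => ?_
  have hw := D.edgeVol_div_dist_nonneg K σ
  rw [D.volume_cone_mul_stab_sq u hσ]
  nlinarith [mul_nonneg hw (sq_nonneg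
    (u.2 σ - u.1 K + inner ℝ (D.gradCell u K) (D.bary σ - D.center K)))]

lemma cellEnergy_le_sum_stab_sq (hd : 0 < d) (hΩb : Bornology.IsBounded Ω) {θ : ℝ}
    (hθ : D.theta ≤ θ) (u : D.X) (K : D.Cell) :
    D.cellEnergy u K ≤ 2 * ∑ σ ∈ D.edgesOf K, volume.real (D.cone K σ) * D.stab u K σ ^ 2 +
      2 * (d * θ ^ 2 * (D.cellVol K * ‖D.gradCell u K‖ ^ 2)) := by
  grw [← D.sum_inner_bary_sq_le hd hΩb hθ (D.gradCell u K) K]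
  rw [cellEnergy, Finset.mul_sum, Finset.mul_sum, ← Finset.sum_add_distrib]
  refine Finset.sum_le_sum fun σ hσ => ?_
  have hw := D.edgeVol_div_dist_nonneg K σ
  rw [D.volume_cone_mul_stab_sq u hσ]
  nlinarith [mul_nonneg hw (sq_nonneg
    (u.2 σ - u.1 K - 2 * inner ℝ (D.gradCell u K) (D.bary σ - D.center K)))]

lemma sum_gradEnergy_le (hd : 0 < d) (hΩb : Bornology.IsBounded Ω) {θ : ℝ}
    (hθ : D.theta ≤ θ) (u : D.X) :
    ∑ K, D.gradEnergy u K ≤ (d + 2 + 2 * θ ^ 2 * d ^ 2) * D.seminormX u ^ 2 := by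
  rw [D.seminormX_sq, Finset.mul_sum]
  refine Finset.sum_le_sum fun K _ => ?_
  have hcell := D.cellVol_mul_norm_gradCell_sq_le hd hΩb u K
  have hstab := D.sum_stab_sq_le hd hΩb hθ u K
  rw [D.gradEnergy_eq hd hΩb]
  nlinarith [mul_le_mul_of_nonneg_left hcell (by positivity : 0 ≤ d * θ ^ 2)]

lemma seminormX_sq_le (hd : 0 < d) (hΩb : Bornology.IsBounded Ω) {θ : ℝ}
    (hθ : D.theta ≤ θ) (u : D.X) :
    D.seminormX u ^ 2 ≤ 2 * (1 + d * θ ^ 2) * ∑ K, D.gradEnergy u K := by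
  rw [D.seminormX_sq, Finset.mul_sum]
  refine Finset.sum_le_sum fun K _ => ?_
  have hstab : 0 ≤ ∑ σ ∈ D.edgesOf K, volume.real (D.cone K σ) * D.stab u K σ ^ 2 :=
    Finset.sum_nonneg fun σ _ => by positivity
  have hcell : 0 ≤ D.cellVol K * ‖D.gradCell u K‖ ^ 2 :=
    mul_nonneg measureReal_nonneg (sq_nonneg _)
  rw [D.gradEnergy_eq hd hΩb]
  nlinarith [D.cellEnergy_le_sum_stab_sq hd hΩb hθ u K,
    mul_nonneg (by positivity : 0 ≤ d * θ ^ 2) hstab]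

end Energy

lemma cone_subset (hσ : σ ∈ D.edgesOf K) : D.cone K σ ⊆ Ω :=
  (D.cone_subset_cell hσ).trans (D.cell_subset K)

lemma ae_restrict_cone {p : Pt d → Prop} (hp : ∀ᵐ x ∂(volume.restrict Ω), p x)
    (hσ : σ ∈ D.edgesOf K) : ∀ᵐ x ∂(volume.restrict (D.cone K σ)), p x :=
  ae_restrict_of_ae_restrict_of_subset (D.cone_subset hσ) hp

lemma integrableOn_cell_of_cone {E : Type*} [NormedAddCommGroup E]
    (hd : 0 < d) (hΩb : Bornology.IsBounded Ω) {f : Pt d → E}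
    (hf : ∀ σ ∈ D.edgesOf K, IntegrableOn f (D.cone K σ)) : IntegrableOn f (D.cell K) :=
  (integrableOn_finset_iUnion.2 hf).congr_set_ae (D.cell_ae_eq_cones hd hΩb K).symm

lemma setIntegral_eq_sum_cell {E : Type*} [NormedAddCommGroup E] [NormedSpace ℝ E]
    {f : Pt d → E} (hf : ∀ K, IntegrableOn f (D.cell K)) :
    ∫ x in Ω, f x = ∑ K, ∫ x in D.cell K, f x := by
  rw [← setIntegral_congr_set D.iUnion_cell_ae_eq,
    integral_iUnion_fintype (fun K => (D.cell_isOpen K).measurableSet) D.cell_disjoint hf]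

lemma setIntegral_eq_sum_cone {E : Type*} [NormedAddCommGroup E] [NormedSpace ℝ E]
    (hd : 0 < d) (hΩb : Bornology.IsBounded Ω) {f : Pt d → E}
    (hf : ∀ K, ∀ σ ∈ D.edgesOf K, IntegrableOn f (D.cone K σ)) :
    ∫ x in Ω, f x = ∑ K, ∑ σ ∈ D.edgesOf K, ∫ x in D.cone K σ, f x := by
  rw [D.setIntegral_eq_sum_cell fun K => D.integrableOn_cell_of_cone hd hΩb (hf K)]
  exact Finset.sum_congr rfl fun K _ => D.setIntegral_cell_eq_sum hd hΩb K (hf K)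

lemma sum_cellVol (hΩb : Bornology.IsBounded Ω) : ∑ K, D.cellVol K = volume.real Ω := by
  have h := D.setIntegral_eq_sum_cell (f := fun _ => (1 : ℝ))
    fun K => integrableOn_const (D.volume_cell_lt_top hΩb K).ne
  simp only [setIntegral_const, smul_eq_mul, mul_one] at h
  exact h.symm

lemma grad_of_mem_cone (u : D.X) (hσ : σ ∈ D.edgesOf K) {x : Pt d} (hx : x ∈ D.cone K σ) :
    D.grad u x = D.gradCone u K σ := by
  rw [grad, Finset.sum_eq_single K, Finset.sum_eq_single σ, Set.indicator_of_mem hx]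
  · intro τ hτ h
    exact Set.indicator_of_notMem (Set.disjoint_left.1 (D.disjoint_cone hσ hτ h.symm) hx) _
  · exact fun h => absurd hσ h
  · intro L _ h
    refine Finset.sum_eq_zero fun τ hτ => Set.indicator_of_notMem (fun hx' => ?_) _
    exact Set.disjoint_left.1 (D.cell_disjoint h) (D.cone_subset_cell hτ hx')
      (D.cone_subset_cell hσ hx)
  · exact fun h => absurd (Finset.mem_univ _) h

lemma grad_of_notMem (u : D.X) {x : Pt d} (hx : x ∉ Ω) : D.grad u x = 0 :=
  Finset.sum_eq_zero fun _ _ => Finset.sum_eq_zero fun _ hσ =>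
    Set.indicator_of_notMem (fun h => hx (D.cone_subset hσ h)) _

section Fluxes

lemma yVec_eq (K : D.Cell) (τ σ : D.Edge) :
    D.yVec K τ σ = (D.cellVol K)⁻¹ • D.edgeVol σ • D.normal K σ +
      (√(d : ℝ) / D.dist K τ * ((if σ = τ then 1 else 0) -
        inner ℝ ((D.cellVol K)⁻¹ • D.edgeVol σ • D.normal K σ) (D.bary τ - D.center K))) •
          D.normal K τ := by
  rw [yVec]
  simp only [inner_smul_left, conj_trivial]
  by_cases h : τ = σ
  · subst h
    rw [if_pos rfl, if_pos rfl, smul_smul]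
    congr 2 <;> ring
  · rw [if_neg h, if_neg (Ne.symm h), smul_smul, sub_eq_add_neg, ← neg_smul]
    congr 2 <;> ring

lemma gradCone_eq_sum (u : D.X) {τ : D.Edge} (hτ : τ ∈ D.edgesOf K) :
    D.gradCone u K τ = ∑ σ ∈ D.edgesOf K, (u.2 σ - u.1 K) • D.yVec K τ σ := by
  have hgrad : D.gradCell u K = ∑ σ ∈ D.edgesOf K,
      (u.2 σ - u.1 K) • (D.cellVol K)⁻¹ • D.edgeVol σ • D.normal K σ := by
    rw [gradCell, Finset.smul_sum]
    refine Finset.sum_congr rfl fun σ _ => ?_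
    simp only [smul_smul]
    ring_nf
  have hstab : D.stab u K τ = ∑ σ ∈ D.edgesOf K, (u.2 σ - u.1 K) *
      (√(d : ℝ) / D.dist K τ * ((if σ = τ then 1 else 0) -
        inner ℝ ((D.cellVol K)⁻¹ • D.edgeVol σ • D.normal K σ) (D.bary τ - D.center K))) := by
    simp_rw [mul_left_comm _ (√(d : ℝ) / D.dist K τ), mul_sub, mul_ite, mul_one, mul_zero]
    rw [stab, hgrad, sum_inner, Finset.sum_sub_distrib, Finset.sum_ite_eq_of_mem' _ _ _ hτ,
      mul_sub, Finset.mul_sum]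
    simp only [inner_smul_left _ _ (_ - _ : ℝ), conj_trivial]
  simp only [yVec_eq, smul_add, Finset.sum_add_distrib, smul_smul _ _ (D.normal K τ)]
  rw [gradCone, ← Finset.sum_smul, ← hgrad, ← hstab]

lemma sum_sushiFlux_mul (Λ : Pt d → Matrix (Fin d) (Fin d) ℝ) (u v : D.X) (K : D.Cell) :
    ∑ σ ∈ D.edgesOf K, D.sushiFlux Λ K σ u * (v.1 K - v.2 σ) =
      ∑ τ ∈ D.edgesOf K, inner ℝ (D.gradCone v K τ)
        (Matrix.toEuclideanLin (D.coneIntegral Λ K τ) (D.gradCone u K τ)) := by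
  have hbilin : ∀ τ ∈ D.edgesOf K, inner ℝ (D.gradCone v K τ)
        (Matrix.toEuclideanLin (D.coneIntegral Λ K τ) (D.gradCone u K τ)) =
      ∑ σ ∈ D.edgesOf K, ∑ σ' ∈ D.edgesOf K, (u.2 σ' - u.1 K) * ((v.2 σ - v.1 K) *
        inner ℝ (D.yVec K τ σ)
          (Matrix.toEuclideanLin (D.coneIntegral Λ K τ) (D.yVec K τ σ'))) := by
    intro τ hτ
    simp only [D.gradCone_eq_sum _ hτ, sum_inner, map_sum, map_smul, inner_sum,
      inner_smul_left, inner_smul_right, conj_trivial, Finset.mul_sum]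
    exact Finset.sum_comm
  have hflux : ∀ σ, D.sushiFlux Λ K σ u =
      ∑ σ' ∈ D.edgesOf K, D.localMatrix Λ K σ σ' * (u.1 K - u.2 σ') := by
    simp [sushiFlux, diffForm]
  rw [Finset.sum_congr rfl hbilin, Finset.sum_comm]
  refine Finset.sum_congr rfl fun σ _ => ?_
  rw [hflux, Finset.sum_comm, Finset.sum_mul]
  refine Finset.sum_congr rfl fun σ' _ => ?_
  rw [localMatrix, Finset.sum_mul, Finset.sum_mul]
  exact Finset.sum_congr rfl fun τ _ => by ring

variable {lo hi : ℝ} {Λ : Pt d → Matrix (Fin d) (Fin d) ℝ}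

lemma integrableOn_cone_inner (hΛ : IsDiffusionField Ω lo hi Λ) (hΩ : MeasurableSet Ω)
    (hΩb : Bornology.IsBounded Ω) (hσ : σ ∈ D.edgesOf K) (a b : Pt d) :
    IntegrableOn (fun x => inner ℝ a (Matrix.toEuclideanLin (Λ x) b)) (D.cone K σ) := by
  simp_rw [inner_toEuclideanLin_eq_sum]
  exact integrable_finsetSum _ fun i _ => integrable_finsetSum _ fun j _ =>
    (((hΛ.integrableOn_entry hΩ hΩb i j).mono_set (D.cone_subset hσ)).mul_const _).const_mul _

lemma inner_coneIntegral (hΛ : IsDiffusionField Ω lo hi Λ) (hΩ : MeasurableSet Ω)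
    (hΩb : Bornology.IsBounded Ω) (hσ : σ ∈ D.edgesOf K) (a b : Pt d) :
    inner ℝ a (Matrix.toEuclideanLin (D.coneIntegral Λ K σ) b) =
      ∫ x in D.cone K σ, inner ℝ a (Matrix.toEuclideanLin (Λ x) b) := by
  have hint : ∀ i j, IntegrableOn (fun x => a i * (Λ x i j * b j)) (D.cone K σ) := fun i j =>
    (((hΛ.integrableOn_entry hΩ hΩb i j).mono_set (D.cone_subset hσ)).mul_const _).const_mul _
  simp_rw [inner_toEuclideanLin_eq_sum]
  rw [integral_finsetSum _ fun i _ => integrable_finsetSum _ fun j _ => hint i j]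
  refine Finset.sum_congr rfl fun i _ => ?_
  rw [integral_finsetSum _ fun j _ => hint i j]
  refine Finset.sum_congr rfl fun j _ => ?_
  rw [integral_const_mul, integral_mul_const, coneIntegral, Matrix.of_apply]

lemma setIntegral_cone_inner_comm (hΛ : IsDiffusionField Ω lo hi Λ) (hσ : σ ∈ D.edgesOf K)
    (a b : Pt d) :
    ∫ x in D.cone K σ, inner ℝ a (Matrix.toEuclideanLin (Λ x) b) =
      ∫ x in D.cone K σ, inner ℝ b (Matrix.toEuclideanLin (Λ x) a) := by
  refine integral_congr_ae ?_
  filter_upwards [D.ae_restrict_cone hΛ.ae_symm hσ] with x hx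
  rw [← hx, real_inner_comm]

lemma form_sushiFlux_eq_sum (hΛ : IsDiffusionField Ω lo hi Λ) (hΩ : MeasurableSet Ω)
    (hΩb : Bornology.IsBounded Ω) (u v : D.X) :
    D.form (D.sushiFlux Λ) u v = ∑ K, ∑ σ ∈ D.edgesOf K, ∫ x in D.cone K σ,
      inner ℝ (D.gradCone u K σ) (Matrix.toEuclideanLin (Λ x) (D.gradCone v K σ)) := by
  refine Finset.sum_congr rfl fun K _ => ?_
  rw [D.sum_sushiFlux_mul]
  refine Finset.sum_congr rfl fun σ hσ => ?_
  rw [D.inner_coneIntegral hΛ hΩ hΩb hσ, D.setIntegral_cone_inner_comm hΛ hσ]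

lemma form_sushiFlux_eq_integral (hd : 0 < d) (hΛ : IsDiffusionField Ω lo hi Λ)
    (hΩ : MeasurableSet Ω) (hΩb : Bornology.IsBounded Ω) (u v : D.X) :
    D.form (D.sushiFlux Λ) u v =
      ∫ x in Ω, inner ℝ (D.grad u x) (Matrix.toEuclideanLin (Λ x) (D.grad v x)) := by
  have heq : ∀ K, ∀ σ ∈ D.edgesOf K, Set.EqOn
      (fun x => inner ℝ (D.gradCone u K σ) (Matrix.toEuclideanLin (Λ x) (D.gradCone v K σ)))
      (fun x => inner ℝ (D.grad u x) (Matrix.toEuclideanLin (Λ x) (D.grad v x)))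
      (D.cone K σ) := by
    intro K σ hσ x hx
    simp only [D.grad_of_mem_cone _ hσ hx]
  rw [D.form_sushiFlux_eq_sum hΛ hΩ hΩb, D.setIntegral_eq_sum_cone hd hΩb]
  · exact Finset.sum_congr rfl fun K _ => Finset.sum_congr rfl fun σ hσ =>
      setIntegral_congr_fun (D.measurableSet_cone hσ) (heq K σ hσ)
  · exact fun K σ hσ => (D.integrableOn_cone_inner hΛ hΩ hΩb hσ _ _).congr_fun
      (heq K σ hσ) (D.measurableSet_cone hσ)

lemma form_sushiFlux_comm (hΛ : IsDiffusionField Ω lo hi Λ) (hΩ : MeasurableSet Ω)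
    (hΩb : Bornology.IsBounded Ω) (u v : D.X) :
    D.form (D.sushiFlux Λ) u v = D.form (D.sushiFlux Λ) v u := by
  rw [D.form_sushiFlux_eq_sum hΛ hΩ hΩb, D.form_sushiFlux_eq_sum hΛ hΩ hΩb]
  exact Finset.sum_congr rfl fun K _ => Finset.sum_congr rfl fun σ hσ =>
    D.setIntegral_cone_inner_comm hΛ hσ _ _

lemma sum_volume_mul_norm_mul_norm_le (a b : D.Cell → D.Edge → Pt d) :
    ∑ K, ∑ σ ∈ D.edgesOf K, volume.real (D.cone K σ) * (‖a K σ‖ * ‖b K σ‖) ≤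
      √(∑ K, ∑ σ ∈ D.edgesOf K, volume.real (D.cone K σ) * ‖a K σ‖ ^ 2) *
      √(∑ K, ∑ σ ∈ D.edgesOf K, volume.real (D.cone K σ) * ‖b K σ‖ ^ 2) := by
  rw [Finset.sum_sigma', Finset.sum_sigma', Finset.sum_sigma']
  have h := Real.sum_mul_le_sqrt_mul_sqrt (Finset.univ.sigma D.edgesOf)
    (fun p => √(volume.real (D.cone p.1 p.2)) * ‖a p.1 p.2‖)
    (fun p => √(volume.real (D.cone p.1 p.2)) * ‖b p.1 p.2‖)
  simp only [mul_pow, Real.sq_sqrt measureReal_nonneg] at h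
  refine le_trans (le_of_eq (Finset.sum_congr rfl fun p _ => ?_)) h
  rw [mul_mul_mul_comm, Real.mul_self_sqrt measureReal_nonneg]

lemma setIntegral_cone_inner_le (hΛ : IsDiffusionField Ω lo hi Λ)
    (hΩb : Bornology.IsBounded Ω) (hσ : σ ∈ D.edgesOf K) (a b : Pt d) :
    ∫ x in D.cone K σ, inner ℝ a (Matrix.toEuclideanLin (Λ x) b) ≤
      max |lo| |hi| * (volume.real (D.cone K σ) * (‖a‖ * ‖b‖)) := by
  refine (Real.le_norm_self _).trans ((norm_setIntegral_le_of_norm_le_const_ae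
    (C := max |lo| |hi| * (‖a‖ * ‖b‖)) (D.volume_cone_lt_top hΩb hσ) ?_).trans
    (le_of_eq (by ring)))
  filter_upwards [D.ae_restrict_cone hΛ.ae_norm_le hσ] with x hx
  calc ‖(inner ℝ a (Matrix.toEuclideanLin (Λ x) b) : ℝ)‖
      ≤ ‖a‖ * (max |lo| |hi| * ‖b‖) := (norm_inner_le_norm _ _).trans (by gcongr; exact hx b)
    _ = max |lo| |hi| * (‖a‖ * ‖b‖) := by ring

lemma form_sushiFlux_le (hd : 0 < d) (hΛ : IsDiffusionField Ω lo hi Λ)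
    (hΩ : MeasurableSet Ω) (hΩb : Bornology.IsBounded Ω) {θ : ℝ}
    (hθ : D.theta ≤ θ) (u v : D.X) :
    D.form (D.sushiFlux Λ) u v ≤
      max |lo| |hi| * (d + 2 + 2 * θ ^ 2 * d ^ 2) * D.seminormX u * D.seminormX v := by
  set C : ℝ := d + 2 + 2 * θ ^ 2 * d ^ 2
  have hC : 0 ≤ C := by positivity
  have hform : D.form (D.sushiFlux Λ) u v ≤ max |lo| |hi| * ∑ K, ∑ σ ∈ D.edgesOf K,
      volume.real (D.cone K σ) * (‖D.gradCone u K σ‖ * ‖D.gradCone v K σ‖) := by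
    simp_rw [D.form_sushiFlux_eq_sum hΛ hΩ hΩb, Finset.mul_sum]
    exact Finset.sum_le_sum fun K _ => Finset.sum_le_sum fun σ hσ =>
      D.setIntegral_cone_inner_le hΛ hΩb hσ _ _
  have hgrad : ∀ u : D.X, √(∑ K, ∑ σ ∈ D.edgesOf K,
      volume.real (D.cone K σ) * ‖D.gradCone u K σ‖ ^ 2) ≤ √C * D.seminormX u := fun u => by
    rw [← Real.sqrt_sq (D.seminormX_nonneg u), ← Real.sqrt_mul hC]
    exact Real.sqrt_le_sqrt (D.sum_gradEnergy_le hd hΩb hθ u)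
  calc D.form (D.sushiFlux Λ) u v
      ≤ max |lo| |hi| * ((√C * D.seminormX u) * (√C * D.seminormX v)) := by
        refine hform.trans (mul_le_mul_of_nonneg_left
          ((D.sum_volume_mul_norm_mul_norm_le _ _).trans ?_) (by positivity))
        exact mul_le_mul (hgrad u) (hgrad v) (Real.sqrt_nonneg _)
          (mul_nonneg (Real.sqrt_nonneg _) (D.seminormX_nonneg u))
    _ = max |lo| |hi| * (√C * √C) * D.seminormX u * D.seminormX v := by ring
    _ = max |lo| |hi| * C * D.seminormX u * D.seminormX v := by rw [Real.mul_self_sqrt hC]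

lemma mul_sum_gradEnergy_le_form_sushiFlux (hΛ : IsDiffusionField Ω lo hi Λ)
    (hΩ : MeasurableSet Ω) (hΩb : Bornology.IsBounded Ω) (u : D.X) :
    lo * ∑ K, D.gradEnergy u K ≤ D.form (D.sushiFlux Λ) u u := by
  simp_rw [D.form_sushiFlux_eq_sum hΛ hΩ hΩb, gradEnergy, Finset.mul_sum]
  refine Finset.sum_le_sum fun K _ => Finset.sum_le_sum fun σ hσ => ?_
  have hconst : lo * (volume.real (D.cone K σ) * ‖D.gradCone u K σ‖ ^ 2) =
      ∫ _ in D.cone K σ, lo * ‖D.gradCone u K σ‖ ^ 2 := by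
    rw [setIntegral_const, smul_eq_mul, mul_left_comm]
  rw [hconst]
  refine integral_mono_ae (integrableOn_const (D.volume_cone_lt_top hΩb hσ).ne)
    (D.integrableOn_cone_inner hΛ hΩ hΩb hσ _ _) ?_
  filter_upwards [D.ae_restrict_cone hΛ.ae_coercive hσ] with x hx using hx _

lemma le_form_sushiFlux (hd : 0 < d) (hlo : 0 ≤ lo) (hΛ : IsDiffusionField Ω lo hi Λ)
    (hΩ : MeasurableSet Ω) (hΩb : Bornology.IsBounded Ω) {θ : ℝ}
    (hθ : D.theta ≤ θ) (u : D.X) :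
    lo / (2 * (1 + d * θ ^ 2)) * D.seminormX u ^ 2 ≤ D.form (D.sushiFlux Λ) u u := by
  refine le_trans ?_ (D.mul_sum_gradEnergy_le_form_sushiFlux hΛ hΩ hΩb u)
  calc lo / (2 * (1 + d * θ ^ 2)) * D.seminormX u ^ 2
      ≤ lo / (2 * (1 + d * θ ^ 2)) * (2 * (1 + d * θ ^ 2) * ∑ K, D.gradEnergy u K) := by
        gcongr
        exact D.seminormX_sq_le hd hΩb hθ u
    _ = lo * ∑ K, D.gradEnergy u K := by field_simp

end Fluxes

end Discretisation

/-- `B` bounds the gradient of the differentiable function `φ` and its Lipschitz constant: a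
quantitative form of `φ ∈ W^{2,∞}`, all that the error estimates see of a test function. -/
structure IsSmoothBound {E : Type*} [NormedAddCommGroup E] [InnerProductSpace ℝ E]
    [CompleteSpace E] (φ : E → ℝ) (B : ℝ) : Prop where
  differentiable : Differentiable ℝ φ
  norm_gradient_le : ∀ x, ‖gradient φ x‖ ≤ B
  norm_gradient_sub_le : ∀ x y, ‖gradient φ y - gradient φ x‖ ≤ B * ‖y - x‖

namespace IsSmoothBound

variable {E : Type*} [NormedAddCommGroup E] [InnerProductSpace ℝ E] [CompleteSpace E]
  {φ : E → ℝ} {B : ℝ}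

lemma nonneg (hφ : IsSmoothBound φ B) : 0 ≤ B := (norm_nonneg _).trans (hφ.norm_gradient_le 0)

lemma continuous_gradient (hφ : IsSmoothBound φ B) : Continuous (gradient φ) :=
  (LipschitzWith.of_dist_le' fun x y => by
    simpa only [dist_eq_norm] using hφ.norm_gradient_sub_le y x).continuous

lemma abs_sub_le (hφ : IsSmoothBound φ B) (x y : E) : |φ y - φ x| ≤ B * ‖y - x‖ :=
  convex_univ.norm_image_sub_le_of_norm_fderiv_le (𝕜 := ℝ) (fun z _ => hφ.differentiable z)
    (fun z _ => by simpa [gradient] using hφ.norm_gradient_le z) (Set.mem_univ x) (Set.mem_univ y)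

lemma abs_taylor_le (hφ : IsSmoothBound φ B) (x y : E) :
    |φ y - φ x - inner ℝ (gradient φ x) (y - x)| ≤ B * ‖y - x‖ ^ 2 := by
  have hB := hφ.nonneg
  have hderiv : ∀ z ∈ segment ℝ x y, ‖fderiv ℝ φ z - fderiv ℝ φ x‖ ≤ B * ‖y - x‖ := by
    intro z hz
    have hgrad := hφ.norm_gradient_sub_le x z
    rw [gradient, gradient, ← map_sub, LinearIsometryEquiv.norm_map] at hgrad
    refine hgrad.trans ?_
    gcongr
    exact norm_sub_le_of_mem_segment hz
  rw [inner_gradient_left, sq, ← mul_assoc, ← Real.norm_eq_abs]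
  exact (convex_segment x y).norm_image_sub_le_of_norm_fderiv_le' (𝕜 := ℝ)
    (fun z _ => hφ.differentiable z) hderiv (left_mem_segment ℝ x y) (right_mem_segment ℝ x y)

end IsSmoothBound

lemma exists_isSmoothBound {E : Type*} [NormedAddCommGroup E] [InnerProductSpace ℝ E]
    [CompleteSpace E] {φ : E → ℝ} (hφ : ContDiff ℝ 2 φ) (hc : HasCompactSupport φ) :
    ∃ B, IsSmoothBound φ B := by
  obtain ⟨C₁, h₁⟩ := hφ.lipschitzWith_of_hasCompactSupport hc (by simp)
  obtain ⟨C₂, h₂⟩ := (hφ.fderiv_right (m := 1) (by norm_num)).lipschitzWith_of_hasCompactSupport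
    (hc.fderiv ℝ) (by simp)
  refine ⟨max C₁ C₂, hφ.differentiable (by simp), fun x => ?_, fun x y => ?_⟩
  · rw [gradient, LinearIsometryEquiv.norm_map]
    exact (norm_fderiv_le_of_lipschitz ℝ h₁).trans (le_max_left _ _)
  · rw [gradient, gradient, ← map_sub, LinearIsometryEquiv.norm_map, ← dist_eq_norm,
      ← dist_eq_norm]
    refine (h₂.dist_le_mul y x).trans ?_
    gcongr
    exact le_max_right _ _

namespace Discretisation

variable {d : ℕ} {Ω : Set (Pt d)} (D : Discretisation d Ω) {K : D.Cell} {σ : D.Edge}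
  {φ : Pt d → ℝ} {B θ : ℝ}

section Interpolation

lemma theta_nonneg : 0 ≤ D.theta := by
  refine Real.sSup_nonneg ?_
  rintro r (⟨σ, _, K, _, L, _, rfl⟩ | ⟨K, σ, _, rfl⟩)
  · exact div_nonneg Metric.infDist_nonneg Metric.infDist_nonneg
  · exact div_nonneg (D.cellDiam_nonneg K) Metric.infDist_nonneg

lemma norm_sub_center_le_of_mem_cone (hΩb : Bornology.IsBounded Ω) (hσ : σ ∈ D.edgesOf K)
    {x : Pt d} (hx : x ∈ D.cone K σ) : ‖x - D.center K‖ ≤ D.cellDiam K :=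
  D.norm_sub_center_le hΩb (subset_closure (D.cone_subset_cell hσ hx))

lemma norm_sum_smul_normal_le (hd : 0 < d) (hΩb : Bornology.IsBounded Ω) (hθ : D.theta ≤ θ)
    (hB : 0 ≤ B) (K : D.Cell) {ρ : D.Edge → ℝ}
    (hρ : ∀ σ ∈ D.edgesOf K, |ρ σ| ≤ B * D.cellDiam K ^ 2) :
    ‖∑ σ ∈ D.edgesOf K, (D.edgeVol σ * ρ σ) • D.normal K σ‖ ≤
      B * θ * d * D.cellDiam K * D.cellVol K := by
  have hh := D.cellDiam_nonneg K
  calc ‖∑ σ ∈ D.edgesOf K, (D.edgeVol σ * ρ σ) • D.normal K σ‖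
      ≤ ∑ σ ∈ D.edgesOf K, B * θ * D.cellDiam K * (D.edgeVol σ * D.dist K σ) := by
        refine norm_sum_le_of_le _ fun σ hσ => ?_
        have hm := D.edgeVol_pos hΩb hσ
        rw [norm_smul, D.norm_normal hσ, mul_one, norm_mul, Real.norm_of_nonneg hm.le,
          Real.norm_eq_abs]
        calc D.edgeVol σ * |ρ σ| ≤ D.edgeVol σ * (B * D.cellDiam K ^ 2) := by
              gcongr; exact hρ σ hσ
          _ = D.edgeVol σ * (B * D.cellDiam K * D.cellDiam K) := by ring
          _ ≤ D.edgeVol σ * (B * D.cellDiam K * (θ * D.dist K σ)) := by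
              gcongr; exact D.cellDiam_le_mul_dist hθ hσ
          _ = B * θ * D.cellDiam K * (D.edgeVol σ * D.dist K σ) := by ring
    _ = B * θ * d * D.cellDiam K * D.cellVol K := by
        rw [← Finset.mul_sum, D.sum_edgeVol_mul_dist hd hΩb]; ring

lemma abs_taylor_bary_le (hΩb : Bornology.IsBounded Ω) (hφ : IsSmoothBound φ B)
    (hσ : σ ∈ D.edgesOf K) :
    |φ (D.bary σ) - φ (D.center K) -
      inner ℝ (gradient φ (D.center K)) (D.bary σ - D.center K)| ≤ B * D.cellDiam K ^ 2 := by
  refine (hφ.abs_taylor_le _ _).trans ?_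
  have := hφ.nonneg
  gcongr
  exact D.norm_bary_sub_center_le hΩb hσ

lemma norm_gradCell_interp_sub_le (hd : 0 < d) (hΩb : Bornology.IsBounded Ω)
    (hθ : D.theta ≤ θ) (hφ : IsSmoothBound φ B) (K : D.Cell) :
    ‖D.gradCell (D.interp φ) K - gradient φ (D.center K)‖ ≤ B * θ * d * D.cellDiam K := by
  have hV := D.cellVol_pos hΩb K
  have hremainder : ∑ σ ∈ D.edgesOf K, (D.edgeVol σ * (φ (D.bary σ) - φ (D.center K) -
      inner ℝ (gradient φ (D.center K)) (D.bary σ - D.center K))) • D.normal K σ =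
      D.cellVol K • (D.gradCell (D.interp φ) K - gradient φ (D.center K)) := by
    simp_rw [smul_sub, D.cellVol_smul_gradCell hΩb, ← D.sum_inner_bary_smul_normal hd hΩb,
      ← Finset.sum_sub_distrib, ← sub_smul, ← mul_sub, interp]
  have h := D.norm_sum_smul_normal_le hd hΩb hθ hφ.nonneg K
    fun σ hσ => D.abs_taylor_bary_le hΩb hφ hσ
  rw [hremainder, norm_smul, Real.norm_of_nonneg hV.le, mul_comm] at h
  exact le_of_mul_le_mul_right h hV

lemma abs_stab_interp_le (hd : 0 < d) (hΩb : Bornology.IsBounded Ω) (hθ : D.theta ≤ θ)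
    (hφ : IsSmoothBound φ B) (hσ : σ ∈ D.edgesOf K) :
    |D.stab (D.interp φ) K σ| ≤ √(d : ℝ) * θ * (B * θ * d + B) * D.cellDiam K := by
  have hB := hφ.nonneg
  have hθ₀ := D.theta_nonneg.trans hθ
  have hh := D.cellDiam_nonneg K
  have hδ := D.dist_pos hσ
  set g := gradient φ (D.center K)
  set G := D.gradCell (D.interp φ) K
  set r := D.bary σ - D.center K
  have hgrad : |inner ℝ (G - g) r| ≤ B * θ * d * D.cellDiam K * D.cellDiam K :=
    (abs_real_inner_le_norm _ _).trans (mul_le_mul (D.norm_gradCell_interp_sub_le hd hΩb hθ hφ K)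
      (D.norm_bary_sub_center_le hΩb hσ) (norm_nonneg _) (by positivity))
  have hresidual : |φ (D.bary σ) - φ (D.center K) - inner ℝ G r| ≤
      (B * θ * d + B) * D.cellDiam K * D.cellDiam K :=
    calc |φ (D.bary σ) - φ (D.center K) - inner ℝ G r|
        = |φ (D.bary σ) - φ (D.center K) - inner ℝ g r - inner ℝ (G - g) r| := by
          rw [inner_sub_left]; congr 1; ring
      _ ≤ B * D.cellDiam K ^ 2 + B * θ * d * D.cellDiam K * D.cellDiam K :=
          (abs_sub _ _).trans (add_le_add (D.abs_taylor_bary_le hΩb hφ hσ) hgrad)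
      _ = (B * θ * d + B) * D.cellDiam K * D.cellDiam K := by ring
  calc |D.stab (D.interp φ) K σ|
      = √(d : ℝ) / D.dist K σ * |φ (D.bary σ) - φ (D.center K) - inner ℝ G r| := by
        rw [stab, abs_mul, abs_of_nonneg (by positivity : 0 ≤ √(d : ℝ) / D.dist K σ)]; rfl
    _ ≤ √(d : ℝ) / D.dist K σ * ((B * θ * d + B) * D.cellDiam K * (θ * D.dist K σ)) := by
        gcongr
        refine hresidual.trans ?_
        gcongr
        exact D.cellDiam_le_mul_dist hθ hσ
    _ = √(d : ℝ) * θ * (B * θ * d + B) * D.cellDiam K := by field_simp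

lemma norm_gradCone_interp_sub_le (hd : 0 < d) (hΩb : Bornology.IsBounded Ω)
    (hθ : D.theta ≤ θ) (hφ : IsSmoothBound φ B) (hσ : σ ∈ D.edgesOf K) {x : Pt d}
    (hx : x ∈ D.cone K σ) :
    ‖D.gradCone (D.interp φ) K σ - gradient φ x‖ ≤
      B * (θ * d + √(d : ℝ) * θ * (θ * d + 1) + 1) * D.size := by
  have hB := hφ.nonneg
  have hθ₀ := D.theta_nonneg.trans hθ
  set g := gradient φ (D.center K)
  set G := D.gradCell (D.interp φ) K
  have hsmooth : ‖g - gradient φ x‖ ≤ B * D.cellDiam K := by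
    rw [norm_sub_rev]
    refine (hφ.norm_gradient_sub_le _ _).trans ?_
    gcongr
    exact D.norm_sub_center_le_of_mem_cone hΩb hσ hx
  have hstab : ‖D.stab (D.interp φ) K σ • D.normal K σ‖ ≤
      √(d : ℝ) * θ * (B * θ * d + B) * D.cellDiam K := by
    rw [norm_smul, D.norm_normal hσ, mul_one, Real.norm_eq_abs]
    exact D.abs_stab_interp_le hd hΩb hθ hφ hσ
  calc ‖D.gradCone (D.interp φ) K σ - gradient φ x‖
      = ‖(G - g) + D.stab (D.interp φ) K σ • D.normal K σ + (g - gradient φ x)‖ := by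
        rw [gradCone]; congr 1; abel
    _ ≤ B * θ * d * D.cellDiam K + √(d : ℝ) * θ * (B * θ * d + B) * D.cellDiam K +
        B * D.cellDiam K :=
        norm_add₃_le.trans (add_le_add_three (D.norm_gradCell_interp_sub_le hd hΩb hθ hφ K)
          hstab hsmooth)
    _ = B * (θ * d + √(d : ℝ) * θ * (θ * d + 1) + 1) * D.cellDiam K := by ring
    _ ≤ B * (θ * d + √(d : ℝ) * θ * (θ * d + 1) + 1) * D.size := by
        gcongr
        exact D.cellDiam_le_size K

end Interpolation

section IntegrationByParts

lemma integrableOn_cell_of_continuous {E : Type*} [NormedAddCommGroup E]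
    (hΩb : Bornology.IsBounded Ω) (K : D.Cell) {g : Pt d → E} (hg : Continuous g) :
    IntegrableOn g (D.cell K) :=
  (hg.continuousOn.integrableOn_compact (D.isBounded_cell hΩb K).isCompact_closure).mono_set
    subset_closure

lemma integrableOn_cone_smul_grad (hΩb : Bornology.IsBounded Ω) (hφ : Continuous φ) (w : D.X)
    (hσ : σ ∈ D.edgesOf K) : IntegrableOn (fun x => φ x • D.grad w x) (D.cone K σ) :=
  IntegrableOn.congr_fun
    ((D.integrableOn_cone_of_continuous hΩb hσ hφ).smul_const (D.gradCone w K σ))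
    (fun x hx => by simp only [D.grad_of_mem_cone w hσ hx]) (D.measurableSet_cone hσ)

lemma setIntegral_cell_smul_grad (hd : 0 < d) (hΩb : Bornology.IsBounded Ω)
    (hφ : Continuous φ) (w : D.X) (K : D.Cell) :
    ∫ x in D.cell K, φ x • D.grad w x =
      ∑ σ ∈ D.edgesOf K, (∫ x in D.cone K σ, φ x) • D.gradCone w K σ := by
  rw [D.setIntegral_cell_eq_sum hd hΩb K fun σ hσ => D.integrableOn_cone_smul_grad hΩb hφ w hσ]
  refine Finset.sum_congr rfl fun σ hσ => ?_
  rw [← integral_smul_const]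
  exact setIntegral_congr_fun (D.measurableSet_cone hσ) fun x hx => by
    simp only [D.grad_of_mem_cone w hσ hx]

-- Both terms on the left are exact for a constant `φ`, so a constant may be subtracted from `φ`.
lemma setIntegral_cell_smul_grad_sub_eq (hd : 0 < d) (hΩb : Bornology.IsBounded Ω)
    (hφ : Continuous φ) (w : D.X) (K : D.Cell) (a : ℝ) :
    (∫ x in D.cell K, φ x • D.grad w x) -
      ∑ σ ∈ D.edgesOf K, (D.edgeVol σ * (w.2 σ - w.1 K) * φ (D.bary σ)) • D.normal K σ =
      ∑ σ ∈ D.edgesOf K, (∫ x in D.cone K σ, (φ x - a)) • D.gradCone w K σ -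
      ∑ σ ∈ D.edgesOf K, (D.edgeVol σ * (w.2 σ - w.1 K) * (φ (D.bary σ) - a)) •
        D.normal K σ := by
  have hcones : ∑ σ ∈ D.edgesOf K, (∫ x in D.cone K σ, (φ x - a)) • D.gradCone w K σ =
      (∫ x in D.cell K, φ x • D.grad w x) -
        a • ∑ σ ∈ D.edgesOf K, volume.real (D.cone K σ) • D.gradCone w K σ := by
    rw [D.setIntegral_cell_smul_grad hd hΩb hφ, Finset.smul_sum, ← Finset.sum_sub_distrib]
    refine Finset.sum_congr rfl fun σ hσ => ?_
    have hone : Integrable (fun _ : Pt d => a) (volume.restrict (D.cone K σ)) :=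
      integrableOn_const (D.volume_cone_lt_top hΩb hσ).ne
    rw [integral_sub (D.integrableOn_cone_of_continuous hΩb hσ hφ) hone, setIntegral_const,
      smul_eq_mul, smul_smul, mul_comm a, sub_smul]
  have hedges : ∑ σ ∈ D.edgesOf K,
      (D.edgeVol σ * (w.2 σ - w.1 K) * (φ (D.bary σ) - a)) • D.normal K σ =
      ∑ σ ∈ D.edgesOf K, (D.edgeVol σ * (w.2 σ - w.1 K) * φ (D.bary σ)) • D.normal K σ -
        a • ∑ σ ∈ D.edgesOf K, (D.edgeVol σ * (w.2 σ - w.1 K)) • D.normal K σ := by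
    simp_rw [Finset.smul_sum, ← Finset.sum_sub_distrib, smul_smul, ← sub_smul, mul_comm a,
      ← mul_sub]
  rw [hcones, hedges, D.sum_volume_smul_gradCone hd hΩb, D.cellVol_smul_gradCell hΩb]
  abel

lemma norm_setIntegral_cell_smul_grad_sub_le (hd : 0 < d) (hΩb : Bornology.IsBounded Ω)
    (hφ : IsSmoothBound φ B) (w : D.X) (K : D.Cell) :
    ‖(∫ x in D.cell K, φ x • D.grad w x) -
      ∑ σ ∈ D.edgesOf K, (D.edgeVol σ * (w.2 σ - w.1 K) * φ (D.bary σ)) • D.normal K σ‖ ≤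
      B * D.cellDiam K * (∑ σ ∈ D.edgesOf K, volume.real (D.cone K σ) * ‖D.gradCone w K σ‖ +
        ∑ σ ∈ D.edgesOf K, D.edgeVol σ * |w.2 σ - w.1 K|) := by
  have hB := hφ.nonneg
  rw [D.setIntegral_cell_smul_grad_sub_eq hd hΩb hφ.differentiable.continuous w K
    (φ (D.center K)), mul_add, Finset.mul_sum, Finset.mul_sum]
  refine norm_sub_le_of_le (norm_sum_le_of_le _ fun σ hσ => ?_)
    (norm_sum_le_of_le _ fun σ hσ => ?_)
  · rw [norm_smul, ← mul_assoc]
    gcongr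
    refine norm_setIntegral_le_of_norm_le_const (D.volume_cone_lt_top hΩb hσ) fun x hx => ?_
    refine (hφ.abs_sub_le _ _).trans ?_
    gcongr
    exact D.norm_sub_center_le_of_mem_cone hΩb hσ hx
  · have hm := D.edgeVol_pos hΩb hσ
    rw [norm_smul, D.norm_normal hσ, mul_one, norm_mul, norm_mul, Real.norm_of_nonneg hm.le,
      Real.norm_eq_abs, Real.norm_eq_abs, mul_comm]
    gcongr
    refine (hφ.abs_sub_le _ _).trans ?_
    gcongr
    exact D.norm_bary_sub_center_le hΩb hσ

lemma norm_cellVol_smul_gradCell_interp_sub_le (hd : 0 < d) (hΩb : Bornology.IsBounded Ω)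
    (hθ : D.theta ≤ θ) (hφ : IsSmoothBound φ B) (K : D.Cell) :
    ‖D.cellVol K • D.gradCell (D.interp φ) K - ∫ x in D.cell K, gradient φ x‖ ≤
      B * (θ * d + 1) * D.cellDiam K * D.cellVol K := by
  have hB := hφ.nonneg
  have hconst : Integrable (fun _ : Pt d => D.gradCell (D.interp φ) K)
      (volume.restrict (D.cell K)) := integrableOn_const (D.volume_cell_lt_top hΩb K).ne
  rw [show D.cellVol K • D.gradCell (D.interp φ) K =
      ∫ _ in D.cell K, D.gradCell (D.interp φ) K by rw [setIntegral_const, cellVol],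
    ← integral_sub hconst (D.integrableOn_cell_of_continuous hΩb K hφ.continuous_gradient)]
  refine norm_setIntegral_le_of_norm_le_const (D.volume_cell_lt_top hΩb K) fun x hx => ?_
  calc ‖D.gradCell (D.interp φ) K - gradient φ x‖
      ≤ B * θ * d * D.cellDiam K + B * ‖x - D.center K‖ :=
        norm_sub_le_norm_sub_add_norm_sub _ (gradient φ (D.center K)) _ |>.trans <|
          add_le_add (D.norm_gradCell_interp_sub_le hd hΩb hθ hφ K) <|
            (norm_sub_rev _ _).trans_le (hφ.norm_gradient_sub_le _ _)
    _ ≤ B * θ * d * D.cellDiam K + B * D.cellDiam K := by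
        gcongr
        exact D.norm_sub_center_le hΩb (subset_closure hx)
    _ = B * (θ * d + 1) * D.cellDiam K := by ring

lemma sum_edge_smul_normal_eq_zero {w : D.X} (hw : D.MemX0 w) (f : D.Edge → ℝ) :
    ∑ K, ∑ σ ∈ D.edgesOf K, (f σ * w.2 σ) • D.normal K σ = 0 := by
  rw [Finset.sum_comm' (s' := D.cellsOf) (t' := Finset.univ) (by simp [cellsOf])]
  refine Finset.sum_eq_zero fun σ _ => ?_
  rw [← Finset.smul_sum]
  rcases D.edge_cells σ with hext | hint
  · rw [hw σ hext.1, mul_zero, zero_smul]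
  · obtain ⟨K, L, hKL, hc⟩ := Finset.card_eq_two.1 hint
    have hmem : ∀ K' ∈ ({K, L} : Finset D.Cell), σ ∈ D.edgesOf K' := by
      simp [← hc]
    rw [cellsOf, hc, Finset.sum_pair hKL, D.normal_eq_neg hKL (hmem K (by simp))
      (hmem L (by simp)), add_neg_cancel, smul_zero]

lemma proj_of_mem_cell (w : D.X) {x : Pt d} (hx : x ∈ D.cell K) : D.proj w x = w.1 K := by
  rw [proj, Finset.sum_eq_single K, Set.indicator_of_mem hx]
  · exact fun L _ h => Set.indicator_of_notMem
      (fun hx' => Set.disjoint_left.1 (D.cell_disjoint h) hx' hx) _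
  · exact fun h => absurd (Finset.mem_univ _) h

lemma integrableOn_proj (hΩb : Bornology.IsBounded Ω) (w : D.X) :
    IntegrableOn (D.proj w) Ω :=
  integrable_finsetSum _ fun K _ =>
    (integrableOn_const hΩb.measure_lt_top.ne).indicator (D.cell_isOpen K).measurableSet

lemma setIntegral_abs_proj (hΩb : Bornology.IsBounded Ω) (w : D.X) :
    ∫ x in Ω, |D.proj w x| = ∑ K, |w.1 K| * D.cellVol K := by
  rw [D.setIntegral_eq_sum_cell
    fun K => ((D.integrableOn_proj hΩb w).mono_set (D.cell_subset K)).abs]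
  refine Finset.sum_congr rfl fun K _ => ?_
  rw [setIntegral_congr_fun (g := fun _ => |w.1 K|) (D.cell_isOpen K).measurableSet
    fun x hx => by simp only [D.proj_of_mem_cell w hx], setIntegral_const, smul_eq_mul, mul_comm,
    cellVol]

lemma setIntegral_proj_smul {E : Type*} [NormedAddCommGroup E] [NormedSpace ℝ E]
    (hΩb : Bornology.IsBounded Ω) (w : D.X) {g : Pt d → E} (hg : Continuous g) :
    ∫ x in Ω, D.proj w x • g x = ∑ K, w.1 K • ∫ x in D.cell K, g x := by
  have heq : ∀ K, Set.EqOn (fun x => w.1 K • g x) (fun x => D.proj w x • g x) (D.cell K) :=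
    fun K x hx => by simp only [D.proj_of_mem_cell w hx]
  rw [D.setIntegral_eq_sum_cell fun K => IntegrableOn.congr_fun
    ((D.integrableOn_cell_of_continuous hΩb K hg).smul (w.1 K)) (heq K)
    (D.cell_isOpen K).measurableSet]
  refine Finset.sum_congr rfl fun K _ => ?_
  rw [← setIntegral_congr_fun (D.cell_isOpen K).measurableSet (heq K), integral_smul]

lemma sum_volume_mul_norm_gradCone_le (hd : 0 < d) (hΩb : Bornology.IsBounded Ω)
    (hθ : D.theta ≤ θ) (w : D.X) :
    ∑ K, ∑ σ ∈ D.edgesOf K, volume.real (D.cone K σ) * ‖D.gradCone w K σ‖ ≤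
      volume.real Ω + (d + 2 + 2 * θ ^ 2 * d ^ 2) * D.seminormX w ^ 2 := by
  refine le_trans ?_ (add_le_add_right (D.sum_gradEnergy_le hd hΩb hθ w) _)
  rw [← D.sum_cellVol hΩb, ← Finset.sum_add_distrib]
  refine Finset.sum_le_sum fun K _ => ?_
  rw [← D.sum_volume_real_cone hd hΩb, gradEnergy, ← Finset.sum_add_distrib]
  refine Finset.sum_le_sum fun σ _ => ?_
  have hle : ‖D.gradCone w K σ‖ ≤ 1 + ‖D.gradCone w K σ‖ ^ 2 := by
    nlinarith [sq_nonneg (‖D.gradCone w K σ‖ - 1)]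
  calc volume.real (D.cone K σ) * ‖D.gradCone w K σ‖
      ≤ volume.real (D.cone K σ) * (1 + ‖D.gradCone w K σ‖ ^ 2) := by gcongr
    _ = _ := by ring

lemma sum_edgeVol_mul_abs_le (hd : 0 < d) (hΩb : Bornology.IsBounded Ω) (w : D.X) :
    ∑ K, ∑ σ ∈ D.edgesOf K, D.edgeVol σ * |w.2 σ - w.1 K| ≤
      d * volume.real Ω + D.seminormX w ^ 2 := by
  rw [← D.sum_cellVol hΩb, D.seminormX_sq, Finset.mul_sum, ← Finset.sum_add_distrib]
  refine Finset.sum_le_sum fun K _ => ?_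
  rw [← D.sum_edgeVol_mul_dist hd hΩb, cellEnergy, ← Finset.sum_add_distrib]
  refine Finset.sum_le_sum fun σ hσ => ?_
  have hδ := D.dist_pos hσ
  have hm := D.edgeVol_pos hΩb hσ
  have hle : |w.2 σ - w.1 K| ≤ D.dist K σ + (w.2 σ - w.1 K) ^ 2 / D.dist K σ := by
    rw [← sub_le_iff_le_add', le_div_iff₀ hδ, ← sq_abs (w.2 σ - w.1 K)]
    nlinarith [sq_nonneg (D.dist K σ - |w.2 σ - w.1 K|), sq_nonneg (D.dist K σ),
      sq_nonneg |w.2 σ - w.1 K|]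
  calc D.edgeVol σ * |w.2 σ - w.1 K|
      ≤ D.edgeVol σ * (D.dist K σ + (w.2 σ - w.1 K) ^ 2 / D.dist K σ) := by gcongr
    _ = _ := by ring

lemma sum_edgeVol_smul_eq_cellVol_smul_gradCell (hd : 0 < d) (hΩb : Bornology.IsBounded Ω)
    (u : D.X) (K : D.Cell) :
    ∑ σ ∈ D.edgesOf K, (D.edgeVol σ * u.2 σ) • D.normal K σ = D.cellVol K • D.gradCell u K := by
  have hzero : u.1 K • ∑ σ ∈ D.edgesOf K, D.edgeVol σ • D.normal K σ = 0 := by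
    rw [D.sum_edgeVol_smul_normal hd hΩb, smul_zero]
  rw [D.cellVol_smul_gradCell hΩb, ← sub_zero (∑ σ ∈ D.edgesOf K, _), ← hzero]
  simp_rw [Finset.smul_sum, ← Finset.sum_sub_distrib, smul_smul, ← sub_smul, mul_sub,
    mul_comm (u.1 K)]

lemma setIntegral_smul_grad_add_eq (hd : 0 < d) (hΩb : Bornology.IsBounded Ω)
    (hφ : Continuous φ) {g : Pt d → Pt d} (hg : Continuous g) {w : D.X} (hw : D.MemX0 w) :
    (∫ x in Ω, φ x • D.grad w x) + ∫ x in Ω, D.proj w x • g x =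
      ∑ K, (((∫ x in D.cell K, φ x • D.grad w x) - ∑ σ ∈ D.edgesOf K,
        (D.edgeVol σ * (w.2 σ - w.1 K) * φ (D.bary σ)) • D.normal K σ) -
        w.1 K • (D.cellVol K • D.gradCell (D.interp φ) K - ∫ x in D.cell K, g x)) := by
  have hint : ∀ K, IntegrableOn (fun x => φ x • D.grad w x) (D.cell K) := fun K =>
    D.integrableOn_cell_of_cone hd hΩb fun σ hσ => D.integrableOn_cone_smul_grad hΩb hφ w hσ
  have hedges : ∀ K, ∑ σ ∈ D.edgesOf K, (D.edgeVol σ * φ (D.bary σ) * w.2 σ) • D.normal K σ =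
      ∑ σ ∈ D.edgesOf K, (D.edgeVol σ * (w.2 σ - w.1 K) * φ (D.bary σ)) • D.normal K σ +
        w.1 K • D.cellVol K • D.gradCell (D.interp φ) K := by
    intro K
    rw [← D.sum_edgeVol_smul_eq_cellVol_smul_gradCell hd hΩb, Finset.smul_sum,
      ← Finset.sum_add_distrib]
    refine Finset.sum_congr rfl fun σ _ => ?_
    rw [smul_smul, ← add_smul, interp]
    congr 1; ring
  have hzero := D.sum_edge_smul_normal_eq_zero hw fun σ => D.edgeVol σ * φ (D.bary σ)
  rw [D.setIntegral_eq_sum_cell hint, D.setIntegral_proj_smul hΩb w hg, ← sub_zero (_ + _),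
    ← hzero, ← Finset.sum_add_distrib, ← Finset.sum_sub_distrib]
  refine Finset.sum_congr rfl fun K _ => ?_
  rw [hedges, smul_sub]
  abel

lemma norm_setIntegral_smul_grad_add_le (hd : 0 < d) (hΩb : Bornology.IsBounded Ω)
    (hθ : D.theta ≤ θ) (hφ : IsSmoothBound φ B) {w : D.X} (hw : D.MemX0 w) :
    ‖(∫ x in Ω, φ x • D.grad w x) + ∫ x in Ω, D.proj w x • gradient φ x‖ ≤
      B * D.size * ((1 + d) * volume.real Ω + (d + 3 + 2 * θ ^ 2 * d ^ 2) * D.seminormX w ^ 2 +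
        (θ * d + 1) * ∫ x in Ω, |D.proj w x|) := by
  have hB := hφ.nonneg
  have hθ₀ := D.theta_nonneg.trans hθ
  have hBs : 0 ≤ B * D.size := mul_nonneg hB D.size_nonneg
  set jumps : D.Cell → ℝ := fun K =>
    ∑ σ ∈ D.edgesOf K, volume.real (D.cone K σ) * ‖D.gradCone w K σ‖ +
      ∑ σ ∈ D.edgesOf K, D.edgeVol σ * |w.2 σ - w.1 K|
  have hjumps : ∀ K, 0 ≤ jumps K := fun K => add_nonneg
    (Finset.sum_nonneg fun σ _ => by positivity)
    (Finset.sum_nonneg fun σ _ => mul_nonneg measureReal_nonneg (abs_nonneg _))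
  have hcell : ∀ K, ‖((∫ x in D.cell K, φ x • D.grad w x) - ∑ σ ∈ D.edgesOf K,
        (D.edgeVol σ * (w.2 σ - w.1 K) * φ (D.bary σ)) • D.normal K σ) -
        w.1 K • (D.cellVol K • D.gradCell (D.interp φ) K - ∫ x in D.cell K, gradient φ x)‖ ≤
      B * D.size * jumps K + B * D.size * ((θ * d + 1) * (|w.1 K| * D.cellVol K)) := by
    intro K
    have hV := (D.cellVol_pos hΩb K).le
    have hsize := D.cellDiam_le_size K
    refine norm_sub_le_of_le
      ((D.norm_setIntegral_cell_smul_grad_sub_le hd hΩb hφ w K).trans ?_) ?_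
    · have := hjumps K
      gcongr
    · rw [norm_smul, Real.norm_eq_abs]
      calc |w.1 K| * ‖D.cellVol K • D.gradCell (D.interp φ) K - ∫ x in D.cell K, gradient φ x‖
          ≤ |w.1 K| * (B * (θ * d + 1) * D.size * D.cellVol K) := by
            gcongr
            refine (D.norm_cellVol_smul_gradCell_interp_sub_le hd hΩb hθ hφ K).trans ?_
            gcongr
        _ = B * D.size * ((θ * d + 1) * (|w.1 K| * D.cellVol K)) := by ring
  rw [D.setIntegral_smul_grad_add_eq hd hΩb hφ.differentiable.continuous hφ.continuous_gradient hw]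
  refine (norm_sum_le_of_le _ fun K _ => hcell K).trans ?_
  rw [Finset.sum_add_distrib, ← Finset.mul_sum, ← Finset.mul_sum, ← Finset.mul_sum,
    ← D.setIntegral_abs_proj hΩb, ← mul_add, Finset.sum_add_distrib]
  refine mul_le_mul_of_nonneg_left ?_ hBs
  linarith [D.sum_volume_mul_norm_gradCone_le hd hΩb hθ w, D.sum_edgeVol_mul_abs_le hd hΩb w]

end IntegrationByParts

end Discretisation

section WeakLimits

variable {𝕜 ι : Type*} [RCLike 𝕜]

lemma exists_tendsto_inner_of_norm_le {H : Type*} [NormedAddCommGroup H] [InnerProductSpace 𝕜 H]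
    [CompleteSpace H] (U : Ultrafilter ι) {g : ι → H} {C : ℝ} (hg : ∀ i, ‖g i‖ ≤ C) :
    ∃ G : H, ∀ F : H, Tendsto (fun i => inner 𝕜 F (g i)) U (𝓝 (inner 𝕜 F G)) := by
  let dual : ι → WeakDual 𝕜 H := fun i =>
    StrongDual.toWeakDual (InnerProductSpace.toDual 𝕜 H (g i))
  obtain ⟨L, -, hL⟩ := (WeakDual.isCompact_closedBall (𝕜 := 𝕜)
    (0 : StrongDual 𝕜 H) C).ultrafilter_le_nhds (U.map dual) (by
      rw [Ultrafilter.coe_map, le_principal_iff, mem_map]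
      refine univ_mem' fun i => mem_closedBall_zero_iff.2 ?_
      exact ((InnerProductSpace.toDual 𝕜 H).norm_map (g i)).trans_le (hg i))
  refine ⟨(InnerProductSpace.toDual 𝕜 H).symm (WeakDual.toStrongDual L), fun F => ?_⟩
  have hLF : Tendsto (fun i => inner 𝕜 (g i) F) U (𝓝 (L F)) :=
    ((WeakDual.eval_continuous F).tendsto L).comp hL
  have hconj := (RCLike.continuous_conj.tendsto (L F)).comp hLF
  rw [← inner_conj_symm, InnerProductSpace.toDual_symm_apply]
  exact hconj.congr fun i => inner_conj_symm _ _

variable {α E : Type*} [MeasurableSpace α] {μ : Measure α} [NormedAddCommGroup E]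

lemma tendsto_integral_norm_of_eLpNorm [IsFiniteMeasure μ] {p : ENNReal} (hp : 1 ≤ p)
    {l : Filter ι} {f : ι → α → E} (hf : ∀ i, AEStronglyMeasurable (f i) μ)
    (h : Tendsto (fun i => eLpNorm (f i) p μ) l (𝓝 0)) :
    Tendsto (fun i => ∫ x, ‖f i x‖ ∂μ) l (𝓝 0) := by
  set c := μ Set.univ ^ (1 / (1 : ENNReal).toReal - 1 / p.toReal)
  have hc : c ≠ ⊤ := by
    refine ENNReal.rpow_ne_top_of_nonneg ?_ (measure_ne_top μ _)
    rcases eq_or_ne p ⊤ with rfl | hp'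
    · simp
    · have : 1 ≤ p.toReal := by simpa using ENNReal.toReal_mono hp' hp
      simpa using inv_le_one_of_one_le₀ this
  have hbound : Tendsto (fun i => eLpNorm (f i) p μ * c) l (𝓝 0) := by
    simpa only [zero_mul] using ENNReal.Tendsto.mul_const h (Or.inr hc)
  have hL1 : Tendsto (fun i => eLpNorm (f i) 1 μ) l (𝓝 0) :=
    tendsto_of_tendsto_of_tendsto_of_le_of_le tendsto_const_nhds hbound (fun _ => zero_le)
      fun i => eLpNorm_le_eLpNorm_mul_rpow_measure_univ hp (hf i)
  refine ((ENNReal.tendsto_toReal ENNReal.zero_ne_top).comp hL1).congr fun i => ?_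
  rw [Function.comp, eLpNorm_one_eq_lintegral_enorm, ← integral_norm_eq_lintegral_enorm (hf i)]

variable [InnerProductSpace 𝕜 E]

lemma inner_toLp {F g : α → E} (hF : MemLp F 2 μ) (hg : MemLp g 2 μ) :
    inner 𝕜 (hF.toLp F) (hg.toLp g) = ∫ x, inner 𝕜 (F x) (g x) ∂μ := by
  rw [L2.inner_def]
  refine integral_congr_ae ?_
  filter_upwards [hF.coeFn_toLp, hg.coeFn_toLp] with x hxF hxg
  rw [hxF, hxg]

lemma integrable_inner_of_memLp {F g : α → E} (hF : MemLp F 2 μ) (hg : MemLp g 2 μ) :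
    Integrable (fun x => inner 𝕜 (F x) (g x)) μ := by
  refine (L2.integrable_inner (𝕜 := 𝕜) (hF.toLp F) (hg.toLp g)).congr ?_
  filter_upwards [hF.coeFn_toLp, hg.coeFn_toLp] with x hxF hxg
  rw [hxF, hxg]

lemma norm_toLp_two_sq (𝕜 : Type*) [RCLike 𝕜] [InnerProductSpace 𝕜 E] {g : α → E}
    (hg : MemLp g 2 μ) : ‖hg.toLp g‖ ^ 2 = ∫ x, ‖g x‖ ^ 2 ∂μ := by
  rw [← RCLike.ofReal_inj (K := 𝕜), RCLike.ofReal_pow, ← inner_self_eq_norm_sq_to_K (𝕜 := 𝕜),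
    inner_toLp, ← integral_ofReal]
  simp only [inner_self_eq_norm_sq_to_K, RCLike.ofReal_pow]

lemma exists_tendsto_integral_inner_of_integral_norm_sq_le [CompleteSpace E] (U : Ultrafilter ι)
    {g : ι → α → E} (hg : ∀ i, MemLp (g i) 2 μ) {C : ℝ} (hC : ∀ i, ∫ x, ‖g i x‖ ^ 2 ∂μ ≤ C) :
    ∃ G : α → E, MemLp G 2 μ ∧ ∀ F : α → E, MemLp F 2 μ →
      Tendsto (fun i => ∫ x, inner 𝕜 (F x) (g i x) ∂μ) U (𝓝 (∫ x, inner 𝕜 (F x) (G x) ∂μ)) := by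
  obtain ⟨G, hG⟩ := exists_tendsto_inner_of_norm_le (𝕜 := 𝕜) U (g := fun i => (hg i).toLp (g i))
    fun i => Real.le_sqrt_of_sq_le ((norm_toLp_two_sq 𝕜 (hg i)).trans_le (hC i))
  refine ⟨G, Lp.memLp G, fun F hF => ?_⟩
  rw [← inner_toLp hF (Lp.memLp G), Lp.toLp_coeFn]
  exact (hG (hF.toLp F)).congr fun i => inner_toLp hF (hg i)

end WeakLimits

section WeakGradients

variable {d : ℕ} {Ω : Set (Pt d)} {u : Pt d → ℝ} {G G' : Pt d → Pt d}

lemma hasWeakGradient_univ_indicator_iff (hΩ : MeasurableSet Ω) :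
    HasWeakGradient Set.univ (Ω.indicator u) G ↔ MemLp u 2 (volume.restrict Ω) ∧ MemLp G 2 ∧
      ∀ φ : Pt d → ℝ, ContDiff ℝ ∞ φ → HasCompactSupport φ →
        ∫ x in Ω, u x • gradient φ x = -∫ x, φ x • G x := by
  simp only [HasWeakGradient, IsTest, Measure.restrict_univ, memLp_indicator_iff_restrict hΩ,
    Set.subset_univ, and_true, and_imp, ← Set.indicator_smul_left,
    integral_indicator hΩ, Measure.restrict_univ]

lemma HasWeakGradient.of_univ_indicator (hΩ : MeasurableSet Ω)
    (hG : HasWeakGradient Set.univ (Ω.indicator u) G) : HasWeakGradient Ω u G := by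
  obtain ⟨hu, hGp, hGu⟩ := (hasWeakGradient_univ_indicator_iff hΩ).1 hG
  refine ⟨hu, hGp.restrict Ω, fun φ hφ => ?_⟩
  rw [hGu φ hφ.1 hφ.2.1, setIntegral_eq_integral_of_forall_compl_eq_zero]
  exact fun x hx => by rw [image_eq_zero_of_notMem_tsupport fun h => hx (hφ.2.2 h), zero_smul]

lemma HasWeakGradient.ae_eq (hΩo : IsOpen Ω) (hG : HasWeakGradient Ω u G)
    (hG' : HasWeakGradient Ω u G') : G =ᵐ[volume.restrict Ω] G' := by
  have hloc {f : Pt d → Pt d} (hf : MemLp f 2 (volume.restrict Ω)) : LocallyIntegrableOn f Ω :=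
    locallyIntegrableOn_of_locallyIntegrable_restrict (hf.locallyIntegrable one_le_two)
  have hzero := hΩo.ae_eq_zero_of_integral_contDiff_smul_eq_zero
    ((hloc hG.2.1).sub (hloc hG'.2.1)) fun φ hφ hφc hφs => ?_
  · rw [EventuallyEq, ae_restrict_iff' hΩo.measurableSet]
    filter_upwards [hzero] with x hx hxΩ using sub_eq_zero.1 (hx hxΩ)
  have hint : ∀ {f : Pt d → Pt d}, MemLp f 2 (volume.restrict Ω) →
      IntegrableOn (fun x => φ x • f x) Ω := fun hf =>
    memLp_one_iff_integrable.1 (hf.smul (hφ.continuous.memLp_of_hasCompactSupport (p := 2) hφc))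
  rw [← setIntegral_eq_integral_of_forall_compl_eq_zero (s := Ω) fun x hx => by
    rw [image_eq_zero_of_notMem_tsupport fun h => hx (hφs h), zero_smul]]
  simp only [Pi.sub_apply, smul_sub]
  rw [integral_sub (hint hG.2.1) (hint hG'.2.1), sub_eq_zero, ← neg_inj,
    ← hG.2.2 φ ⟨hφ, hφc, hφs⟩, ← hG'.2.2 φ ⟨hφ, hφc, hφs⟩]

end WeakGradients

namespace IsSmoothBound

variable {E : Type*} [NormedAddCommGroup E] [InnerProductSpace ℝ E] [CompleteSpace E]
  [MeasurableSpace E] [BorelSpace E] [SecondCountableTopology E] {φ : E → ℝ} {B : ℝ}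
  {μ : Measure E} {f g : E → ℝ}

lemma integrable_smul_gradient (hφ : IsSmoothBound φ B) (hf : Integrable f μ) :
    Integrable (fun x => f x • gradient φ x) μ :=
  hf.smul_bdd B hφ.continuous_gradient.aestronglyMeasurable
    (Eventually.of_forall hφ.norm_gradient_le)

lemma memLp_gradient [IsFiniteMeasure μ] (hφ : IsSmoothBound φ B) (p : ENNReal) :
    MemLp (gradient φ) p μ :=
  MemLp.of_bound hφ.continuous_gradient.aestronglyMeasurable B
    (Eventually.of_forall hφ.norm_gradient_le)

lemma norm_integral_smul_gradient_sub_le (hφ : IsSmoothBound φ B) (hf : Integrable f μ)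
    (hg : Integrable g μ) :
    ‖(∫ x, f x • gradient φ x ∂μ) - ∫ x, g x • gradient φ x ∂μ‖ ≤ B * ∫ x, ‖f x - g x‖ ∂μ := by
  rw [← integral_sub (hφ.integrable_smul_gradient hf) (hφ.integrable_smul_gradient hg),
    ← integral_const_mul]
  refine norm_integral_le_of_norm_le ((hf.sub hg).norm.const_mul B)
    (Eventually.of_forall fun x => ?_)
  rw [← sub_smul, norm_smul, mul_comm]
  gcongr
  exact hφ.norm_gradient_le x

end IsSmoothBound

lemma IsDiffusionField.memLp_apply {d : ℕ} {Ω : Set (Pt d)} {lo hi : ℝ}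
    {Λ : Pt d → Matrix (Fin d) (Fin d) ℝ} (hΛ : IsDiffusionField Ω lo hi Λ)
    (hΩ : MeasurableSet Ω) {g : Pt d → Pt d} {p : ENNReal} (hg : MemLp g p (volume.restrict Ω)) :
    MemLp (fun x => Matrix.toEuclideanLin (Λ x) (g x)) p (volume.restrict Ω) := by
  refine hg.of_le_mul (hΛ.aestronglyMeasurable_apply hΩ hg.aestronglyMeasurable)
    (c := max |lo| |hi|) ?_
  filter_upwards [hΛ.ae_norm_le] with x hx using hx _

namespace Discretisation

variable {d : ℕ} {Ω : Set (Pt d)} (D : Discretisation d Ω) {lo hi : ℝ}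
  {Λ : Pt d → Matrix (Fin d) (Fin d) ℝ} {φ : Pt d → ℝ} {B θ : ℝ}

lemma memLp_grad (hΩb : Bornology.IsBounded Ω) (u : D.X) (p : ENNReal) : MemLp (D.grad u) p :=
  memLp_finsetSum _ fun _ _ => memLp_finsetSum _ fun _ hσ =>
    memLp_indicator_const p (D.measurableSet_cone hσ) _ (Or.inr (D.volume_cone_lt_top hΩb hσ).ne)

lemma integral_norm_grad_sq_le (hd : 0 < d) (hΩb : Bornology.IsBounded Ω)
    (hθ : D.theta ≤ θ) (u : D.X) :
    ∫ x, ‖D.grad u x‖ ^ 2 ≤ (d + 2 + 2 * θ ^ 2 * d ^ 2) * D.seminormX u ^ 2 := by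
  refine le_trans (le_of_eq ?_) (D.sum_gradEnergy_le hd hΩb hθ u)
  rw [← setIntegral_eq_integral_of_forall_compl_eq_zero (s := Ω)
    fun x hx => by rw [D.grad_of_notMem u hx, norm_zero, zero_pow two_ne_zero]]
  have heq : ∀ K, ∀ σ ∈ D.edgesOf K, Set.EqOn (fun _ => ‖D.gradCone u K σ‖ ^ 2)
      (fun x => ‖D.grad u x‖ ^ 2) (D.cone K σ) :=
    fun K σ hσ x hx => by simp only [D.grad_of_mem_cone u hσ hx]
  rw [D.setIntegral_eq_sum_cone hd hΩb fun K σ hσ => IntegrableOn.congr_fun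
    (integrableOn_const (D.volume_cone_lt_top hΩb hσ).ne) (heq K σ hσ) (D.measurableSet_cone hσ)]
  refine Finset.sum_congr rfl fun K _ => Finset.sum_congr rfl fun σ hσ => ?_
  rw [← setIntegral_congr_fun (D.measurableSet_cone hσ) (heq K σ hσ), setIntegral_const,
    smul_eq_mul]

lemma ae_restrict_of_forall_cone (hd : 0 < d) (hΩb : Bornology.IsBounded Ω) {p : Pt d → Prop}
    (hp : ∀ K, ∀ σ ∈ D.edgesOf K, ∀ x ∈ D.cone K σ, p x) : ∀ᵐ x ∂(volume.restrict Ω), p x := by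
  rw [← Measure.restrict_congr_set D.iUnion_cell_ae_eq, ae_restrict_iUnion_iff]
  intro K
  rw [← Measure.restrict_congr_set (D.cell_ae_eq_cones hd hΩb K),
    ae_restrict_biUnion_finset_iff]
  exact fun σ hσ => ae_restrict_of_forall_mem (D.measurableSet_cone hσ) (hp K σ hσ)

lemma ae_norm_grad_interp_sub_le (hd : 0 < d) (hΩb : Bornology.IsBounded Ω) (hθ : D.theta ≤ θ)
    (hφ : IsSmoothBound φ B) : ∀ᵐ x ∂(volume.restrict Ω),
      ‖D.grad (D.interp φ) x - gradient φ x‖ ≤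
        B * (θ * d + √(d : ℝ) * θ * (θ * d + 1) + 1) * D.size := by
  refine D.ae_restrict_of_forall_cone hd hΩb fun K σ hσ x hx => ?_
  rw [D.grad_of_mem_cone _ hσ hx]
  exact D.norm_gradCone_interp_sub_le hd hΩb hθ hφ hσ hx

lemma norm_setIntegral_inner_grad_le (hd : 0 < d) (hΛ : IsDiffusionField Ω lo hi Λ)
    (hΩb : Bornology.IsBounded Ω) (hθ : D.theta ≤ θ) (w : D.X) {g : Pt d → Pt d} {ε : ℝ}
    (hε : 0 ≤ ε) (hg : ∀ᵐ x ∂(volume.restrict Ω), ‖g x‖ ≤ ε) :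
    ‖∫ x in Ω, inner ℝ (D.grad w x) (Matrix.toEuclideanLin (Λ x) (g x))‖ ≤
      max |lo| |hi| * ε *
        (volume.real Ω + (d + 2 + 2 * θ ^ 2 * d ^ 2) * D.seminormX w ^ 2) := by
  have hsq : Integrable fun x => ‖D.grad w x‖ ^ 2 :=
    (memLp_two_iff_integrable_sq_norm (D.memLp_grad hΩb w 2).1).1 (D.memLp_grad hΩb w 2)
  have hone : IntegrableOn (fun _ => (1 : ℝ)) Ω := integrableOn_const hΩb.measure_lt_top.ne
  calc ‖∫ x in Ω, inner ℝ (D.grad w x) (Matrix.toEuclideanLin (Λ x) (g x))‖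
      ≤ ∫ x in Ω, max |lo| |hi| * ε * (1 + ‖D.grad w x‖ ^ 2) := by
        refine norm_integral_le_of_norm_le ((hone.add hsq.integrableOn).const_mul _) ?_
        filter_upwards [hΛ.ae_norm_le, hg] with x hΛx hgx
        have hle : ‖D.grad w x‖ ≤ 1 + ‖D.grad w x‖ ^ 2 := by
          nlinarith [sq_nonneg (‖D.grad w x‖ - 1)]
        calc _ ≤ ‖D.grad w x‖ * (max |lo| |hi| * ‖g x‖) :=
              (norm_inner_le_norm _ _).trans (by gcongr; exact hΛx _)
          _ ≤ (1 + ‖D.grad w x‖ ^ 2) * (max |lo| |hi| * ε) := by gcongr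
          _ = _ := mul_comm _ _
    _ = max |lo| |hi| * ε * (volume.real Ω + ∫ x in Ω, ‖D.grad w x‖ ^ 2) := by
        rw [integral_const_mul, integral_add hone hsq.integrableOn, setIntegral_const, smul_eq_mul,
          mul_one]
    _ ≤ _ := by
        gcongr
        exact (setIntegral_le_integral hsq (Eventually.of_forall fun x => sq_nonneg _)).trans
          (D.integral_norm_grad_sq_le hd hΩb hθ w)

lemma abs_form_interp_sub_le (hd : 0 < d) (hΛ : IsDiffusionField Ω lo hi Λ)
    (hΩ : MeasurableSet Ω) (hΩb : Bornology.IsBounded Ω) (hθ : D.theta ≤ θ)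
    (hφ : IsSmoothBound φ B) (w : D.X) :
    |D.form (D.sushiFlux Λ) w (D.interp φ) -
      ∫ x in Ω, inner ℝ (D.grad w x) (Matrix.toEuclideanLin (Λ x) (gradient φ x))| ≤
      max |lo| |hi| * (B * (θ * d + √(d : ℝ) * θ * (θ * d + 1) + 1) * D.size) *
        (volume.real Ω + (d + 2 + 2 * θ ^ 2 * d ^ 2) * D.seminormX w ^ 2) := by
  have hB := hφ.nonneg
  have hθ₀ := D.theta_nonneg.trans hθ
  have : IsFiniteMeasure (volume.restrict Ω) :=
    isFiniteMeasure_restrict.2 hΩb.measure_lt_top.ne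
  have hw : MemLp (D.grad w) 2 (volume.restrict Ω) := (D.memLp_grad hΩb w 2).restrict Ω
  have hinterp : MemLp (D.grad (D.interp φ)) 2 (volume.restrict Ω) :=
    (D.memLp_grad hΩb _ 2).restrict Ω
  rw [D.form_sushiFlux_eq_integral hd hΛ hΩ hΩb, ← integral_sub
    (integrable_inner_of_memLp hw (hΛ.memLp_apply hΩ hinterp))
    (integrable_inner_of_memLp hw (hΛ.memLp_apply hΩ (hφ.memLp_gradient 2)))]
  simp only [← inner_sub_right, ← map_sub]
  exact D.norm_setIntegral_inner_grad_le hd hΛ hΩb hθ w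
    (mul_nonneg (by positivity) D.size_nonneg) (D.ae_norm_grad_interp_sub_le hd hΩb hθ hφ)

end Discretisation

lemma integral_inner_smul_const {α E : Type*} [MeasurableSpace α] {μ : Measure α}
    [NormedAddCommGroup E] [InnerProductSpace ℝ E] [CompleteSpace E] {φ : α → ℝ} {g : α → E}
    (h : Integrable (fun x => φ x • g x) μ) (e : E) :
    ∫ x, inner ℝ (φ x • e) (g x) ∂μ = inner ℝ e (∫ x, φ x • g x ∂μ) := by
  rw [← integral_inner h]
  simp only [real_inner_smul_left, real_inner_smul_right]

lemma Discretisation.norm_setIntegral_smul_grad_add_le_of_integrableOn {d : ℕ} {Ω : Set (Pt d)}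
    (D : Discretisation d Ω) (hd : 0 < d) (hΩb : Bornology.IsBounded Ω) {θ : ℝ}
    (hθ : D.theta ≤ θ) {φ u : Pt d → ℝ} {B : ℝ} (hφ : IsSmoothBound φ B) {w : D.X}
    (hw : D.MemX0 w) (hu : IntegrableOn u Ω) :
    ‖(∫ x in Ω, φ x • D.grad w x) + ∫ x in Ω, u x • gradient φ x‖ ≤
      B * D.size * ((1 + d) * volume.real Ω + (d + 3 + 2 * θ ^ 2 * d ^ 2) * D.seminormX w ^ 2 +
        (θ * d + 1) * ((∫ x in Ω, ‖D.proj w x - u x‖) + ∫ x in Ω, ‖u x‖)) +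
      B * ∫ x in Ω, ‖D.proj w x - u x‖ := by
  have hproj := D.integrableOn_proj hΩb w
  have hproj_le : ∫ x in Ω, |D.proj w x| ≤
      (∫ x in Ω, ‖D.proj w x - u x‖) + ∫ x in Ω, ‖u x‖ := by
    refine (integral_mono hproj.abs ((hproj.sub hu).norm.add hu.norm) fun x => ?_).trans_eq
      (integral_add (hproj.sub hu).norm hu.norm)
    exact norm_le_norm_sub_add (D.proj w x) (u x)
  have hB := hφ.nonneg
  have hθ₀ := D.theta_nonneg.trans hθ
  have hsize := D.size_nonneg
  calc ‖(∫ x in Ω, φ x • D.grad w x) + ∫ x in Ω, u x • gradient φ x‖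
      ≤ ‖(∫ x in Ω, φ x • D.grad w x) + ∫ x in Ω, D.proj w x • gradient φ x‖ +
        ‖(∫ x in Ω, D.proj w x • gradient φ x) - ∫ x in Ω, u x • gradient φ x‖ := by
        refine (le_of_eq ?_).trans (norm_sub_le _ _)
        congr 1
        abel
    _ ≤ _ := add_le_add ((D.norm_setIntegral_smul_grad_add_le hd hΩb hθ hφ hw).trans (by gcongr))
        (hφ.norm_integral_smul_gradient_sub_le hproj hu)

section Consistency

variable {d : ℕ} {Ω : Set (Pt d)} {ι : Type*} {D : ι → Discretisation d Ω} {θ C : ℝ}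
  {w : ∀ i, (D i).X} {u : Pt d → ℝ}

lemma tendsto_setIntegral_smul_grad (hd : 0 < d) (hΩb : Bornology.IsBounded Ω)
    (hD : ∀ i, (D i).theta ≤ θ) (hw : ∀ i, (D i).MemX0 (w i))
    (hC : ∀ i, (D i).seminormX (w i) ≤ C) (hu : MemLp u 2 (volume.restrict Ω))
    (hlim : Tendsto (fun i => eLpNorm (fun x => (D i).proj (w i) x - u x) 2 (volume.restrict Ω))
      (sizeToZero D) (𝓝 0)) {φ : Pt d → ℝ} {B : ℝ} (hφ : IsSmoothBound φ B) :
    Tendsto (fun i => ∫ x in Ω, φ x • (D i).grad (w i) x) (sizeToZero D)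
      (𝓝 (-∫ x in Ω, u x • gradient φ x)) := by
  have : IsFiniteMeasure (volume.restrict Ω) :=
    isFiniteMeasure_restrict.2 hΩb.measure_lt_top.ne
  have hui : IntegrableOn u Ω := hu.integrable one_le_two
  set defect : ι → ℝ := fun i => ∫ x in Ω, ‖(D i).proj (w i) x - u x‖
  have hdefect : Tendsto defect (sizeToZero D) (𝓝 0) :=
    tendsto_integral_norm_of_eLpNorm one_le_two
      (fun i => (((D i).integrableOn_proj hΩb (w i)).sub hui).aestronglyMeasurable) hlim
  have hsize : Tendsto (fun i => (D i).size) (sizeToZero D) (𝓝 0) := tendsto_comap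
  have hbound : Tendsto (fun i => B * (D i).size * ((1 + d) * volume.real Ω +
      (d + 3 + 2 * θ ^ 2 * d ^ 2) * C ^ 2 + (θ * d + 1) * (defect i + ∫ x in Ω, ‖u x‖)) +
      B * defect i) (sizeToZero D) (𝓝 0) := by
    simpa using ((hsize.const_mul B).mul (((hdefect.add_const _).const_mul _).const_add _)).add
      (hdefect.const_mul B)
  refine tendsto_iff_norm_sub_tendsto_zero.2 (squeeze_zero_norm (fun i => ?_) hbound)
  have hB := hφ.nonneg
  have hsize₀ := (D i).size_nonneg
  have hw₀ : 0 ≤ (D i).seminormX (w i) := (D i).seminormX_nonneg _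
  rw [norm_norm, sub_neg_eq_add]
  refine ((D i).norm_setIntegral_smul_grad_add_le_of_integrableOn hd hΩb (hD i) hφ (hw i)
    hui).trans ?_
  gcongr
  exact hC i

lemma exists_hasWeakGradient_tendsto_integral_inner_grad (hd : 0 < d) (hΩ : MeasurableSet Ω)
    (hΩb : Bornology.IsBounded Ω) (hD : ∀ i, (D i).theta ≤ θ)
    (hw : ∀ i, (D i).MemX0 (w i)) (hC : ∀ i, (D i).seminormX (w i) ≤ C)
    (hu : MemLp u 2 (volume.restrict Ω))
    (hlim : Tendsto (fun i => eLpNorm (fun x => (D i).proj (w i) x - u x) 2 (volume.restrict Ω))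
      (sizeToZero D) (𝓝 0)) (U : Ultrafilter ι) (hU : ↑U ≤ sizeToZero D) :
    ∃ G : Pt d → Pt d, HasWeakGradient Set.univ (Ω.indicator u) G ∧
      ∀ F : Pt d → Pt d, MemLp F 2 →
        Tendsto (fun i => ∫ x, inner ℝ (F x) ((D i).grad (w i) x)) U
          (𝓝 (∫ x, inner ℝ (F x) (G x))) := by
  obtain ⟨G, hG, hconv⟩ := exists_tendsto_integral_inner_of_integral_norm_sq_le (𝕜 := ℝ) U
    (fun i => (D i).memLp_grad hΩb (w i) 2) (C := (d + 2 + 2 * θ ^ 2 * d ^ 2) * C ^ 2) fun i => by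
      have : 0 ≤ (D i).seminormX (w i) := (D i).seminormX_nonneg _
      refine ((D i).integral_norm_grad_sq_le hd hΩb (hD i) (w i)).trans ?_
      gcongr
      exact hC i
  refine ⟨G, (hasWeakGradient_univ_indicator_iff hΩ).2 ⟨hu, hG, fun φ hφ hφc => ?_⟩, hconv⟩
  obtain ⟨B, hB⟩ := exists_isSmoothBound (contDiff_infty.1 hφ 2) hφc
  have hφp : MemLp φ 2 := hφ.continuous.memLp_of_hasCompactSupport hφc
  have hint {g : Pt d → Pt d} (hg : MemLp g 2) : Integrable fun x => φ x • g x :=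
    memLp_one_iff_integrable.1 (hg.smul hφp)
  refine neg_eq_iff_eq_neg.1 (ext_inner_left ℝ fun e => ?_)
  have hweak := hconv (fun x => φ x • e)
    ((hφ.continuous.smul continuous_const).memLp_of_hasCompactSupport hφc.smul_right)
  rw [integral_inner_smul_const (hint hG)] at hweak
  refine tendsto_nhds_unique (((tendsto_const_nhds (x := e)).inner
    ((tendsto_setIntegral_smul_grad hd hΩb hD hw hC hu hlim hB).mono_left hU)).congr
      fun i => ?_) hweak
  rw [integral_inner_smul_const (hint ((D i).memLp_grad hΩb (w i) 2)),
    setIntegral_eq_integral_of_forall_compl_eq_zero]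
  exact fun x hx => by rw [(D i).grad_of_notMem _ hx, smul_zero]

variable {lo hi : ℝ} {Λ : Pt d → Matrix (Fin d) (Fin d) ℝ}

lemma tendsto_form_interp_sub (hd : 0 < d) (hΛ : IsDiffusionField Ω lo hi Λ)
    (hΩ : MeasurableSet Ω) (hΩb : Bornology.IsBounded Ω) (hD : ∀ i, (D i).theta ≤ θ)
    (hC : ∀ i, (D i).seminormX (w i) ≤ C) {φ : Pt d → ℝ} {B : ℝ} (hφ : IsSmoothBound φ B) :
    Tendsto (fun i => (D i).form ((D i).sushiFlux Λ) (w i) ((D i).interp φ) -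
      ∫ x in Ω, inner ℝ ((D i).grad (w i) x) (Matrix.toEuclideanLin (Λ x) (gradient φ x)))
      (sizeToZero D) (𝓝 0) := by
  have hsize : Tendsto (fun i => (D i).size) (sizeToZero D) (𝓝 0) := tendsto_comap
  have hbound : Tendsto (fun i => max |lo| |hi| *
      (B * (θ * d + √(d : ℝ) * θ * (θ * d + 1) + 1) * (D i).size) *
      (volume.real Ω + (d + 2 + 2 * θ ^ 2 * d ^ 2) * C ^ 2)) (sizeToZero D) (𝓝 0) := by
    simpa only [mul_zero, zero_mul] using
      ((hsize.const_mul (B * (θ * d + √(d : ℝ) * θ * (θ * d + 1) + 1))).const_mul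
        (max |lo| |hi|)).mul_const (volume.real Ω + (d + 2 + 2 * θ ^ 2 * d ^ 2) * C ^ 2)
  refine squeeze_zero_norm (fun i => ?_) hbound
  have hB := hφ.nonneg
  have hθ₀ := (D i).theta_nonneg.trans (hD i)
  have hsize₀ := (D i).size_nonneg
  have hw₀ : 0 ≤ (D i).seminormX (w i) := (D i).seminormX_nonneg _
  refine ((D i).abs_form_interp_sub_le hd hΛ hΩ hΩb (hD i) hφ (w i)).trans ?_
  gcongr
  exact hC i

lemma isConsistentFamily_sushiFlux (hd : 0 < d) (hΩo : IsOpen Ω) (hΩb : Bornology.IsBounded Ω)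
    (hΛ : IsDiffusionField Ω lo hi Λ) (hD : ∀ i, (D i).theta ≤ θ) :
    IsConsistentFamily D Λ fun i => (D i).sushiFlux Λ := by
  rintro hne w u hw ⟨C, -, hC⟩ hu hlim
  have hΩ := hΩo.measurableSet
  have hlimit := exists_hasWeakGradient_tendsto_integral_inner_grad hd hΩ hΩb hD hw hC hu hlim
  refine ⟨(hlimit (Ultrafilter.of _) (Ultrafilter.of_le _)).imp fun G hG => hG.1,
    fun G₀ hG₀ φ hφ => tendsto_iff_ultrafilter _ _ _ |>.2 fun U hU => ?_⟩
  obtain ⟨G, hG, hconv⟩ := hlimit U hU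
  obtain ⟨B, hB⟩ := exists_isSmoothBound (contDiff_infty.1 hφ.1 2) hφ.2.1
  have : IsFiniteMeasure (volume.restrict Ω) :=
    isFiniteMeasure_restrict.2 hΩb.measure_lt_top.ne
  set F : Pt d → Pt d := fun x => Matrix.toEuclideanLin (Λ x) (gradient φ x)
  have hF : MemLp (Ω.indicator F) 2 :=
    (memLp_indicator_iff_restrict hΩ).2 (hΛ.memLp_apply hΩ (hB.memLp_gradient 2))
  have hFint : ∀ g : Pt d → Pt d,
      ∫ x, inner ℝ (Ω.indicator F x) (g x) = ∫ x in Ω, inner ℝ (F x) (g x) := by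
    intro g
    rw [← integral_indicator hΩ]
    congr with x
    by_cases hx : x ∈ Ω <;> simp [hx]
  have hgrad : Tendsto (fun i => ∫ x in Ω, inner ℝ ((D i).grad (w i) x) (F x)) U
      (𝓝 (∫ x in Ω, inner ℝ (F x) (G₀ x))) := by
    have hGG₀ : ∫ x in Ω, inner ℝ (F x) (G x) = ∫ x in Ω, inner ℝ (F x) (G₀ x) :=
      integral_congr_ae (((hG.of_univ_indicator hΩ).ae_eq hΩo hG₀).mono fun x hx => by
        simp only [hx])
    rw [← hGG₀, ← hFint]
    exact (hconv _ hF).congr fun i => (hFint _).trans (by simp only [real_inner_comm])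
  have hform := ((tendsto_form_interp_sub hd hΛ hΩ hΩb hD hC hB).mono_left hU).add hgrad
  rw [zero_add] at hform
  exact hform.congr fun i => sub_add_cancel _ _

end Consistency

end Sushi

end

theorem lemma4p4_general {d : ℕ} (hd : 0 < d) {Ω : Set (Sushi.Pt d)} (hΩo : IsOpen Ω)
    (hΩb : Bornology.IsBounded Ω) {lo hi : ℝ} (hlo : 0 < lo)
    {Λ : Sushi.Pt d → Matrix (Fin d) (Fin d) ℝ} (hΛ : Sushi.IsDiffusionField Ω lo hi Λ)
    {ι : Type*} (D : ι → Sushi.Discretisation d Ω) {θ : ℝ} (hD : ∀ i, (D i).theta ≤ θ) :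
    (∀ i, ∀ u v : (D i).X, (D i).form ((D i).sushiFlux Λ) u v =
        ∫ x in Ω, inner ℝ ((D i).grad u x) (Matrix.toEuclideanLin (Λ x) ((D i).grad v x))) ∧
      Sushi.IsContinuousFamily D (fun i => (D i).sushiFlux Λ) ∧
      Sushi.IsCoerciveFamily D (fun i => (D i).sushiFlux Λ) ∧
      Sushi.IsConsistentFamily D Λ (fun i => (D i).sushiFlux Λ) ∧
      Sushi.IsSymmetricFamily D (fun i => (D i).sushiFlux Λ) := by
  have hΩ := hΩo.measurableSet
  have hnorm : 0 < max |lo| |hi| := lt_max_of_lt_left (abs_pos.2 hlo.ne')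
  exact ⟨fun i => (D i).form_sushiFlux_eq_integral hd hΛ hΩ hΩb,
    ⟨max |lo| |hi| * (d + 2 + 2 * θ ^ 2 * d ^ 2), mul_pos hnorm (by positivity),
      fun i => (D i).form_sushiFlux_le hd hΛ hΩ hΩb (hD i)⟩,
    ⟨lo / (2 * (1 + d * θ ^ 2)), by positivity,
      fun i => (D i).le_form_sushiFlux hd hlo.le hΛ hΩ hΩb (hD i)⟩,
    Sushi.isConsistentFamily_sushiFlux hd hΩo hΩb hΛ hD,
    fun i => (D i).form_sushiFlux_comm hΛ hΩ hΩb⟩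

theorem lemma4p4 {d : ℕ} (hd : 0 < d) {Ω : Set (Sushi.Pt d)} (hΩo : IsOpen Ω)
    (hΩb : Bornology.IsBounded Ω) (hΩc : IsConnected Ω)
    {lo hi : ℝ} (hlo : 0 < lo) (hlohi : lo ≤ hi)
    {Λ : Sushi.Pt d → Matrix (Fin d) (Fin d) ℝ} (hΛ : Sushi.IsDiffusionField Ω lo hi Λ)
    {ι : Type*} (D : ι → Sushi.Discretisation d Ω)
    {θ : ℝ} (hθ : 0 < θ) (hD : ∀ i, (D i).theta ≤ θ) :
    (∀ i, ∀ u v : (D i).X, (D i).form ((D i).sushiFlux Λ) u v =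
        ∫ x in Ω, inner ℝ ((D i).grad u x) (Matrix.toEuclideanLin (Λ x) ((D i).grad v x))) ∧
      Sushi.IsContinuousFamily D (fun i => (D i).sushiFlux Λ) ∧
      Sushi.IsCoerciveFamily D (fun i => (D i).sushiFlux Λ) ∧
      Sushi.IsConsistentFamily D Λ (fun i => (D i).sushiFlux Λ) ∧
      Sushi.IsSymmetricFamily D (fun i => (D i).sushiFlux Λ) :=
  lemma4p4_general hd hΩo hΩb hlo hΛ D hD
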